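/- All graphs are finite and simple. For a graph $G$ let $\chi(G)$ be its chromatic number and $\omega(G)$ its clique number; $G$ is claw-free if no set of vertices induces a copy of $K_{1,3}$. For integers $s,t\ge 2$ say that the Erdős–Lovász Tihany conjecture holds for $G$ and the pair $(s,t)$ if the following implication is true: if $\chi(G)=s+t-1>\omega(G)$, then there is a partition $V(G)=S\sqcup T$ with $\chi(G[S])\ge s$ and $\chi(G[T])\ge t$. Then: (i) for all $s,t\ge 2$ with $t\le s+2$, the conjecture holds for $(s,t)$ and every graph $G$ that contains $K_s$ as a subgraph; (ii) for all $s,t\ge 2$ with $t\le 4s-3$, the conjecture holds for $(s,t)$ and every claw-free graph $G$ that contains $K_s$ as a subgraph; (iii) for all $t$ with $2\le t\le 10$ (in particular for $t=10$), the conjecture holds for $(3,t)$ and every claw-free graph $G$; (iv) for all $t$ with $2\le t\le 5$, the conjecture holds for $(3,t)$ and every graph $G$. -/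

import Mathlib

/-- `G` is claw-free: no set of vertices induces a copy of `K_{1,3}`. -/
def ClawFree {V : Type*} (G : SimpleGraph V) : Prop :=
  ∀ W : Set V, IsEmpty (G.induce W ≃g completeBipartiteGraph (Fin 1) (Fin 3))

/-- `G` contains the complete graph `K_s` as a subgraph. -/
def ContainsComplete {V : Type*} (G : SimpleGraph V) (s : ℕ) : Prop :=
  (SimpleGraph.completeGraph (Fin s)).IsContained G

/-- The assertion of the Erdős–Lovász Tihany conjecture for the pair `(s, t)` and the graph `G`:
if `χ(G) = s + t - 1 > ω(G)`, then `V(G)` is the disjoint union of sets `S`, `T` with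
`χ(G[S]) ≥ s` and `χ(G[T]) ≥ t`. (Used only for `s, t ≥ 2`, so the subtraction is genuine.) -/
def ErdosLovaszTihany {V : Type*} (s t : ℕ) (G : SimpleGraph V) : Prop :=
  G.chromaticNumber = ((s + t - 1 : ℕ) : ℕ∞) → G.cliqueNum < s + t - 1 →
    ∃ S T : Set V, Disjoint S T ∧ S ∪ T = Set.univ ∧
      (s : ℕ∞) ≤ (G.induce S).chromaticNumber ∧ (t : ℕ∞) ≤ (G.induce T).chromaticNumber

/-! Put n = t - 1. A counterexample is an `Unsplit` graph: every vertex set is (s - 1)-colourable or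
has an n-colourable complement, no clique has s + n vertices, and s + n - 1 colours do not suffice.
So deleting any clique K with s vertices leaves an n-colourable graph, and in each n-colouring of G
- K every class has a vertex complete to K (`exists_complete_of_coloring`): otherwise the class
could be distributed over the colours of K. Everything rests on this source of common neighbours.

For general graphs, exchanging vertices between two cliques shows that no clique has max(s, n + 1)
vertices (`Unsplit.card_clique_lt_max`). Since K has a common neighbour, this settles n ≤ s. For n =
s + 1 a longest s-th power of a path, on which (s + 1)-colourings are periodic, yields a clique with
s + 2 vertices (`Unsplit.exists_card_clique_of_lt`), one too many. If s = 3 and there is no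
triangle, a shortest odd closed walk is used instead.

For claw-free graphs, K can be chosen so that every x in K is avoidable: some s-clique misses the
closed neighbourhood of x. Then that neighbourhood has an n-colouring d, and d uses no colour more
than twice on the neighbours of x. Label the vertices of K by themselves and the other vertices by
their class in the colouring f of G - K. There are s + n labels but d has n colours, so a Hall type
argument (`exists_disjoint_deficient`) gives s disjoint label sets J, each coloured by d with |J| -
1 colours. Small sets J are recoloured: K with a few classes of f would need one colour fewer than
`CriticalColoring.not_colOn` allows, unless those classes contain vertices missing exactly one
vertex of K. Such near neighbours are scarce, and counting them gives the contradiction: 4s ≤ n + 3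
for s ≥ 4 (`CriticalColoring.four_le_or_two_le`), and finer counts for s = 2 and s = 3. For s = 3
only common neighbours of K enter the labelling, and a second round of counting is made after K is
chosen with fewest common neighbours. -/

/-! ### Colourings of vertex subsets -/

/-- `f` is a proper colouring of the subgraph of `G` induced on `S`. -/
def ProperOn {V α : Type*} (G : SimpleGraph V) (S : Set V) (f : V → α) : Prop :=
  ∀ u ∈ S, ∀ v ∈ S, G.Adj u v → f u ≠ f v

/-- The subgraph of `G` induced on `S` is `n`-colourable. -/
def ColOn {V : Type*} (G : SimpleGraph V) (S : Set V) (n : ℕ) : Prop :=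
  ∃ f : V → ℕ, (∀ u ∈ S, f u < n) ∧ ProperOn G S f

lemma ProperOn.mono {V α : Type*} {G : SimpleGraph V} {S T : Set V} {f : V → α}
    (h : ProperOn G T f) (hST : S ⊆ T) : ProperOn G S f :=
  fun u hu v hv => h u (hST hu) v (hST hv)

lemma ColOn.of_image {V α : Type*} {G : SimpleGraph V} {S : Set V} {n : ℕ} (f : V → α)
    (B : Finset α) (hB : ∀ u ∈ S, f u ∈ B) (hf : ProperOn G S f) (hc : B.card ≤ n) :
    ColOn G S n := by
  classical
  refine ⟨fun u => if h : f u ∈ B then (B.equivFin ⟨f u, h⟩).val else 0, ?_, ?_⟩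
  · intro u hu
    simp only [hB u hu, dif_pos]
    exact lt_of_lt_of_le (Fin.is_lt _) hc
  · intro u hu v hv huv h
    simp only [hB u hu, hB v hv, dif_pos] at h
    have := B.equivFin.injective (Fin.ext h)
    exact hf u hu v hv huv (by simpa using this)

lemma ColOn.mono {V : Type*} {G : SimpleGraph V} {S T : Set V} {n m : ℕ}
    (h : ColOn G T n) (hST : S ⊆ T) (hnm : n ≤ m) : ColOn G S m := by
  obtain ⟨f, hf, hp⟩ := h
  exact ⟨f, fun u hu => (hf u (hST hu)).trans_le hnm, hp.mono hST⟩

lemma ColOn.union {V : Type*} {G : SimpleGraph V} {S T : Set V} {a b : ℕ}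
    (hS : ColOn G S a) (hT : ColOn G T b) : ColOn G (S ∪ T) (a + b) := by
  classical
  obtain ⟨f, hf, hfp⟩ := hS
  obtain ⟨g, hg, hgp⟩ := hT
  have key : ∀ u ∈ S ∪ T, u ∉ S → u ∈ T := fun u hu h => hu.resolve_left h
  refine ⟨fun u => if u ∈ S then f u else a + g u, ?_, ?_⟩
  · intro u hu
    by_cases h : u ∈ S
    · simp only [h, if_true]; have := hf u h; omega
    · simp only [h, if_false]; have := hg u (key u hu h); omega
  · intro u hu v hv huv
    by_cases h : u ∈ S <;> by_cases h' : v ∈ S <;> simp only [h, h', if_true, if_false]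
    · exact hfp u h v h' huv
    · have := hf u h; omega
    · have := hf v h'; omega
    · have := hgp u (key u hu h) v (key v hv h') huv; omega

lemma ColOn.card_clique_le {V : Type*} {G : SimpleGraph V} {S : Set V} {n : ℕ}
    (h : ColOn G S n) (K : Finset V) (hK : G.IsClique (K : Set V)) (hKS : (K : Set V) ⊆ S) :
    K.card ≤ n := by
  classical
  obtain ⟨f, hf, hp⟩ := h
  have h1 : K.card ≤ (Finset.range n).card := by
    refine Finset.card_le_card_of_injOn f ?_ ?_
    · intro u hu
      simpa using hf u (hKS hu)
    · intro u hu v hv huv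
      by_contra hne
      exact hp u (hKS hu) v (hKS hv) (hK hu hv hne) huv
  simpa using h1

lemma colOn_of_colorable_induce {V : Type*} {G : SimpleGraph V} {S : Set V} {n : ℕ}
    (h : (G.induce S).Colorable n) : ColOn G S n := by
  classical
  obtain ⟨c⟩ := h
  refine ⟨fun u => if h : u ∈ S then (c ⟨u, h⟩).val else 0, ?_, ?_⟩
  · intro u hu
    simp [hu]
  · intro u hu v hv huv he
    simp only [hu, hv, dif_pos] at he
    exact c.valid (v := ⟨u, hu⟩) (w := ⟨v, hv⟩) (by simpa using huv) (Fin.ext he)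

lemma ColOn.colorable {V : Type*} {G : SimpleGraph V} {n : ℕ}
    (h : ColOn G Set.univ n) : G.Colorable n := by
  obtain ⟨f, hf, hp⟩ := h
  exact ⟨SimpleGraph.Coloring.mk (fun u => (⟨f u, hf u trivial⟩ : Fin n))
    (fun {u v} huv he => hp u trivial v trivial huv (by simpa using he))⟩

lemma le_chromaticNumber_induce {V : Type*} {G : SimpleGraph V} {S : Set V} {n : ℕ} (hn : 1 ≤ n)
    (h : ¬ ColOn G S (n - 1)) : (n : ℕ∞) ≤ (G.induce S).chromaticNumber := by
  rw [SimpleGraph.le_chromaticNumber_iff_colorable]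
  intro m hm
  by_contra hlt
  exact h ((colOn_of_colorable_induce hm).mono subset_rfl (by omega))

/-! ### Counterexamples and common neighbours of cliques -/

/-- `G` is neither `(s + n - 1)`-colourable nor contains a clique of size `s + n`, and it has no
vertex partition whose parts have chromatic numbers at least `s` and `n + 1`. -/
structure Unsplit {V : Type*} (G : SimpleGraph V) (s n : ℕ) : Prop where
  split : ∀ S : Set V, ColOn G S (s - 1) ∨ ColOn G Sᶜ n
  clique : ∀ K : Finset V, G.IsClique (K : Set V) → K.card < s + n
  notCol : ¬ ColOn G Set.univ (s + n - 1)

lemma erdosLovaszTihany_of_not_unsplit {V : Type*} [Finite V] {G : SimpleGraph V} {s t : ℕ}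
    (hs : 2 ≤ s) (ht : 2 ≤ t) (h : ¬ Unsplit G s (t - 1)) : ErdosLovaszTihany s t G := by
  intro hχ hω
  by_contra hno
  refine h ⟨?_, ?_, ?_⟩
  · intro S
    by_contra hS
    push Not at hS
    exact hno ⟨S, Sᶜ, disjoint_compl_right, Set.union_compl_self S,
      le_chromaticNumber_induce (by omega) hS.1, le_chromaticNumber_induce (by omega) hS.2⟩
  · intro K hK
    have := hK.card_le_cliqueNum
    omega
  · intro hc
    have h1 := hc.colorable.chromaticNumber_le
    rw [hχ] at h1
    have h2 : s + t - 1 ≤ s + (t - 1) - 1 := by exact_mod_cast h1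
    omega

lemma Unsplit.colOn_compl {V : Type*} {G : SimpleGraph V} {s n : ℕ} (h : Unsplit G s n)
    (hs : 1 ≤ s) {K : Finset V} (hK : G.IsClique (K : Set V)) (hc : s ≤ K.card) :
    ColOn G (K : Set V)ᶜ n := by
  rcases h.split K with h1 | h1
  · have := h1.card_clique_le K hK subset_rfl
    omega
  · exact h1

/-- If `G` minus a clique `K` is coloured with `n` colours and `G` has no colouring with
`|K| + n - 1` colours, then every colour class has a vertex complete to `K`. -/
lemma exists_complete_of_coloring {V : Type*} {G : SimpleGraph V} {K : Finset V} {n : ℕ}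
    {f : V → ℕ} (hf : ∀ u ∉ K, f u < n) (hp : ProperOn G (K : Set V)ᶜ f)
    (h : ¬ ColOn G Set.univ (K.card + n - 1)) {i : ℕ} (hi : i < n) :
    ∃ y ∉ K, f y = i ∧ ∀ x ∈ K, G.Adj x y := by
  classical
  by_contra hno
  push Not at hno
  have hg : ∀ y, ∃ x, y ∉ K → f y = i → x ∈ K ∧ ¬ G.Adj x y := by
    intro y
    by_cases h1 : y ∉ K ∧ f y = i
    · obtain ⟨x, hx, hxy⟩ := hno y h1.1 h1.2
      exact ⟨x, fun _ _ => ⟨hx, hxy⟩⟩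
    · exact ⟨y, fun a b => absurd ⟨a, b⟩ h1⟩
  choose g hg using hg
  -- Each vertex `u` of class `i` takes the colour of its nonneighbour `g u` in `K`. The class is
  -- independent and only `g u` owns that colour inside `K`, so nothing clashes and colour `i` is
  -- saved.
  refine h (ColOn.of_image (α := V ⊕ ℕ)
    (fun u => if u ∈ K then Sum.inl u else if f u = i then Sum.inl (g u) else Sum.inr (f u))
    (K.disjSum ((Finset.range n).erase i)) ?_ ?_ ?_)
  · intro u _
    by_cases h1 : u ∈ K
    · simp [h1]
    · by_cases h2 : f u = i
      · simp [h1, h2, (hg u h1 h2).1]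
      · simp [h1, h2, hf u h1]
  · intro u _ v _ huv
    by_cases h1 : u ∈ K <;> by_cases h2 : v ∈ K
    · simp [h1, h2, huv.ne]
    · by_cases h4 : f v = i
      · simp only [h1, h2, h4, if_true, if_false, ne_eq, Sum.inl.injEq]
        rintro rfl
        exact (hg v h2 h4).2 huv
      · simp [h1, h2, h4]
    · by_cases h4 : f u = i
      · simp only [h1, h2, h4, if_true, if_false, ne_eq, Sum.inl.injEq]
        intro h5
        exact (hg u h1 h4).2 (h5 ▸ huv.symm)
      · simp [h1, h2, h4]
    · have h3 := hp u (by simpa using h1) v (by simpa using h2) huv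
      by_cases h4 : f u = i <;> by_cases h5 : f v = i
      · exact absurd (h4.trans h5.symm) h3
      · simp [h1, h2, h4, h5]
      · simp [h1, h2, h4, h5]
      · simp [h1, h2, h4, h5, h3]
  · rw [Finset.card_disjSum, Finset.card_erase_of_mem (by simpa using hi), Finset.card_range]
    omega

/-- Extending a colouring of `K` and some colour classes to the whole graph. -/
lemma colOn_univ_of_classes {V : Type*} {G : SimpleGraph V} {K : Finset V} {n a : ℕ}
    {f : V → ℕ} (hf : ∀ u ∉ K, f u < n) (hp : ProperOn G (K : Set V)ᶜ f) (J : Finset ℕ)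
    (hJ : ∀ j ∈ J, j < n) (h : ColOn G {v | v ∈ K ∨ f v ∈ J} a) :
    ColOn G Set.univ (a + (n - J.card)) := by
  classical
  have h2 : ColOn G {v | v ∉ K ∧ f v ∉ J} (n - J.card) := by
    refine ColOn.of_image f (Finset.range n \ J) ?_ (hp.mono fun v hv => by simpa using hv.1) ?_
    · intro u hu
      simpa using ⟨hf u hu.1, hu.2⟩
    · rw [Finset.card_sdiff_of_subset (fun j hj => by simpa using hJ j hj), Finset.card_range]
  refine (h.union h2).mono ?_ le_rfl
  intro v _
  by_cases h1 : v ∈ K <;> by_cases h3 : f v ∈ J <;> simp [h1, h3]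

/-! ### Excluding large cliques -/

lemma Unsplit.not_disjoint_cliques {V : Type*} {G : SimpleGraph V} {s n : ℕ} (h : Unsplit G s n)
    (hs : 1 ≤ s) {S T : Finset V} (hS : G.IsClique (S : Set V)) (hT : G.IsClique (T : Set V))
    (hd : Disjoint S T) (hSc : s ≤ S.card) : T.card ≤ n :=
  (h.colOn_compl hs hS hSc).card_clique_le T hT fun _ hv hv' =>
    Finset.disjoint_left.1 hd hv' hv

lemma isClique_insert_finset {V : Type*} [DecidableEq V] {G : SimpleGraph V} {S : Finset V} {v : V}
    (hS : G.IsClique (S : Set V)) (hv : ∀ x ∈ S, G.Adj x v) :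
    G.IsClique ((insert v S : Finset V) : Set V) := by
  rw [Finset.coe_insert]
  exact hS.insert fun b hb _ => (hv b hb).symm

/-- `S` is enlarged until it has `s` vertices and, with `T`, contradicts
`Unsplit.not_disjoint_cliques`. A further vertex complete to `T` can replace some `x` of `X` in `T`,
so that `x` moves to `S`. If there is no such vertex, then `S` itself supplies all common neighbours
of `T`, and `S ∪ T` is too large a clique. -/
lemma Unsplit.no_clique_exchange {V : Type*} {G : SimpleGraph V} {s n : ℕ}
    (h : Unsplit G s n) (hs : 2 ≤ s) (j : ℕ) : ∀ T S X : Finset V, G.IsClique (T : Set V) →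
    T.card = n + 1 → Disjoint S T → X ⊆ T → G.IsClique ((S : Set V) ∪ X) →
    s ≤ S.card + X.card → S.card + j = s → False := by
  classical
  induction j with
  | zero =>
    intro T S X hT hTc hd _ hSX _ hSc
    have := h.not_disjoint_cliques (by omega) (hSX.subset Set.subset_union_left) hT hd (by omega)
    omega
  | succ j ih =>
    intro T S X hT hTc hd hXT hSX hcard hSc
    by_cases hv : ∃ v ∉ S, v ∉ T ∧ ∀ x ∈ T, G.Adj x v
    · obtain ⟨v, hvS, hvT, hv⟩ := hv
      have hX : 0 < X.card := by omega
      obtain ⟨x, hx⟩ := Finset.card_pos.1 hX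
      have hxT := hXT hx
      have hxS : x ∉ S := fun hxS => Finset.disjoint_left.1 hd hxS hxT
      have hvx : v ≠ x := fun e => hvT (e ▸ hxT)
      refine ih (insert v (T.erase x)) (insert x S) (X.erase x) ?_ ?_ ?_ ?_ ?_ ?_ ?_
      · exact isClique_insert_finset (hT.subset (by simp)) fun y hy => hv y (Finset.mem_of_mem_erase hy)
      · rw [Finset.card_insert_of_notMem (fun h' => hvT (Finset.mem_of_mem_erase h')),
          Finset.card_erase_of_mem hxT]
        omega
      · rw [Finset.disjoint_left]
        intro a ha ha'
        rw [Finset.mem_insert] at ha ha'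
        rcases ha with rfl | ha
        · rcases ha' with ha' | ha'
          · exact hvx ha'.symm
          · simp at ha'
        · rcases ha' with rfl | ha'
          · exact hvS ha
          · exact Finset.disjoint_left.1 hd ha (Finset.mem_of_mem_erase ha')
      · intro a ha
        exact Finset.mem_insert_of_mem
          (Finset.mem_erase.2 ⟨Finset.ne_of_mem_erase ha, hXT (Finset.mem_of_mem_erase ha)⟩)
      · refine hSX.subset ?_
        intro a ha
        rcases ha with ha | ha
        · rw [Finset.mem_coe, Finset.mem_insert] at ha
          rcases ha with rfl | ha
          · exact Or.inr hx
          · exact Or.inl ha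
        · exact Or.inr (Finset.mem_of_mem_erase ha)
      · rw [Finset.card_insert_of_notMem hxS, Finset.card_erase_of_mem hx]
        omega
      · rw [Finset.card_insert_of_notMem hxS]
        omega
    · push Not at hv
      -- The clique `T` has `n + 1` vertices and is not `n`-colourable, so the other alternative of
      -- the split holds. Its `s - 1` classes give `s - 1` common neighbours of `T`, all in `S`, and
      -- `S` has at most `s - 1` vertices.
      obtain ⟨f, hf, hp⟩ : ColOn G (T : Set V)ᶜ (s - 1) := by
        rcases h.split (T : Set V)ᶜ with h1 | h1
        · exact h1
        · rw [compl_compl] at h1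
          have := h1.card_clique_le T hT subset_rfl
          omega
      have hex : ∀ i : ℕ, ∃ y, i < s - 1 → y ∈ S ∧ f y = i ∧ ∀ x ∈ T, G.Adj x y := by
        intro i
        by_cases hi : i < s - 1
        · obtain ⟨y, hyT, hfy, hy⟩ := exists_complete_of_coloring (K := T)
            (fun u hu => hf u (by simpa using hu)) hp
            (by rw [hTc]; convert h.notCol using 2; omega) hi
          refine ⟨y, fun _ => ⟨?_, hfy, hy⟩⟩
          by_contra hyS
          obtain ⟨x, hx, hxy⟩ := hv y hyS hyT
          exact hxy (hy x hx)
        · have : 0 < T.card := by omega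
          obtain ⟨y, _⟩ := Finset.card_pos.1 this
          exact ⟨y, fun h' => absurd h' hi⟩
      choose y hy using hex
      have hYS : (Finset.range (s - 1)).image y ⊆ S := by
        intro a ha
        obtain ⟨i, hi, rfl⟩ := Finset.mem_image.1 ha
        exact (hy i (by simpa using hi)).1
      have hYc : ((Finset.range (s - 1)).image y).card = s - 1 := by
        rw [Finset.card_image_of_injOn, Finset.card_range]
        intro i hi i' hi' he
        have h1 := (hy i (by simpa using hi)).2.1
        have h2 := (hy i' (by simpa using hi')).2.1
        have h3 : y i = y i' := he
        rw [← h1, ← h2, h3]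
      have hYeq : (Finset.range (s - 1)).image y = S :=
        Finset.eq_of_subset_of_card_le hYS (by omega)
      have hcl := h.clique (S ∪ T) ?_
      · rw [Finset.card_union_of_disjoint hd, ← hYeq] at hcl
        omega
      · have hST : ∀ a ∈ S, ∀ x ∈ T, G.Adj x a := by
          intro a ha
          rw [← hYeq] at ha
          obtain ⟨i, hi, rfl⟩ := Finset.mem_image.1 ha
          exact (hy i (by simpa using hi)).2.2
        rw [Finset.coe_union]
        intro a ha b hb hab
        rcases ha with ha | ha <;> rcases hb with hb | hb
        · exact hSX (Or.inl ha) (Or.inl hb) hab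
        · exact (hST a ha b hb).symm
        · exact hST b hb a ha
        · exact hT ha hb hab

lemma Unsplit.card_clique_lt_max {V : Type*} {G : SimpleGraph V} {s n : ℕ}
    (h : Unsplit G s n) (hs : 2 ≤ s) (hn : 1 ≤ n) {L : Finset V} (hL : G.IsClique (L : Set V)) :
    L.card < max s (n + 1) := by
  classical
  by_contra hlt
  push Not at hlt
  obtain ⟨L', hL', hc⟩ := Finset.exists_subset_card_eq hlt
  have hcl : G.IsClique (L' : Set V) := hL.subset (by simpa using hL')
  obtain ⟨T, hT, hTc⟩ := Finset.exists_subset_card_eq (s := L') (n := n + 1) (by omega)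
  have h1 : (L' \ T).card = L'.card - T.card := Finset.card_sdiff_of_subset hT
  refine h.no_clique_exchange hs (s - (L' \ T).card) T (L' \ T) T (hcl.subset (by simpa using hT))
    hTc Finset.sdiff_disjoint subset_rfl (hcl.subset ?_) ?_ ?_
  · intro a ha
    rcases ha with ha | ha
    · exact (Finset.mem_sdiff.1 ha).1
    · exact hT ha
  · omega
  · omega

/-! ### Powers of paths and the case n = s + 1 -/

/-- Among `s + 2` consecutive terms only the first and the last may agree, and they must, since only
`s + 1` values are available. -/
lemma periodic_of_window_injective {s a b : ℕ} {c : ℕ → ℕ}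
    (hc : ∀ j, a ≤ j → j < b → c j < s + 1)
    (hi : ∀ i j, a ≤ i → i < j → j < b → j ≤ i + s → c i ≠ c j) {j : ℕ} (hj : a ≤ j)
    (hb : j + s + 1 < b) : c (j + s + 1) = c j := by
  classical
  by_contra hne
  have hinj : Set.InjOn c (Finset.Icc j (j + s + 1)) := by
    intro x hx y hy hxy
    simp only [Finset.coe_Icc, Set.mem_Icc] at hx hy
    by_contra hxy'
    rcases Nat.lt_or_ge x y with h1 | h1
    · by_cases h2 : y ≤ x + s
      · exact hi x y (by omega) h1 (by omega) h2 hxy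
      · have h3 : x = j := by omega
        have h4 : y = j + s + 1 := by omega
        subst h3 h4
        exact hne hxy.symm
    · by_cases h2 : x ≤ y + s
      · exact hi y x (by omega) (by omega) (by omega) h2 hxy.symm
      · have h3 : y = j := by omega
        have h4 : x = j + s + 1 := by omega
        subst h3 h4
        exact hne hxy
  have := Finset.card_le_card_of_injOn (t := Finset.range (s + 1)) c (by
    intro x hx
    simp only [Finset.coe_Icc, Set.mem_Icc] at hx
    simpa using hc x (by omega) (by omega)) hinj
  simp at this
  omega

lemma eq_iff_modEq_of_window_injective {s a b : ℕ} {c : ℕ → ℕ}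
    (hc : ∀ j, a ≤ j → j < b → c j < s + 1)
    (hi : ∀ i j, a ≤ i → i < j → j < b → j ≤ i + s → c i ≠ c j) {i j : ℕ} (hai : a ≤ i)
    (hij : i ≤ j) (hjb : j < b) : c i = c j ↔ (s + 1) ∣ j - i := by
  have key : ∀ q r, a ≤ r → r + q * (s + 1) < b → c (r + q * (s + 1)) = c r := by
    intro q
    induction q with
    | zero => intro r _ _; simp
    | succ q ih =>
      intro r hr hrb
      have e : r + (q + 1) * (s + 1) = (r + q * (s + 1)) + s + 1 := by ring
      rw [e] at hrb ⊢
      rw [periodic_of_window_injective hc hi (by omega) hrb, ih r hr (by omega)]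
  have h1 := Nat.mod_add_div (j - i) (s + 1)
  set r := (j - i) % (s + 1) with hr
  set q := (j - i) / (s + 1)
  have hrlt : r < s + 1 := Nat.mod_lt _ (by omega)
  have hq : q * (s + 1) = (s + 1) * q := by ring
  have h2 : c j = c (i + r) := by
    rw [← key q (i + r) (by omega) (by omega)]
    congr 1
    omega
  rw [h2, Nat.dvd_iff_mod_eq_zero, ← hr]
  constructor
  · intro h3
    by_contra h4
    exact hi i (i + r) hai (by omega) (by omega) (by omega) h3
  · intro h3
    rw [h3, add_zero]

/-- `p 0, …, p (m - 1)` is the `s`-th power of a path. -/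
def IsPathPower {V : Type*} (G : SimpleGraph V) (s m : ℕ) (p : ℕ → V) : Prop :=
  (∀ i j, i < j → j < m → p i ≠ p j) ∧ ∀ i j, i < j → j < m → j ≤ i + s → G.Adj (p i) (p j)

lemma IsPathPower.isClique_image {V : Type*} [DecidableEq V] {G : SimpleGraph V} {s m : ℕ}
    {p : ℕ → V} (h : IsPathPower G s m p) {a b : ℕ} (hb : b ≤ m) (hab : b ≤ a + s + 1) :
    G.IsClique (((Finset.Ico a b).image p : Finset V) : Set V) := by
  intro x hx y hy hxy
  rw [Finset.mem_coe, Finset.mem_image] at hx hy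
  obtain ⟨i, hi, rfl⟩ := hx
  obtain ⟨j, hj, rfl⟩ := hy
  rw [Finset.mem_Ico] at hi hj
  rcases Nat.lt_trichotomy i j with h1 | h1 | h1
  · exact h.2 i j h1 (by omega) (by omega)
  · exact absurd (by rw [h1]) hxy
  · exact (h.2 j i h1 (by omega) (by omega)).symm

lemma IsPathPower.inj {V : Type*} {G : SimpleGraph V} {s m : ℕ}
    {p : ℕ → V} (h : IsPathPower G s m p) {i j : ℕ} (hi : i < m) (hj : j < m) (he : p i = p j) :
    i = j := by
  rcases Nat.lt_trichotomy i j with h1 | h1 | h1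
  · exact absurd he (h.1 i j h1 hj)
  · exact h1
  · exact absurd he.symm (h.1 j i h1 hi)

lemma IsPathPower.card_image {V : Type*} [DecidableEq V] {G : SimpleGraph V} {s m : ℕ}
    {p : ℕ → V} (h : IsPathPower G s m p) {a b : ℕ} (hb : b ≤ m) :
    ((Finset.Ico a b).image p).card = b - a := by
  rw [Finset.card_image_of_injOn, Nat.card_Ico]
  intro i hi j hj hij
  simp only [Finset.coe_Ico, Set.mem_Ico] at hi hj
  exact h.inj (by omega) (by omega) hij

lemma exists_maximal_pathPower {V : Type*} [Finite V] {G : SimpleGraph V} {K : Finset V}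
    (hK : G.IsClique (K : Set V)) (hne : K.Nonempty) : ∃ m p, K.card ≤ m ∧
    IsPathPower G K.card m p ∧ ∀ q, ¬ IsPathPower G K.card (m + 1) q := by
  classical
  have := Fintype.ofFinite V
  have h0 : ∃ p, IsPathPower G K.card K.card p := by
    obtain ⟨v, _⟩ := hne
    have hinj : ∀ (i j : ℕ) (hi : i < K.card) (hj : j < K.card), i < j →
        ((K.equivFin.symm ⟨i, hi⟩ : K) : V) ≠ (K.equivFin.symm ⟨j, hj⟩ : K) := by
      intro i j hi hj hij he
      have := K.equivFin.symm.injective (Subtype.ext he)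
      simp at this
      omega
    refine ⟨fun i => if h : i < K.card then (K.equivFin.symm ⟨i, h⟩ : K) else v, ?_, ?_⟩
    · intro i j hij hj
      have hi : i < K.card := by omega
      simp only [hi, hj, dif_pos]
      exact hinj i j hi hj hij
    · intro i j hij hj _
      have hi : i < K.card := by omega
      simp only [hi, hj, dif_pos]
      exact hK (Subtype.coe_prop _) (Subtype.coe_prop _) (hinj i j hi hj hij)
  have hbd : ∀ m p, IsPathPower G K.card m p → m ≤ Fintype.card V := by
    intro m p h
    have h1 := h.card_image (a := 0) le_rfl
    have h2 := Finset.card_le_univ ((Finset.Ico 0 m).image p)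
    omega
  by_contra hno
  push Not at hno
  have hall : ∀ j, ∃ p, IsPathPower G K.card (K.card + j) p := by
    intro j
    induction j with
    | zero => exact h0
    | succ j ih =>
      obtain ⟨p, hp⟩ := ih
      exact hno (K.card + j) p (Nat.le_add_right _ _) hp
  obtain ⟨p, hp⟩ := hall (Fintype.card V + 1)
  have := hbd _ p hp
  omega

/-- Without such a clique, the common neighbours of the last `s` vertices `W` of a longest path
power are pairwise nonadjacent, and by maximality they all lie on the path. A final segment starting
at a suitable one of them cannot be `(s + 1)`-coloured, because a colouring of it and the colouring
`f` of `G - W` would have the same period. Yet that segment avoids the clique formed by the first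
`s` vertices. -/
lemma Unsplit.exists_card_clique_of_lt {V : Type*} [Finite V] {G : SimpleGraph V} {s : ℕ}
    (h : Unsplit G s (s + 1)) (hs : 2 ≤ s) {K : Finset V} (hK : G.IsClique (K : Set V))
    (hKc : K.card = s) : ∃ L : Finset V, G.IsClique (L : Set V) ∧ L.card = s + 2 := by
  classical
  by_contra hno
  push Not at hno
  obtain ⟨m, p, hm, hp, hmax⟩ := exists_maximal_pathPower hK (Finset.card_pos.1 (by omega))
  rw [hKc] at hm hp hmax
  set W := (Finset.Ico (m - s) m).image p with hW
  have hWcl : G.IsClique (W : Set V) := hp.isClique_image le_rfl (by omega)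
  have hWc : W.card = s := by rw [hW, hp.card_image le_rfl]; omega
  have hmemW : ∀ j, j < m → (p j ∈ W ↔ m - s ≤ j) := by
    intro j hj
    rw [hW, Finset.mem_image]
    constructor
    · rintro ⟨i, hi, he⟩
      rw [Finset.mem_Ico] at hi
      have := hp.inj hi.2 hj he
      omega
    · intro h1
      exact ⟨j, by simp; omega, rfl⟩
  obtain ⟨f, hf, hfp⟩ := h.colOn_compl (by omega) hWcl hWc.ge
  have hcom : ∀ i < s + 1, ∃ j, j < m - s ∧ f (p j) = i ∧ ∀ x ∈ W, G.Adj x (p j) := by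
    intro i hi
    obtain ⟨y, hyW, hfy, hy⟩ := exists_complete_of_coloring
      (fun u hu => hf u (by simpa using hu)) hfp (by rw [hWc]; exact h.notCol) hi
    by_cases hex : ∃ j < m, p j = y
    · obtain ⟨j, hj, rfl⟩ := hex
      refine ⟨j, ?_, hfy, hy⟩
      have := mt (hmemW j hj).2 hyW
      omega
    · exfalso
      push Not at hex
      -- A common neighbour of `W` off the path would prolong it.
      refine hmax (fun j => if j = m then y else p j) ⟨?_, ?_⟩
      · intro i j hij hj
        have hi : i ≠ m := by omega
        by_cases hjm : j = m
        · simp only [hi, hjm, if_true, if_false]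
          exact hex i (by omega)
        · simp only [hi, hjm, if_false]
          exact hp.1 i j hij (by omega)
      · intro i j hij hj hjs
        have hi : i ≠ m := by omega
        by_cases hjm : j = m
        · simp only [hi, hjm, if_true, if_false]
          exact hy _ ((hmemW i (by omega)).2 (by omega))
        · simp only [hi, hjm, if_false]
          exact hp.2 i j hij (by omega) hjs
  have hind : ∀ y z, (∀ x ∈ W, G.Adj x y) → (∀ x ∈ W, G.Adj x z) → ¬ G.Adj y z := by
    intro y z hy hz hyz
    have hyW : y ∉ W := fun h' => (hy y h').ne rfl
    have hzW : z ∉ insert y W := by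
      rw [Finset.mem_insert, not_or]
      exact ⟨hyz.ne', fun h' => (hz z h').ne rfl⟩
    refine hno (insert z (insert y W)) (isClique_insert_finset (isClique_insert_finset hWcl hy) ?_) ?_
    · intro x hx
      rw [Finset.mem_insert] at hx
      rcases hx with rfl | hx
      · exact hyz
      · exact hz x hx
    · rw [Finset.card_insert_of_notMem hzW, Finset.card_insert_of_notMem hyW, hWc]
  obtain ⟨j0, hj0, -⟩ := hcom 0 (by omega)
  set js := m - s - 1 with hjs
  have hjsW : ∀ x ∈ W, G.Adj x (p js) := by
    intro x hx
    rw [hW, Finset.mem_image] at hx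
    obtain ⟨i, hi, rfl⟩ := hx
    rw [Finset.mem_Ico] at hi
    exact (hp.2 js i (by omega) hi.2 (by omega)).symm
  -- `p js` is the vertex just before `W`. There are at least three colours, so two common
  -- neighbours of `W` have colours other than that of `p js`; `j2` is the later one.
  have hpick : ∃ j1 j2, j1 < j2 ∧ j2 < m - s ∧ (∀ x ∈ W, G.Adj x (p j1)) ∧
      (∀ x ∈ W, G.Adj x (p j2)) ∧ f (p j2) ≠ f (p js) := by
    have hcol : ∃ i1 i2, i1 < s + 1 ∧ i2 < s + 1 ∧ i1 ≠ i2 ∧ i1 ≠ f (p js) ∧ i2 ≠ f (p js) := by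
      by_cases h0 : f (p js) = 0
      · exact ⟨1, 2, by omega, by omega, by omega, by omega, by omega⟩
      · by_cases h1 : f (p js) = 1
        · exact ⟨0, 2, by omega, by omega, by omega, by omega, by omega⟩
        · exact ⟨0, 1, by omega, by omega, by omega, by omega, by omega⟩
    obtain ⟨i1, i2, h1, h2, h12, hn1, hn2⟩ := hcol
    obtain ⟨j1, hj1, hf1, ha1⟩ := hcom i1 h1
    obtain ⟨j2, hj2, hf2, ha2⟩ := hcom i2 h2
    have hne : j1 ≠ j2 := fun e => h12 (by rw [← hf1, ← hf2, e])
    rcases lt_or_gt_of_ne hne with hlt | hlt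
    · exact ⟨j1, j2, hlt, hj2, ha1, ha2, by rw [hf2]; exact hn2⟩
    · exact ⟨j2, j1, hlt, hj1, ha2, ha1, by rw [hf1]; exact hn1⟩
  obtain ⟨j1, j2, h12, hj2, ha1, ha2, hne⟩ := hpick
  have hgap : j1 + s < j2 := by
    by_contra hle
    exact hind _ _ ha1 ha2 (hp.2 j1 j2 h12 (by omega) (by omega))
  have hF : ¬ ColOn G (((Finset.Ico j2 m).image p : Finset V) : Set V) (s + 1) := by
    rintro ⟨d, hd, hdp⟩
    have hmem : ∀ j, j2 ≤ j → j < m → p j ∈ (((Finset.Ico j2 m).image p : Finset V) : Set V) := by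
      intro j h1 h2
      rw [Finset.mem_coe, Finset.mem_image]
      exact ⟨j, by simp; omega, rfl⟩
    have hWF : ∀ x ∈ W, x ∈ (((Finset.Ico j2 m).image p : Finset V) : Set V) := by
      intro x hx
      rw [hW, Finset.mem_image] at hx
      obtain ⟨i, hi, rfl⟩ := hx
      rw [Finset.mem_Ico] at hi
      exact hmem i (by omega) hi.2
    -- Both vertices are complete to `W`, and `W` leaves only one of the `s + 1` colours.
    have hdd : d (p j2) = d (p js) := by
      by_contra hdne
      have hWd : (W.image d).card = s := by
        rw [Finset.card_image_of_injOn, hWc]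
        intro x hx y hy hxy
        by_contra hxy'
        exact hdp x (hWF x hx) y (hWF y hy) (hWcl hx hy hxy') hxy
      have h1 : d (p js) ∉ W.image d := by
        intro h1
        obtain ⟨x, hx, he⟩ := Finset.mem_image.1 h1
        exact hdp x (hWF x hx) _ (hmem js (by omega) (by omega)) (hjsW x hx) he
      have h2 : d (p j2) ∉ insert (d (p js)) (W.image d) := by
        rw [Finset.mem_insert, not_or]
        refine ⟨hdne, fun h1 => ?_⟩
        obtain ⟨x, hx, he⟩ := Finset.mem_image.1 h1
        exact hdp x (hWF x hx) _ (hmem j2 (by omega) (by omega)) (ha2 x hx) he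
      have h3 : insert (d (p j2)) (insert (d (p js)) (W.image d)) ⊆ Finset.range (s + 1) := by
        intro a ha
        rw [Finset.mem_range]
        simp only [Finset.mem_insert, Finset.mem_image] at ha
        rcases ha with rfl | rfl | ⟨x, hx, rfl⟩
        · exact hd _ (hmem j2 (by omega) (by omega))
        · exact hd _ (hmem js (by omega) (by omega))
        · exact hd _ (hWF x hx)
      have h4 := Finset.card_le_card h3
      rw [Finset.card_insert_of_notMem h2, Finset.card_insert_of_notMem h1, hWd,
        Finset.card_range] at h4
      omega
    have h1 : (s + 1) ∣ js - j2 :=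
      (eq_iff_modEq_of_window_injective (c := fun j => d (p j)) (a := j2) (b := m)
        (fun j h1 h2 => hd _ (hmem j h1 h2))
        (fun i j h1 h2 h3 h4 => hdp _ (hmem i h1 (by omega)) _ (hmem j (by omega) h3)
          (hp.2 i j h2 h3 h4)) le_rfl (by omega) (by omega)).1 hdd
    have hnW : ∀ j, j < m - s → p j ∈ (W : Set V)ᶜ := by
      intro j hj
      have := mt (hmemW j (by omega)).1 (by omega)
      simpa using this
    exact hne ((eq_iff_modEq_of_window_injective (c := fun j => f (p j)) (a := 0) (b := m - s)
        (fun j h1 h2 => hf _ (hnW j h2))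
        (fun i j h1 h2 h3 h4 => hfp _ (hnW i (by omega)) _ (hnW j h3)
          (hp.2 i j h2 (by omega) h4)) (by omega) (by omega) (by omega)).2 h1)
  have hS0 : G.IsClique (((Finset.Ico 0 s).image p : Finset V) : Set V) :=
    hp.isClique_image hm (by omega)
  have hS0c : ((Finset.Ico 0 s).image p).card = s := by rw [hp.card_image hm]; omega
  -- As `j2 > j1 + s`, the segment from `j2` on is disjoint from the first `s` vertices.
  refine hF ((h.colOn_compl (by omega) hS0 hS0c.ge).mono ?_ le_rfl)
  intro x hx hx'
  rw [Finset.mem_coe, Finset.mem_image] at hx hx'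
  obtain ⟨i, hi, rfl⟩ := hx
  obtain ⟨j, hj, he⟩ := hx'
  rw [Finset.mem_Ico] at hi hj
  have := hp.inj (by omega) hi.2 he
  omega

/-- A common neighbour turns `K` into a clique with `s + 1` vertices. The bound `max s (n + 1)` then
leaves only `n = s + 1`, where a clique with `s + 2` vertices violates it. -/
lemma not_unsplit_of_le {V : Type*} [Finite V] {G : SimpleGraph V} {s n : ℕ} (hs : 2 ≤ s)
    (hn : 1 ≤ n) (hns : n ≤ s + 1) {K : Finset V} (hK : G.IsClique (K : Set V))
    (hKc : K.card = s) : ¬ Unsplit G s n := by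
  classical
  intro h
  obtain ⟨f, hf, hp⟩ := h.colOn_compl (by omega) hK hKc.ge
  obtain ⟨y, hyK, -, hy⟩ := exists_complete_of_coloring (i := 0)
    (fun u hu => hf u (by simpa using hu)) hp (by rw [hKc]; exact h.notCol) hn
  have h1 := h.card_clique_lt_max hs hn (isClique_insert_finset hK hy)
  rw [Finset.card_insert_of_notMem hyK, hKc] at h1
  obtain rfl : n = s + 1 := by omega
  obtain ⟨L, hL, hLc⟩ := h.exists_card_clique_of_lt hs hK hKc
  have := h.card_clique_lt_max hs hn hL
  omega

/-! ### Claws, greedy colouring and triangle-free graphs -/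

lemma exists_clique_of_containsComplete {V : Type*} {G : SimpleGraph V} {s : ℕ}
    (h : ContainsComplete G s) : ∃ K : Finset V, G.IsClique (K : Set V) ∧ K.card = s := by
  have h1 := (SimpleGraph.not_cliqueFree_iff_top_isContained s).2 h
  unfold SimpleGraph.CliqueFree at h1
  push Not at h1
  obtain ⟨K, hK⟩ := h1
  exact ⟨K, hK.1, hK.2⟩

lemma ClawFree.not_claw {V : Type*} {G : SimpleGraph V} (hG : ClawFree G) {x a b c : V}
    (ha : G.Adj x a) (hb : G.Adj x b) (hc : G.Adj x c) (hab : a ≠ b) (hac : a ≠ c) (hbc : b ≠ c)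
    (nab : ¬ G.Adj a b) (nac : ¬ G.Adj a c) (nbc : ¬ G.Adj b c) : False := by
  have nba : ¬ G.Adj b a := fun h => nab h.symm
  have nca : ¬ G.Adj c a := fun h => nac h.symm
  have ncb : ¬ G.Adj c b := fun h => nbc h.symm
  let g : Fin 1 ⊕ Fin 3 → V := Sum.elim (fun _ => x) ![a, b, c]
  have hinj : Function.Injective g := by
    rintro (u | u) (v | v) huv
    · rw [Subsingleton.elim u v]
    · fin_cases v
      · exact absurd huv ha.ne
      · exact absurd huv hb.ne
      · exact absurd huv hc.ne
    · fin_cases u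
      · exact absurd huv ha.ne'
      · exact absurd huv hb.ne'
      · exact absurd huv hc.ne'
    · fin_cases u <;> fin_cases v
      · rfl
      · exact absurd huv hab
      · exact absurd huv hac
      · exact absurd huv hab.symm
      · rfl
      · exact absurd huv hbc
      · exact absurd huv hac.symm
      · exact absurd huv hbc.symm
      · rfl
  let e : completeBipartiteGraph (Fin 1) (Fin 3) ↪g G :=
    { toFun := g
      inj' := hinj
      map_rel_iff' := by
        rintro (u | u) (v | v)
        · simp [g]
        · fin_cases v <;> simp [g, ha, hb, hc]
        · fin_cases u <;> simp [g, ha.symm, hb.symm, hc.symm]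
        · fin_cases u <;> fin_cases v <;> simp [g, nab, nba, nac, nca, nbc, ncb] }
  exact (hG (Set.range e)).false e.isoInduceRange.symm

lemma colOn_of_degree_lt {V : Type*} [Fintype V] [DecidableEq V] {G : SimpleGraph V}
    [DecidableRel G.Adj] {n : ℕ} (S : Finset V) (hS : ∀ v ∈ S, (S.filter (G.Adj v)).card < n) :
    ColOn G (S : Set V) n := by
  induction S using Finset.induction_on with
  | empty => exact ⟨fun _ => 0, by simp, fun u hu => by simp at hu⟩
  | insert v S hv ih =>
    obtain ⟨f, hf, hp⟩ := ih fun u hu =>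
      (Finset.card_le_card (Finset.filter_subset_filter _ (Finset.subset_insert v S))).trans_lt
        (hS u (Finset.mem_insert_of_mem hu))
    have h1 : ((S.filter (G.Adj v)).image f).card < (Finset.range n).card := by
      rw [Finset.card_range]
      exact Finset.card_image_le.trans_lt ((Finset.card_le_card
        (Finset.filter_subset_filter _ (Finset.subset_insert v S))).trans_lt
          (hS v (Finset.mem_insert_self v S)))
    obtain ⟨c, hc, hc'⟩ := Finset.exists_mem_notMem_of_card_lt_card h1
    have hne : ∀ u ∈ S, G.Adj v u → f u ≠ c := fun u hu huv he =>
      hc' (Finset.mem_image.2 ⟨u, Finset.mem_filter.2 ⟨hu, huv⟩, he⟩)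
    refine ⟨fun u => if u = v then c else f u, ?_, ?_⟩
    · intro u hu
      by_cases h : u = v
      · simpa [h] using hc
      · simp only [h, if_false]
        rw [Finset.mem_coe, Finset.mem_insert] at hu
        exact hf u (hu.resolve_left h)
    · intro u hu w hw huw
      rw [Finset.mem_coe, Finset.mem_insert] at hu hw
      by_cases h : u = v <;> by_cases h' : w = v
      · exact absurd (h.trans h'.symm) huw.ne
      · simp only [h, h', if_true, if_false]
        exact (hne w (hw.resolve_left h') (h ▸ huw)).symm
      · simp only [h, h', if_true, if_false]
        exact hne u (hu.resolve_left h) (h' ▸ huw.symm)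
      · simp only [h, h', if_false]
        exact hp u (hu.resolve_left h) w (hw.resolve_left h') huw

lemma exists_walk_getVert {V : Type*} {G : SimpleGraph V} {u v : V} (w : G.Walk u v) {i j : ℕ}
    (hij : i ≤ j) (hj : j ≤ w.length) :
    ∃ q : G.Walk (w.getVert i) (w.getVert j), q.length = j - i := by
  induction j, hij using Nat.le_induction with
  | base => exact ⟨SimpleGraph.Walk.nil, by simp⟩
  | succ j hij ih =>
    obtain ⟨q, hq⟩ := ih (by omega)
    exact ⟨q.concat (w.adj_getVert_succ (by omega)), by
      rw [SimpleGraph.Walk.length_concat, hq]; omega⟩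

/-- A shortest odd closed walk in a triangle-free graph: every vertex has at most two neighbours
on it. -/
lemma exists_odd_closed_walk {V : Type*} [Finite V] {G : SimpleGraph V} (h2 : ¬ G.Colorable 2)
    (h3 : ∀ K : Finset V, G.IsClique (K : Set V) → K.card ≠ 3) :
    ∃ c : ℕ → V, ∃ n, Odd n ∧ c n = c 0 ∧ (∀ i < n, G.Adj (c i) (c (i + 1))) ∧
      ∀ v i j k, i < j → j < k → k < n → G.Adj v (c i) → G.Adj v (c j) → G.Adj v (c k) → False := by
  classical
  rw [SimpleGraph.two_colorable_iff_forall_loop_even] at h2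
  push Not at h2
  obtain ⟨u0, w0, hw0⟩ := h2
  have hex : ∃ n, ∃ u, ∃ w : G.Walk u u, w.length = n ∧ Odd n :=
    ⟨w0.length, u0, w0, rfl, by simpa using hw0⟩
  obtain ⟨u, w, hwn, hodd⟩ := Nat.find_spec hex
  have hmin : ∀ v, ∀ q : G.Walk v v, Odd q.length → Nat.find hex ≤ q.length :=
    fun v q hq => Nat.find_min' hex ⟨v, q, rfl, hq⟩
  generalize Nat.find hex = n at hwn hodd hmin
  have hn0 : w.getVert 0 = u := w.getVert_zero
  have hnn : w.getVert n = u := by rw [← hwn]; exact w.getVert_length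
  -- The positions `i` and `j` cut the closed walk into two arcs, one of even length. Replacing that
  -- arc by the detour of length 2 through `v` keeps the length odd, so by minimality the arc has
  -- length 2.
  have hdiff : ∀ v i j, i < j → j < n → G.Adj v (w.getVert i) → G.Adj v (w.getVert j) →
      j - i = 2 ∨ j - i + 2 = n := by
    intro v i j hij hj hi' hj'
    rcases Nat.even_or_odd (j - i) with he | ho
    · obtain ⟨q, hq⟩ := exists_walk_getVert w (i := j) (j := n) (by omega) (by omega)
      obtain ⟨r, hr⟩ := exists_walk_getVert w (i := 0) (j := i) (by omega) (by omega)
      have h1 := hmin v (((SimpleGraph.Walk.cons hj' q).append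
        (r.copy (hn0.trans hnn.symm) rfl)).concat hi'.symm)
      simp only [SimpleGraph.Walk.length_concat, SimpleGraph.Walk.length_append,
        SimpleGraph.Walk.length_cons, SimpleGraph.Walk.length_copy, hq, hr] at h1
      have h4 : Odd (n - j + 1 + (i - 0) + 1) := by
        obtain ⟨a, ha⟩ := he
        obtain ⟨b, hb⟩ := hodd
        exact ⟨b - a + 1, by omega⟩
      have h5 := h1 h4
      obtain ⟨a, ha⟩ := he
      omega
    · obtain ⟨q, hq⟩ := exists_walk_getVert w (i := i) (j := j) (by omega) (by omega)
      have h1 := hmin v ((SimpleGraph.Walk.cons hi' q).concat hj'.symm)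
      simp only [SimpleGraph.Walk.length_concat, SimpleGraph.Walk.length_cons, hq] at h1
      have h4 : Odd (j - i + 1 + 1) := by
        obtain ⟨a, ha⟩ := ho
        exact ⟨a + 1, by omega⟩
      have h5 := h1 h4
      obtain ⟨a, ha⟩ := ho
      obtain ⟨b, hb⟩ := hodd
      omega
  refine ⟨w.getVert, n, hodd, hnn.trans hn0.symm,
    fun i hi => w.adj_getVert_succ (by omega), ?_⟩
  intro v i j k hij hjk hk hvi hvj hvk
  have d1 := hdiff v i j hij (by omega) hvi hvj
  have d2 := hdiff v j k hjk hk hvj hvk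
  have d3 := hdiff v i k (by omega) hk hvi hvk
  obtain ⟨b, hb⟩ := hodd
  -- The three differences all lie in {2, n - 2}; for odd `n` this forces `n = 3`, hence a triangle.
  have hn3 : n = 3 := by omega
  subst hn3
  have e1 := w.adj_getVert_succ (i := 0) (by omega)
  have e2 := w.adj_getVert_succ (i := 1) (by omega)
  have e3 := w.adj_getVert_succ (i := 2) (by omega)
  simp only [zero_add, Nat.reduceAdd] at e1 e2 e3
  rw [hnn.trans hn0.symm] at e3
  refine h3 {w.getVert 0, w.getVert 1, w.getVert 2} ?_ ?_
  · intro a ha b hb hab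
    simp only [Finset.coe_insert, Finset.coe_singleton, Set.mem_insert_iff,
      Set.mem_singleton_iff] at ha hb
    rcases ha with rfl | rfl | rfl <;> rcases hb with rfl | rfl | rfl <;>
      first
      | exact absurd rfl hab
      | assumption
      | exact e1.symm
      | exact e2.symm
      | exact e3.symm
  · rw [Finset.card_insert_of_notMem, Finset.card_pair e2.ne]
    rw [Finset.mem_insert, Finset.mem_singleton, not_or]
    exact ⟨e1.ne, e3.ne'⟩

/-- The vertex set `S` of a shortest odd closed walk is not 2-colourable, so its complement has an
`n`-colouring. Every vertex has at most two neighbours in `S`; hence `S` is 3-colourable, and one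
whole class of the complement can reuse those three colours. This makes `n + 2` colours in all. -/
lemma not_unsplit_three_of_triangleFree {V : Type*} [Finite V] {G : SimpleGraph V} {n : ℕ}
    (hn : 1 ≤ n) (h3 : ∀ K : Finset V, G.IsClique (K : Set V) → K.card ≠ 3) :
    ¬ Unsplit G 3 n := by
  classical
  intro h
  have := Fintype.ofFinite V
  have h2 : ¬ G.Colorable 2 := by
    intro hc
    obtain ⟨c⟩ := hc
    exact h.notCol ⟨fun u => c u, fun u _ => (c u).is_lt.trans_le (by omega),
      fun u _ v _ huv he => c.valid huv (Fin.ext he)⟩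
  obtain ⟨c, m, hodd, hcm, hadj, hnb⟩ := exists_odd_closed_walk h2 h3
  set S := (Finset.range m).image c with hS
  have hmS : ∀ i, i ≤ m → c i ∈ S := by
    intro i hi
    have hm : 0 < m := hodd.pos
    rcases hi.lt_or_eq with hi | rfl
    · exact Finset.mem_image_of_mem _ (by simpa using hi)
    · rw [hcm]
      exact Finset.mem_image_of_mem _ (by simpa using hm)
  have hdeg : ∀ v, (S.filter (G.Adj v)).card < 3 := by
    intro v
    by_contra hge
    have h1 : (S.filter (G.Adj v)).card ≤ ((Finset.range m).filter fun i => G.Adj v (c i)).card := by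
      rw [hS, Finset.filter_image]
      exact Finset.card_image_le
    obtain ⟨T, hT, hTc⟩ := Finset.exists_subset_card_eq
      (s := (Finset.range m).filter fun i => G.Adj v (c i)) (n := 3) (by omega)
    let e := T.orderIsoOfFin hTc
    have hmem : ∀ i, (e i : ℕ) < m ∧ G.Adj v (c (e i)) := by
      intro i
      simpa using hT (e i).2
    exact hnb v (e 0) (e 1) (e 2) (e.strictMono (by decide)) (e.strictMono (by decide))
      (hmem 2).1 (hmem 0).2 (hmem 1).2 (hmem 2).2
  have hS2 : ¬ ColOn G (S : Set V) 2 := by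
    rintro ⟨f, hf, hp⟩
    have key : ∀ i ≤ m, f (c i) % 2 = (f (c 0) + i) % 2 := by
      intro i
      induction i with
      | zero => intro _; simp
      | succ i ih =>
        intro hi
        have h1 := ih (by omega)
        have h4 := hf _ (hmS i (by omega))
        have h5 := hf _ (hmS (i + 1) hi)
        have h6 := hp _ (hmS i (by omega)) _ (hmS (i + 1) hi) (hadj i (by omega))
        omega
    have h1 := key m le_rfl
    rw [hcm] at h1
    obtain ⟨b, hb⟩ := hodd
    omega
  obtain ⟨f, hf, hp⟩ := (h.split S).resolve_left hS2
  obtain ⟨g, hg, hgp⟩ := colOn_of_degree_lt (G := G) S fun v _ => hdeg v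
  have hfree : ∀ v, ∃ c < 3, ∀ u ∈ S, G.Adj v u → g u ≠ c := by
    intro v
    have h1 : ((S.filter (G.Adj v)).image g).card < (Finset.range 3).card := by
      rw [Finset.card_range]
      exact Finset.card_image_le.trans_lt (hdeg v)
    obtain ⟨c, hc, hc'⟩ := Finset.exists_mem_notMem_of_card_lt_card h1
    exact ⟨c, by simpa using hc, fun u hu huv he =>
      hc' (Finset.mem_image.2 ⟨u, Finset.mem_filter.2 ⟨hu, huv⟩, he⟩)⟩
  choose r hr hr' using hfree
  -- Class `0` of `f` moves into the colours `0, 1, 2`; the shift by 2 sends the classes `1, …, n -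
  -- 1` to `3, …, n + 1`.
  refine h.notCol ⟨fun v => if v ∈ S then g v else if f v = 0 then r v else f v + 2, ?_, ?_⟩
  · intro v _
    by_cases h1 : v ∈ S
    · simp only [h1, if_true]
      have := hg v h1
      omega
    · by_cases h4 : f v = 0
      · simp only [h1, h4, if_true, if_false]
        have := hr v
        omega
      · simp only [h1, h4, if_false]
        have := hf v h1
        omega
  · intro u _ v _ huv
    by_cases h1 : u ∈ S <;> by_cases h4 : v ∈ S
    · simpa only [h1, h4, if_true] using hgp u h1 v h4 huv
    · by_cases h5 : f v = 0
      · simpa only [h1, h4, h5, if_true, if_false] using hr' v u h1 huv.symm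
      · simp only [h1, h4, h5, if_true, if_false]
        have := hg u h1
        omega
    · by_cases h5 : f u = 0
      · simpa only [h1, h4, h5, if_true, if_false] using (hr' u v h4 huv).symm
      · simp only [h1, h4, h5, if_true, if_false]
        have := hg v h4
        omega
    · have h7 := hp u h1 v h4 huv
      by_cases h5 : f u = 0 <;> by_cases h6 : f v = 0
      · omega
      · simp only [h1, h4, h5, h6, if_true, if_false]
        have := hr u
        omega
      · simp only [h1, h4, h5, h6, if_true, if_false]
        have := hr v
        omega
      · simp only [h1, h4, h5, h6, if_false]
        omega

/-- Neighbours of a vertex are pairwise nonadjacent, so a vertex of degree three would centre a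
claw; greedy colouring then needs three colours. -/
lemma ClawFree.colOn_three {V : Type*} [Finite V] {G : SimpleGraph V} (hG : ClawFree G)
    (h3 : ∀ K : Finset V, G.IsClique (K : Set V) → K.card ≠ 3) : ColOn G Set.univ 3 := by
  classical
  have := Fintype.ofFinite V
  rw [← Finset.coe_univ]
  refine colOn_of_degree_lt _ fun v _ => ?_
  by_contra hge
  obtain ⟨T, hT, hTc⟩ := Finset.exists_subset_card_eq
    (s := Finset.univ.filter (G.Adj v)) (n := 3) (by omega)
  obtain ⟨a, b, c, hab, hac, hbc, rfl⟩ := Finset.card_eq_three.1 hTc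
  have hadj : ∀ x ∈ ({a, b, c} : Finset V), G.Adj v x := fun x hx => by simpa using hT hx
  have htri : ∀ x y, G.Adj v x → G.Adj v y → ¬ G.Adj x y := by
    intro x y hx hy hxy
    refine h3 {v, x, y} ?_ (Finset.card_eq_three.2 ⟨v, x, y, hx.ne, hy.ne, hxy.ne, rfl⟩)
    intro a ha b hb hab
    simp only [Finset.coe_insert, Finset.coe_singleton, Set.mem_insert_iff,
      Set.mem_singleton_iff] at ha hb
    rcases ha with rfl | rfl | rfl <;> rcases hb with rfl | rfl | rfl <;>
      first
      | exact absurd rfl hab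
      | assumption
      | exact hx.symm
      | exact hy.symm
      | exact hxy.symm
  have ha := hadj a (by simp)
  have hb := hadj b (by simp)
  have hc := hadj c (by simp)
  exact hG.not_claw ha hb hc hab hac hbc (htri a b ha hb) (htri a c ha hc) (htri b c hb hc)

/-! ### Avoidable vertices -/

/-- Some `s`-clique contains neither `x` nor a neighbour of `x`. -/
def Avoidable {V : Type*} (G : SimpleGraph V) (s : ℕ) (x : V) : Prop :=
  ∃ W : Finset V, G.IsClique (W : Set V) ∧ W.card = s ∧ ∀ v ∈ W, v ≠ x ∧ ¬ G.Adj x v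

lemma isClique_exchange {V : Type*} [DecidableEq V] {G : SimpleGraph V} {K : Finset V} {w y : V}
    (hK : G.IsClique (K : Set V)) (hy : ∀ x ∈ K, x ≠ w → G.Adj x y) :
    G.IsClique ((insert y (K.erase w) : Finset V) : Set V) :=
  isClique_insert_finset (hK.subset (by simp)) fun x hx =>
    hy x (Finset.mem_of_mem_erase hx) (Finset.ne_of_mem_erase hx)

lemma card_exchange {V : Type*} [DecidableEq V] {K : Finset V} {w y : V}
    (hw : w ∈ K) (hy : y ∉ K) : (insert y (K.erase w)).card = K.card := by
  rw [Finset.card_insert_of_notMem (fun h => hy (Finset.mem_of_mem_erase h)),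
    Finset.card_erase_of_mem hw]
  have := Finset.card_pos.2 ⟨w, hw⟩
  omega

/-- A vertex outside an `s`-clique and not complete to it is avoidable. -/
lemma Unsplit.avoidable {V : Type*} {G : SimpleGraph V} {s n : ℕ} (h : Unsplit G s n)
    (hs : 1 ≤ s) (x : V) : ∀ K : Finset V, G.IsClique (K : Set V) → K.card = s → x ∉ K →
    (∃ z ∈ K, ¬ G.Adj x z) → Avoidable G s x := by
  classical
  suffices H : ∀ m, ∀ K : Finset V, (K.filter (G.Adj x)).card = m → G.IsClique (K : Set V) →
      K.card = s → x ∉ K → (∃ z ∈ K, ¬ G.Adj x z) → Avoidable G s x from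
    fun K => H _ K rfl
  intro m
  induction m with
  | zero =>
    intro K hm hK hKc hx _
    refine ⟨K, hK, hKc, fun v hv => ⟨fun e => hx (e ▸ hv), fun hxv => ?_⟩⟩
    have := Finset.card_pos.2 ⟨v, Finset.mem_filter.2 ⟨hv, hxv⟩⟩
    omega
  | succ m ih =>
    intro K hm hK hKc hx hz
    obtain ⟨z, hz, hxz⟩ := hz
    obtain ⟨w, hw⟩ := Finset.card_pos.1 (show 0 < (K.filter (G.Adj x)).card by omega)
    rw [Finset.mem_filter] at hw
    -- The neighbour `w` of `x` is exchanged for a vertex `y` complete to `K` in the class of `x`.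
    -- Being nonadjacent to `x`, it lowers the number of neighbours of `x` in the clique, while `z`
    -- remains.
    obtain ⟨f, hf, hp⟩ := h.colOn_compl hs hK hKc.ge
    obtain ⟨y, hyK, hfy, hy⟩ := exists_complete_of_coloring (i := f x)
      (fun u hu => hf u (by simpa using hu)) hp (by rw [hKc]; exact h.notCol)
      (hf x (by simpa using hx))
    have hyx : y ≠ x := by
      rintro rfl
      exact hxz (hy z hz).symm
    have hxy : ¬ G.Adj x y := fun hxy => hp x (by simpa using hx) y (by simpa using hyK) hxy hfy.symm
    have hzw : z ≠ w := by
      rintro rfl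
      exact hxz hw.2
    refine ih (insert y (K.erase w)) ?_ (isClique_exchange hK fun u hu _ => hy u hu)
      ((card_exchange hw.1 hyK).trans hKc) ?_
      ⟨z, Finset.mem_insert_of_mem (Finset.mem_erase.2 ⟨hzw, hz⟩), hxz⟩
    · rw [Finset.filter_insert, if_neg hxy, Finset.filter_erase, Finset.card_erase_of_mem
        (Finset.mem_filter.2 hw)]
      omega
    · rw [Finset.mem_insert, not_or]
      exact ⟨hyx.symm, fun h' => hx (Finset.mem_of_mem_erase h')⟩

/-- A vertex `x` of a maximum clique `L` is found that is avoidable. The clique `W` avoiding `x`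
then works: each of its vertices lies outside `L` and misses `x`, so it is avoidable by way of an
`s`-subset of `L` containing `x`. -/
lemma Unsplit.exists_avoidable_clique {V : Type*} [Finite V] {G : SimpleGraph V} {s n : ℕ}
    (h : Unsplit G s n) (hs : 1 ≤ s) {K : Finset V} (hK : G.IsClique (K : Set V))
    (hKc : K.card = s) :
    ∃ W : Finset V, G.IsClique (W : Set V) ∧ W.card = s ∧ ∀ x ∈ W, Avoidable G s x := by
  classical
  have := Fintype.ofFinite V
  obtain ⟨L, hL, hmax⟩ := Finset.exists_max_image
    (Finset.univ.filter fun L : Finset V => G.IsClique (L : Set V) ∧ s ≤ L.card) Finset.card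
    ⟨K, by simpa using ⟨hK, hKc.ge⟩⟩
  simp only [Finset.mem_filter, Finset.mem_univ, true_and] at hL hmax
  obtain ⟨M, hML, hMc⟩ := Finset.exists_subset_card_eq hL.2
  have hM : G.IsClique (M : Set V) := hL.1.subset (by simpa using hML)
  obtain ⟨f, hf, hp⟩ := h.colOn_compl hs hM hMc.ge
  -- Since `L` has fewer than `s + n` vertices, some colour is absent from `L \ M`. The vertex
  -- complete to `M` with that colour lies outside `L`, and by maximality it misses some `x` of `L`.
  have h1 : ((L \ M).image f).card < (Finset.range n).card := by
    rw [Finset.card_range]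
    refine Finset.card_image_le.trans_lt ?_
    rw [Finset.card_sdiff_of_subset hML]
    have := h.clique L hL.1
    omega
  obtain ⟨i, hi, hi'⟩ := Finset.exists_mem_notMem_of_card_lt_card h1
  obtain ⟨y, hyM, hfy, hy⟩ := exists_complete_of_coloring
      (fun u hu => hf u (by simpa using hu)) hp (by rw [hMc]; exact h.notCol)
      (Finset.mem_range.1 hi)
  have hyL : y ∉ L := fun hyL =>
    hi' (Finset.mem_image.2 ⟨y, Finset.mem_sdiff.2 ⟨hyL, hyM⟩, hfy⟩)
  obtain ⟨x, hxL, hxy⟩ : ∃ x ∈ L, ¬ G.Adj x y := by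
    by_contra hno
    push Not at hno
    have h2 := hmax (insert y L) ⟨isClique_insert_finset hL.1 hno, by
      rw [Finset.card_insert_of_notMem hyL]; omega⟩
    rw [Finset.card_insert_of_notMem hyL] at h2
    omega
  have hxM : x ∉ M := fun hxM => hxy (hy x hxM)
  obtain ⟨z, hz⟩ := Finset.card_pos.1 (show 0 < M.card by omega)
  obtain ⟨W, hW, hWc, hWx⟩ := h.avoidable hs x (insert y (M.erase z))
    (isClique_exchange hM fun u hu _ => hy u hu) ((card_exchange hz hyM).trans hMc) (by
      rw [Finset.mem_insert, not_or]
      exact ⟨fun e => hyL (e ▸ hxL), fun h' => hxM (Finset.mem_of_mem_erase h')⟩)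
    ⟨y, Finset.mem_insert_self _ _, hxy⟩
  refine ⟨W, hW, hWc, fun u hu => ?_⟩
  obtain ⟨Q, hxQ, hQL, hQc⟩ := Finset.exists_subsuperset_card_eq
    (Finset.singleton_subset_iff.2 hxL) (by simpa using hs) hL.2
  have huL : u ∉ L := by
    intro huL
    exact (hWx u hu).2 (hL.1 hxL huL (hWx u hu).1.symm)
  exact h.avoidable hs u Q (hL.1.subset (by simpa using hQL)) hQc (fun h' => huL (hQL h'))
    ⟨x, hxQ (Finset.mem_singleton_self x), fun h' => (hWx u hu).2 h'.symm⟩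

/-- The avoiding clique can be deleted without touching the closed neighbourhood of `x`. -/
lemma Unsplit.exists_coloring_of_avoidable {V : Type*} {G : SimpleGraph V} {s n : ℕ}
    (h : Unsplit G s n) (hs : 1 ≤ s) {x : V} (hx : Avoidable G s x) :
    ∃ d : V → ℕ, (∀ v, v = x ∨ G.Adj x v → d v < n) ∧
      ProperOn G {v | v = x ∨ G.Adj x v} d := by
  obtain ⟨W, hW, hWc, hWx⟩ := hx
  obtain ⟨d, hd, hp⟩ := h.colOn_compl hs hW hWc.ge
  have hsub : ∀ v, v = x ∨ G.Adj x v → v ∈ (W : Set V)ᶜ := by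
    rintro v hv hvW
    rcases hv with rfl | hv
    · exact (hWx v hvW).1 rfl
    · exact (hWx v hvW).2 hv
  exact ⟨d, fun v hv => hd v (hsub v hv), hp.mono hsub⟩

/-! ### Common neighbours and near neighbours of a clique -/

/-- The vertices complete to `Q`. -/
noncomputable def commonNbrs {V : Type*} [Fintype V] (G : SimpleGraph V) (Q : Finset V) :
    Finset V := by
  classical
  exact Finset.univ.filter fun v => ∀ x ∈ Q, G.Adj x v

@[simp] lemma mem_commonNbrs {V : Type*} [Fintype V] {G : SimpleGraph V} {Q : Finset V} {v : V} :
    v ∈ commonNbrs G Q ↔ ∀ x ∈ Q, G.Adj x v := by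
  classical
  simp [commonNbrs]

/-- The vertices other than `u`, nonadjacent to `u` and complete to `K \ {u}`. -/
noncomputable def nearNbrs {V : Type*} [Fintype V] (G : SimpleGraph V) (K : Finset V) (u : V) :
    Finset V := by
  classical
  exact Finset.univ.filter fun v => v ≠ u ∧ ¬ G.Adj u v ∧ ∀ x ∈ K, x ≠ u → G.Adj x v

@[simp] lemma mem_nearNbrs {V : Type*} [Fintype V] {G : SimpleGraph V} {K : Finset V} {u v : V} :
    v ∈ nearNbrs G K u ↔ v ≠ u ∧ ¬ G.Adj u v ∧ ∀ x ∈ K, x ≠ u → G.Adj x v := by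
  classical
  simp [nearNbrs]

lemma notMem_of_mem_commonNbrs {V : Type*} [Fintype V] {G : SimpleGraph V} {K : Finset V} {v : V}
    (h : v ∈ commonNbrs G K) : v ∉ K := fun hv => (mem_commonNbrs.1 h v hv).ne rfl

lemma notMem_of_mem_nearNbrs {V : Type*} [Fintype V] {G : SimpleGraph V} {K : Finset V} {u v : V}
    (h : v ∈ nearNbrs G K u) : v ∉ K := fun hv =>
  ((mem_nearNbrs.1 h).2.2 v hv (mem_nearNbrs.1 h).1).ne rfl

lemma ClawFree.card_le_two_mul_card_image {V : Type*} {G : SimpleGraph V} (hG : ClawFree G) {x : V}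
    {S : Finset V} {d : V → ℕ} (hS : ∀ v ∈ S, G.Adj x v) (hp : ProperOn G (S : Set V) d) :
    S.card ≤ 2 * (S.image d).card := by
  classical
  refine Finset.card_le_mul_card_image S 2 fun a _ => ?_
  by_contra hgt
  push Not at hgt
  obtain ⟨p, q, r, hp', hq, hr, hpq, hpr, hqr⟩ := Finset.two_lt_card_iff.1 hgt
  rw [Finset.mem_filter] at hp' hq hr
  exact hG.not_claw (hS p hp'.1) (hS q hq.1) (hS r hr.1) hpq hpr hqr
    (fun e => hp p hp'.1 q hq.1 e (hp'.2.trans hq.2.symm))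
    (fun e => hp p hp'.1 r hr.1 e (hp'.2.trans hr.2.symm))
    (fun e => hp q hq.1 r hr.1 e (hq.2.trans hr.2.symm))

lemma card_image_add_card_le {V : Type*} {G : SimpleGraph V} [DecidableEq V] {n : ℕ} {x : V}
    {Q N : Finset V} {d : V → ℕ} (hd : ∀ v, v = x ∨ G.Adj x v → d v < n)
    (hp : ProperOn G {v | v = x ∨ G.Adj x v} d) (hQ : G.IsClique (Q : Set V)) (hx : x ∈ Q)
    (hN : ∀ v ∈ N, ∀ u ∈ Q, G.Adj u v) : (N.image d).card + Q.card ≤ n := by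
  have hQx : ∀ u ∈ Q, u = x ∨ G.Adj x u := by
    intro u hu
    by_cases e : u = x
    · exact Or.inl e
    · exact Or.inr (hQ hx hu (Ne.symm e))
  have h1 : (Q.image d).card = Q.card := by
    refine Finset.card_image_of_injOn ?_
    intro a ha b hb hab
    by_contra hne
    exact hp a (hQx a ha) b (hQx b hb) (hQ ha hb hne) hab
  rw [← h1, ← Finset.card_union_of_disjoint]
  · refine (Finset.card_le_card (t := Finset.range n) ?_).trans (by simp)
    intro i hi
    rw [Finset.mem_range]
    rcases Finset.mem_union.1 hi with hi | hi
    · obtain ⟨v, hv, rfl⟩ := Finset.mem_image.1 hi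
      exact hd v (Or.inr (hN v hv x hx))
    · obtain ⟨v, hv, rfl⟩ := Finset.mem_image.1 hi
      exact hd v (hQx v hv)
  · rw [Finset.disjoint_left]
    intro i hi hi'
    obtain ⟨v, hv, rfl⟩ := Finset.mem_image.1 hi
    obtain ⟨u, hu, he⟩ := Finset.mem_image.1 hi'
    exact hp u (hQx u hu) v (Or.inr (hN v hv x hx)) (hN v hv u hu) he

/-- In an `n`-colouring of the closed neighbourhood of `x`, the clique `Q` takes `|Q|` colours, so
its common neighbours use at most `n - |Q|`, each at most twice because there is no claw at `x`. -/
lemma Unsplit.card_commonNbrs_le {V : Type*} [Fintype V] {G : SimpleGraph V} {s n : ℕ}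
    (h : Unsplit G s n) (hG : ClawFree G) (hs : 1 ≤ s) {Q : Finset V}
    (hQ : G.IsClique (Q : Set V)) {x : V} (hx : x ∈ Q) (hxa : Avoidable G s x) :
    (commonNbrs G Q).card + 2 * Q.card ≤ 2 * n := by
  classical
  obtain ⟨d, hd, hp⟩ := h.exists_coloring_of_avoidable hs hxa
  have h1 := card_image_add_card_le hd hp hQ hx (N := commonNbrs G Q)
    fun v hv => mem_commonNbrs.1 hv
  have h2 := hG.card_le_two_mul_card_image (x := x) (S := commonNbrs G Q) (d := d)
    (fun v hv => mem_commonNbrs.1 hv x hx)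
    (hp.mono fun v hv => Or.inr (mem_commonNbrs.1 hv x hx))
  omega

lemma card_commonNbrs_erase {V : Type*} [Fintype V] [DecidableEq V] {G : SimpleGraph V}
    {K : Finset V} (hK : G.IsClique (K : Set V)) {u : V} (hu : u ∈ K) :
    (commonNbrs G (K.erase u)).card = (commonNbrs G K).card + 1 + (nearNbrs G K u).card := by
  have h1 : commonNbrs G (K.erase u) = insert u (commonNbrs G K) ∪ nearNbrs G K u := by
    ext v
    simp only [mem_commonNbrs, Finset.mem_union, Finset.mem_insert, mem_nearNbrs,
      Finset.mem_erase]
    constructor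
    · intro hv
      by_cases hvu : v = u
      · exact Or.inl (Or.inl hvu)
      · by_cases huv : G.Adj u v
        · refine Or.inl (Or.inr fun x hx => ?_)
          by_cases hxu : x = u
          · exact hxu ▸ huv
          · exact hv x ⟨hxu, hx⟩
        · exact Or.inr ⟨hvu, huv, fun x hx hxu => hv x ⟨hxu, hx⟩⟩
    · rintro ((rfl | hv) | hv) x ⟨hxu, hx⟩
      · exact hK hx hu hxu
      · exact hv x hx
      · exact hv.2.2 x hx hxu
  rw [h1, Finset.card_union_of_disjoint, Finset.card_insert_of_notMem]
  · exact fun h' => notMem_of_mem_commonNbrs h' hu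
  · rw [Finset.disjoint_left]
    intro a ha ha'
    rw [mem_nearNbrs] at ha'
    rcases Finset.mem_insert.1 ha with rfl | ha
    · exact ha'.1 rfl
    · exact ha'.2.1 (mem_commonNbrs.1 ha u hu)

/-! ### Critical colourings -/

/-- `f` colours the complement of the clique `K` of the claw-free graph `G` with `n` colours, and
`G` itself has no colouring with `|K| + n - 1` colours. -/
structure CriticalColoring {V : Type*} (G : SimpleGraph V) (K : Finset V) (n : ℕ) (f : V → ℕ) :
    Prop where
  claw : ClawFree G
  clique : G.IsClique (K : Set V)
  lt : ∀ u ∉ K, f u < n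
  proper : ProperOn G (K : Set V)ᶜ f
  notCol : ¬ ColOn G Set.univ (K.card + n - 1)

lemma Unsplit.exists_criticalColoring {V : Type*} {G : SimpleGraph V} {s n : ℕ}
    (h : Unsplit G s n) (hG : ClawFree G) (hs : 1 ≤ s) {K : Finset V}
    (hK : G.IsClique (K : Set V)) (hKc : K.card = s) : ∃ f, CriticalColoring G K n f := by
  obtain ⟨f, hf, hp⟩ := h.colOn_compl hs hK hKc.ge
  exact ⟨f, hG, hK, fun u hu => hf u (by simpa using hu), hp, by rw [hKc]; exact h.notCol⟩

namespace CriticalColoring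

variable {V : Type*} {G : SimpleGraph V} {K : Finset V} {n : ℕ} {f : V → ℕ}

lemma not_adj (h : CriticalColoring G K n f) {u v : V} (hu : u ∉ K) (hv : v ∉ K)
    (he : f u = f v) : ¬ G.Adj u v := fun huv =>
  h.proper u (by simpa using hu) v (by simpa using hv) huv he

lemma exists_common (h : CriticalColoring G K n f) {i : ℕ} (hi : i < n) :
    ∃ y ∉ K, f y = i ∧ ∀ x ∈ K, G.Adj x y :=
  exists_complete_of_coloring h.lt h.proper h.notCol hi

lemma no_three (h : CriticalColoring G K n f) {x a b c : V} (ha : a ∉ K) (hb : b ∉ K)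
    (hc : c ∉ K) (hxa : G.Adj x a) (hxb : G.Adj x b) (hxc : G.Adj x c) (hab : a ≠ b) (hac : a ≠ c)
    (hbc : b ≠ c) (h1 : f a = f b) (h2 : f a = f c) : False :=
  h.claw.not_claw hxa hxb hxc hab hac hbc (h.not_adj ha hb h1) (h.not_adj ha hc h2)
    (h.not_adj hb hc (h1.symm.trans h2))

/-- The classes outside `J` keep their colours, so saving one colour on `K` and the classes in `J`
would save one on all of `G`. -/
lemma not_colOn (h : CriticalColoring G K n f) (hK : 1 ≤ K.card) (J : Finset ℕ)
    (hJ : ∀ j ∈ J, j < n) (hJne : 1 ≤ J.card) :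
    ¬ ColOn G {v | v ∈ K ∨ f v ∈ J} (K.card + J.card - 1) := by
  intro hc
  refine h.notCol ((colOn_univ_of_classes h.lt h.proper J hJ hc).mono subset_rfl ?_)
  have : J.card ≤ n := by
    have := Finset.card_le_card (show J ⊆ Finset.range n from fun j hj => by simpa using hJ j hj)
    simpa using this
  omega

end CriticalColoring

/-! ### Recolouring two or three classes with the colours of a clique -/

/-- Colours of a clique `K` are its elements; a vertex outside `K` may receive as colour an element
of `K` not adjacent to it, or an additional colour. -/
lemma colOn_of_lists {V β : Type*} {G : SimpleGraph V} {K : Finset V} {S : Set V} {B : Finset β}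
    (c : V → β ⊕ V) (hB : ∀ v ∈ S, ∀ b, c v = Sum.inl b → b ∈ B)
    (hw : ∀ v ∈ S, ∀ w, c v = Sum.inr w → w ∈ K ∧ ¬ G.Adj w v) (hp : ProperOn G S c) :
    ColOn G ({v | v ∈ K} ∪ S) (K.card + B.card) := by
  classical
  refine ColOn.of_image (fun v => if v ∈ K then Sum.inr v else c v) (B.disjSum K) ?_ ?_
    (by rw [Finset.card_disjSum]; omega)
  · intro v hv
    by_cases h : v ∈ K
    · simp [h]
    · have hvS := hv.resolve_left h
      simp only [h, if_false]
      rcases hc : c v with b | w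
      · simpa using hB v hvS b hc
      · simpa using (hw v hvS w hc).1
  · intro u hu v hv huv
    by_cases h : u ∈ K <;> by_cases h' : v ∈ K
    · simpa [h, h'] using huv.ne
    · simp only [h, h', if_true, if_false]
      intro he
      exact (hw v (hv.resolve_left h') u he.symm).2 huv
    · simp only [h, h', if_true, if_false]
      intro he
      exact (hw u (hu.resolve_left h) v he).2 huv.symm
    · simp only [h, h', if_false]
      exact hp u (hu.resolve_left h) v (hv.resolve_left h') huv

lemma properOn_union {V α : Type*} {G : SimpleGraph V} {A B : Set V} {c : V → α}
    (hA : ProperOn G A c) (hB : ProperOn G B c)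
    (hAB : ∀ a ∈ A, ∀ b ∈ B, G.Adj a b → c a ≠ c b) : ProperOn G (A ∪ B) c := by
  rintro u (hu | hu) v (hv | hv) huv
  · exact hA u hu v hv huv
  · exact hAB u hu v hv huv
  · exact (hAB v hv u hu huv.symm).symm
  · exact hB u hu v hv huv

lemma properOn_of_indep {V α : Type*} {G : SimpleGraph V} {A : Set V} {c : V → α}
    (hA : ∀ u ∈ A, ∀ v ∈ A, ¬ G.Adj u v) : ProperOn G A c :=
  fun u hu v hv huv => absurd huv (hA u hu v hv)

/-- Two independent sets `A`, `B` outside a clique `K` containing nonadjacent vertices `y`, `z`,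
all other vertices of `A ∪ B` having a nonneighbour in `K`. -/
lemma ClawFree.colOn_two_classes {V : Type*} {G : SimpleGraph V} (hG : ClawFree G) {K : Finset V}
    {A B : Set V} (hA : ∀ u ∈ A, ∀ v ∈ A, ¬ G.Adj u v) (hB : ∀ u ∈ B, ∀ v ∈ B, ¬ G.Adj u v)
    (hAB : ∀ u ∈ A, u ∉ B) {y z : V} (hy : y ∈ A)
    (hz : z ∈ B) (hyz : ¬ G.Adj y z) (hA' : ∀ u ∈ A, u ≠ y → ∃ w ∈ K, ¬ G.Adj w u)
    (hB' : ∀ u ∈ B, u ≠ z → ∃ w ∈ K, ¬ G.Adj w u)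
    (hne : ∀ e ∈ A, ∀ q ∈ B, G.Adj e q → ∀ w ∈ K, ¬ G.Adj w e → ¬ G.Adj w q →
      ∃ w' ∈ K, w' ≠ w ∧ (¬ G.Adj w' e ∨ ¬ G.Adj w' q)) :
    ColOn G ({v | v ∈ K} ∪ (A ∪ B)) (K.card + 1) := by
  classical
  -- the neighbours of `z` in `A`, and the vertices of `B` with two neighbours among them
  set E : Set V := {e | e ∈ A ∧ G.Adj z e} with hE
  set R : Set V := {q | q ∈ B ∧ q ≠ z ∧ ∀ e ∈ E, ∀ e' ∈ E, G.Adj q e → G.Adj q e' → e = e'} with hR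
  have hEy : ∀ e ∈ E, e ≠ y := by
    rintro e ⟨_, he⟩ rfl
    exact hyz he.symm
  -- A vertex `e` of `E` is adjacent to `z`, so by claw-freeness it has at most one other neighbour
  -- `q` in `B`. Its colour is chosen so that the list of `q` is not exhausted.
  have hα : ∀ e, ∃ a, e ∈ E → (a ∈ K ∧ ¬ G.Adj a e) ∧
      ∀ q ∈ B, q ≠ z → G.Adj e q → ∃ b ∈ K, ¬ G.Adj b q ∧ b ≠ a := by
    intro e
    by_cases he : e ∈ E
    · obtain ⟨w, hw, hwe⟩ := hA' e he.1 (hEy e he)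
      by_cases hq : ∃ q ∈ B, q ≠ z ∧ G.Adj e q
      · obtain ⟨q, hqB, hqz, heq⟩ := hq
        have huniq : ∀ q' ∈ B, q' ≠ z → G.Adj e q' → q' = q := by
          intro q' hq' hq'z heq'
          by_contra hqq
          exact hG.not_claw he.2.symm heq heq' hqz.symm hq'z.symm (Ne.symm hqq)
            (hB z hz q hqB) (hB z hz q' hq') (hB q hqB q' hq')
        have key : ∃ a ∈ K, ¬ G.Adj a e ∧ ∃ b ∈ K, ¬ G.Adj b q ∧ b ≠ a := by
          obtain ⟨b, hb, hbq⟩ := hB' q hqB hqz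
          by_cases hbw : b = w
          · subst hbw
            obtain ⟨w', hw', hww, h1 | h1⟩ := hne e he.1 q hqB heq b hb hwe hbq
            · exact ⟨w', hw', h1, b, hb, hbq, hww.symm⟩
            · exact ⟨b, hb, hwe, w', hw', h1, hww⟩
          · exact ⟨w, hw, hwe, b, hb, hbq, hbw⟩
        obtain ⟨a, ha, hae, hb⟩ := key
        refine ⟨a, fun _ => ⟨⟨ha, hae⟩, ?_⟩⟩
        intro q' hq' hq'z heq'
        rw [huniq q' hq' hq'z heq']
        exact hb
      · push Not at hq
        exact ⟨w, fun _ => ⟨⟨hw, hwe⟩, fun q hqB hqz heq => absurd heq (hq q hqB hqz)⟩⟩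
    · exact ⟨e, fun h => absurd h he⟩
  choose α hα using hα
  have hβ : ∀ q, ∃ b, q ∈ R → (b ∈ K ∧ ¬ G.Adj b q) ∧ ∀ e ∈ E, G.Adj e q → b ≠ α e := by
    intro q
    by_cases hq : q ∈ R
    · by_cases he : ∃ e ∈ E, G.Adj e q
      · obtain ⟨e, he, heq⟩ := he
        obtain ⟨b, hb, hbq, hba⟩ := (hα e he).2 q hq.1 hq.2.1 heq
        refine ⟨b, fun _ => ⟨⟨hb, hbq⟩, fun e' he' heq' => ?_⟩⟩
        rw [hq.2.2 e' he' e he heq'.symm heq.symm]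
        exact hba
      · push Not at he
        obtain ⟨b, hb, hbq⟩ := hB' q hq.1 hq.2.1
        exact ⟨b, fun _ => ⟨⟨hb, hbq⟩, fun e' he' heq' => absurd heq' (he e' he')⟩⟩
    · exact ⟨q, fun h => absurd h hq⟩
  choose β hβ using hβ
  -- The one additional colour goes to `z` together with `A \ E`, and to the vertices of `B` with
  -- two neighbours in `E`; by claw-freeness these have no third neighbour in `A`. Between `E` and
  -- `R` each vertex has at most one neighbour on the other side, so the choices `α` and `β`
  -- suffice.
  set c : V → Unit ⊕ V := fun v => if v ∈ E then Sum.inr (α v) else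
    if v ∈ R then Sum.inr (β v) else Sum.inl () with hc
  have h := colOn_of_lists (G := G) (K := K) (S := A ∪ B) (B := {()}) c
    (fun v _ b _ => by simp) ?_ ?_
  · simpa using h
  · intro v _ w hvw
    by_cases h1 : v ∈ E
    · simp only [hc, h1, if_true, Sum.inr.injEq] at hvw
      exact hvw ▸ (hα v h1).1
    · by_cases h2 : v ∈ R
      · simp only [hc, h1, h2, if_true, if_false, Sum.inr.injEq] at hvw
        exact hvw ▸ (hβ v h2).1
      · simp [hc, h1, h2] at hvw
  · refine properOn_union (properOn_of_indep hA) (properOn_of_indep hB) ?_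
    intro a ha b hb hab
    have haR : a ∉ R := fun h => hAB a ha h.1
    have hbE : b ∉ E := fun h => hAB b h.1 hb
    by_cases h1 : a ∈ E <;> by_cases h2 : b ∈ R
    · simp only [hc, h1, hbE, h2, if_true, if_false, ne_eq, Sum.inr.injEq]
      exact fun he => (hβ b h2).2 a h1 hab he.symm
    · simp [hc, h1, hbE, h2]
    · simp [hc, h1, hbE, h2, haR]
    · exfalso
      by_cases hbz : b = z
      · subst hbz
        exact h1 ⟨ha, hab.symm⟩
      · have h3 : ¬ ∀ e ∈ E, ∀ e' ∈ E, G.Adj b e → G.Adj b e' → e = e' := fun h3 => h2 ⟨hb, hbz, h3⟩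
        push Not at h3
        obtain ⟨e, he, e', he', hbe, hbe', hee⟩ := h3
        have hae : a ≠ e := by
          rintro rfl
          exact h1 he
        have hae' : a ≠ e' := by
          rintro rfl
          exact h1 he'
        exact hG.not_claw hab.symm hbe hbe' hae hae' hee (hA a ha e he.1) (hA a ha e' he'.1)
          (hA e he.1 e' he'.1)

/-- List colouring of a bipartite graph with parts `E` and `F`: it is enough to choose the colours
on `E` in such a way that no list on `F` is exhausted. -/
lemma exists_list_coloring {V : Type*} [DecidableEq V] {E F : Finset V} {L : V → Finset V}
    {r : V → V → Prop} (α : V → V) (hα : ∀ e ∈ E, α e ∈ L e)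
    (hF : ∀ f ∈ F, ∃ b ∈ L f, ∀ e ∈ E, r e f → b ≠ α e) (hEF : Disjoint E F) :
    ∃ c : V → V, (∀ v, v ∈ E ∨ v ∈ F → c v ∈ L v) ∧ ∀ e ∈ E, ∀ f ∈ F, r e f → c e ≠ c f := by
  have : ∀ f, ∃ b, f ∈ F → b ∈ L f ∧ ∀ e ∈ E, r e f → b ≠ α e := by
    intro f
    by_cases hf : f ∈ F
    · obtain ⟨b, hb, hb'⟩ := hF f hf
      exact ⟨b, fun _ => ⟨hb, hb'⟩⟩
    · exact ⟨f, fun h => absurd h hf⟩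
  choose β hβ using this
  have hFE : ∀ f ∈ F, f ∉ E := fun f hf hf' => Finset.disjoint_left.1 hEF hf' hf
  refine ⟨fun v => if v ∈ E then α v else β v, ?_, ?_⟩
  · rintro v (hv | hv)
    · simpa only [hv, if_true] using hα v hv
    · simpa only [hFE v hv, if_false] using (hβ v hv).1
  · intro e he f hf hef
    simp only [he, hFE f hf, if_true, if_false]
    exact ((hβ f hf).2 e he hef).symm

lemma exists_mem_notMem_of_card_lt {V : Type*} [DecidableEq V] {A B : Finset V}
    (h : B.card < A.card) : ∃ a ∈ A, a ∉ B :=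
  Finset.exists_mem_notMem_of_card_lt_card h

/-- A singleton list on `F` is respected first; the other list on `F` then has three elements
against at most two colours on `E`. Once all lists on `F` have two elements, a failing pair of
colours on `E` must be equal, as a set, to a list on `F`. Two lists cannot block all pairs. -/
lemma exists_list_coloring_of_card_le_two {V : Type*} [DecidableEq V] {E F : Finset V}
    {L : V → Finset V} {r : V → V → Prop} (hEF : Disjoint E F) (hE : E.card ≤ 2)
    (hF : F.card ≤ 2) (hL : ∀ v, v ∈ E ∨ v ∈ F → 1 ≤ (L v).card)
    (hE3 : ∀ e ∈ E, ∀ e' ∈ E, e ≠ e' → (L e).card ≤ 1 → 3 ≤ (L e').card)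
    (hF3 : ∀ e ∈ F, ∀ e' ∈ F, e ≠ e' → (L e).card ≤ 1 → 3 ≤ (L e').card)
    (hEF1 : ∀ e ∈ E, ∀ f ∈ F, r e f → (L e).card ≤ 1 → (L f).card ≤ 1 → L e ≠ L f) :
    ∃ c : V → V, (∀ v, v ∈ E ∨ v ∈ F → c v ∈ L v) ∧ ∀ e ∈ E, ∀ f ∈ F, r e f → c e ≠ c f := by
  classical
  -- it suffices that every list on `F` is not contained in the set of colours used on `E`
  have hsuff : ∀ α : V → V, (∀ e ∈ E, α e ∈ L e) → (∀ f ∈ F, ∃ b ∈ L f, b ∉ E.image α) →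
      ∃ c : V → V, (∀ v, v ∈ E ∨ v ∈ F → c v ∈ L v) ∧ ∀ e ∈ E, ∀ f ∈ F, r e f → c e ≠ c f := by
    intro α hα hf
    refine exists_list_coloring α hα (fun f hfF => ?_) hEF
    obtain ⟨b, hb, hb'⟩ := hf f hfF
    exact ⟨b, hb, fun e he _ hbe => hb' (Finset.mem_image.2 ⟨e, he, hbe.symm⟩)⟩
  have hex : ∀ v, ∃ a, v ∈ E ∨ v ∈ F → a ∈ L v := by
    intro v
    by_cases hv : v ∈ E ∨ v ∈ F
    · obtain ⟨a, ha⟩ := Finset.card_pos.1 (hL v hv)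
      exact ⟨a, fun _ => ha⟩
    · exact ⟨v, fun h => absurd h hv⟩
  choose γ hγ using hex
  by_cases h1 : ∃ f ∈ F, (L f).card ≤ 1
  · obtain ⟨f0, hf0, hf0c⟩ := h1
    obtain ⟨c, hc⟩ := Finset.card_eq_one.1 (le_antisymm hf0c (hL f0 (Or.inr hf0)))
    have hα : ∀ e, ∃ a, e ∈ E → a ∈ L e ∧ (r e f0 → a ≠ c) := by
      intro e
      by_cases he : e ∈ E
      · by_cases her : r e f0
        · have : ∃ a ∈ L e, a ≠ c := by
            by_contra hno
            push Not at hno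
            have h2 : L e ⊆ {c} := fun a ha => Finset.mem_singleton.2 (hno a ha)
            have h3 := Finset.card_le_card h2
            rw [Finset.card_singleton] at h3
            refine hEF1 e he f0 hf0 her h3 hf0c ?_
            rw [hc]
            exact Finset.eq_of_subset_of_card_le h2 (by simpa using hL e (Or.inl he))
          obtain ⟨a, ha, hac⟩ := this
          exact ⟨a, fun _ => ⟨ha, fun _ => hac⟩⟩
        · exact ⟨γ e, fun _ => ⟨hγ e (Or.inl he), fun h => absurd h her⟩⟩
      · exact ⟨e, fun h => absurd h he⟩
    choose α hα using hα
    refine exists_list_coloring α (fun e he => (hα e he).1) (fun f hf => ?_) hEF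
    by_cases hff : f = f0
    · subst hff
      exact ⟨c, by simp [hc], fun e he her => ((hα e he).2 her).symm⟩
    · obtain ⟨b, hb, hb'⟩ := exists_mem_notMem_of_card_lt (A := L f) (B := E.image α)
        (Finset.card_image_le.trans_lt (by have := hF3 f0 hf0 f hf (Ne.symm hff) hf0c; omega))
      exact ⟨b, hb, fun e he _ hbe => hb' (Finset.mem_image.2 ⟨e, he, hbe.symm⟩)⟩
  · push Not at h1
    by_cases hE1 : E.card ≤ 1
    · refine hsuff γ (fun e he => hγ e (Or.inl he)) fun f hf =>
        exists_mem_notMem_of_card_lt (Finset.card_image_le.trans_lt ?_)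
      have := h1 f hf
      omega
    · have hone : ∀ e1 e2, e1 ≠ e2 → E = {e1, e2} → 3 ≤ (L e2).card →
          ∃ c : V → V, (∀ v, v ∈ E ∨ v ∈ F → c v ∈ L v) ∧
            ∀ e ∈ E, ∀ f ∈ F, r e f → c e ≠ c f := by
        intro e1 e2 h12 hEeq hL2
        have hδ : ∀ f, ∃ x, f ∈ F → x ∈ L f ∧ x ≠ γ e1 := by
          intro f
          by_cases hf : f ∈ F
          · obtain ⟨x, hx, hx'⟩ := exists_mem_notMem_of_card_lt (A := L f) (B := {γ e1})
              (by simpa using h1 f hf)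
            exact ⟨x, fun _ => ⟨hx, by simpa using hx'⟩⟩
          · exact ⟨f, fun h => absurd h hf⟩
        choose δ hδ using hδ
        -- With `γ e1` fixed, a remaining colour `δ f` is reserved for each of the at most two `f`,
        -- and three choices at `e2` leave one that is not reserved.
        obtain ⟨b, hb, hb'⟩ := exists_mem_notMem_of_card_lt (A := L e2) (B := F.image δ)
          (Finset.card_image_le.trans_lt (by omega))
        refine hsuff (fun e => if e = e1 then γ e1 else b) ?_ ?_
        · intro e he
          rw [hEeq, Finset.mem_insert, Finset.mem_singleton] at he
          rcases he with rfl | rfl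
          · simpa using hγ e (Or.inl (by simp [hEeq]))
          · simpa [h12.symm] using hb
        · intro f hf
          refine ⟨δ f, (hδ f hf).1, ?_⟩
          rw [hEeq]
          simp only [Finset.image_insert, Finset.image_singleton, if_true, h12.symm, if_false,
            Finset.mem_insert, Finset.mem_singleton, not_or]
          exact ⟨(hδ f hf).2, fun e => hb' (Finset.mem_image.2 ⟨f, hf, e⟩)⟩
      obtain ⟨e1, e2, h12, hEeq⟩ := Finset.card_eq_two.1 (show E.card = 2 by omega)
      have he1 : e1 ∈ E := by simp [hEeq]
      have he2 : e2 ∈ E := by simp [hEeq]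
      by_cases hL2 : 3 ≤ (L e2).card
      · exact hone e1 e2 h12 hEeq hL2
      by_cases hL1 : 3 ≤ (L e1).card
      · exact hone e2 e1 h12.symm (by rw [hEeq, Finset.pair_comm]) hL1
      have h1' : ¬ (L e1).card ≤ 1 := fun h => hL2 (hE3 e1 he1 e2 he2 h12 h)
      have h2' : ¬ (L e2).card ≤ 1 := fun h => hL1 (hE3 e2 he2 e1 he1 h12.symm h)
      obtain ⟨a1, a2, ha, ha'⟩ := Finset.card_eq_two.1 (show (L e1).card = 2 by omega)
      obtain ⟨b1, b2, hb, hb'⟩ := Finset.card_eq_two.1 (show (L e2).card = 2 by omega)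
      by_contra hno
      have hbad : ∀ a b, a ∈ L e1 → b ∈ L e2 → ∃ f ∈ F, ∀ x ∈ L f, x = a ∨ x = b := by
        intro a b haL hbL
        by_contra hno'
        push Not at hno'
        refine hno (hsuff (fun e => if e = e1 then a else b) ?_ ?_)
        · intro e he
          rw [hEeq, Finset.mem_insert, Finset.mem_singleton] at he
          rcases he with rfl | rfl
          · simpa using haL
          · simpa [h12.symm] using hbL
        · intro f hf
          obtain ⟨x, hx, hxa, hxb⟩ := hno' f hf
          refine ⟨x, hx, ?_⟩
          rw [hEeq]
          simp [h12.symm, hxa, hxb]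
      obtain ⟨f1, f2, hFeq⟩ : ∃ f1 f2, ∀ f ∈ F, f = f1 ∨ f = f2 := by
        rcases Nat.lt_or_ge F.card 2 with h | h
        · rcases F.eq_empty_or_nonempty with h' | ⟨f, hf⟩
          · exact ⟨e1, e1, by simp [h']⟩
          · exact ⟨f, f, fun f' hf' => Or.inl (Finset.card_le_one.1 (by omega) f' hf' f hf)⟩
        · obtain ⟨f1, f2, _, h'⟩ := Finset.card_eq_two.1 (le_antisymm hF h)
          exact ⟨f1, f2, by simp [h']⟩
      have hpq : ∀ f ∈ F, ∃ p ∈ L f, ∃ q ∈ L f, p ≠ q := fun f hf => by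
        obtain ⟨p, hp, q, hq, hpq⟩ := Finset.one_lt_card.1 (h1 f hf)
        exact ⟨p, hp, q, hq, hpq⟩
      -- Both lists on `E` now have exactly two elements. Of the four pairs, three already give
      -- distinct blocking lists, more than `F` can hold.
      have hforb : ∀ a b, a ∈ L e1 → b ∈ L e2 → a ≠ b ∧ ∃ f ∈ F, L f = {a, b} := by
        intro a b haL hbL
        obtain ⟨f, hf, hfx⟩ := hbad a b haL hbL
        obtain ⟨p, hp, q, hq, hpq⟩ := hpq f hf
        have hab : a ≠ b := by
          rintro rfl
          exact hpq (by rcases hfx p hp with h | h <;> rcases hfx q hq with h' | h' <;> simp [h, h'])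
        refine ⟨hab, f, hf, Finset.eq_of_subset_of_card_le (fun x hx => by simpa using hfx x hx) ?_⟩
        rw [Finset.card_pair hab]
        exact h1 f hf
      have m1 : a1 ∈ L e1 := by simp [ha']
      have m2 : a2 ∈ L e1 := by simp [ha']
      have m3 : b1 ∈ L e2 := by simp [hb']
      have m4 : b2 ∈ L e2 := by simp [hb']
      obtain ⟨d1, g1, hg1, k1⟩ := hforb a1 b1 m1 m3
      obtain ⟨d2, g2, hg2, k2⟩ := hforb a2 b1 m2 m3
      obtain ⟨d3, g3, hg3, k3⟩ := hforb a1 b2 m1 m4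
      obtain ⟨d4, -⟩ := hforb a2 b2 m2 m4
      have n12 : L g1 ≠ L g2 := by
        rw [k1, k2]
        intro e
        have : a1 ∈ ({a2, b1} : Finset V) := e ▸ Finset.mem_insert_self _ _
        simp [ha, d1] at this
      have n13 : L g1 ≠ L g3 := by
        rw [k1, k3]
        intro e
        have : b1 ∈ ({a1, b2} : Finset V) := e ▸ (by simp)
        simp [hb, d1.symm] at this
      have n23 : L g2 ≠ L g3 := by
        rw [k2, k3]
        intro e
        have : a2 ∈ ({a1, b2} : Finset V) := e ▸ Finset.mem_insert_self _ _
        simp [ha.symm, d4] at this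
      rcases hFeq g1 hg1 with rfl | rfl <;> rcases hFeq g2 hg2 with rfl | rfl <;>
        rcases hFeq g3 hg3 with rfl | rfl <;> first | exact n12 rfl | exact n13 rfl | exact n23 rfl

/-- One additional colour is started at `v` and the part of `B` not adjacent to `v`, the other at
`w` and the part of `C` not adjacent to `w`. The remaining neighbours take colours of `K` through
`α`. -/
lemma ClawFree.colOn_three_classes {V : Type*} {G : SimpleGraph V} (hG : ClawFree G) {K : Finset V}
    {A B C : Set V} (hA : ∀ u ∈ A, ∀ v ∈ A, ¬ G.Adj u v) (hB : ∀ u ∈ B, ∀ v ∈ B, ¬ G.Adj u v)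
    (hC : ∀ u ∈ C, ∀ v ∈ C, ¬ G.Adj u v) (hAB : ∀ u ∈ A, u ∉ B) (hAC : ∀ u ∈ A, u ∉ C)
    (hBC : ∀ u ∈ B, u ∉ C) {v w : V} (hv : v ∈ A) (hw : w ∈ A) (hvw : v ≠ w) (α : V → V)
    (hα : ∀ e, e ∈ B ∧ G.Adj v e ∨ e ∈ C ∧ G.Adj w e → α e ∈ K ∧ ¬ G.Adj (α e) e)
    (hα' : ∀ e ∈ B, G.Adj v e → ∀ q ∈ C, G.Adj w q → G.Adj e q → α e ≠ α q)
    (hR : ∀ r ∈ A, r ≠ v → r ≠ w → ∀ a b, ∃ x ∈ K, ¬ G.Adj x r ∧ x ≠ a ∧ x ≠ b) :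
    ColOn G ({u | u ∈ K} ∪ (A ∪ (B ∪ C))) (K.card + 2) := by
  classical
  set E : Set V := {e | e ∈ B ∧ G.Adj v e}
  set F : Set V := {e | e ∈ C ∧ G.Adj w e}
  set P : Set V := {r | ∀ e ∈ E, ∀ e' ∈ E, G.Adj r e → G.Adj r e' → e = e'}
  set Q : Set V := {r | ∀ e ∈ F, ∀ e' ∈ F, G.Adj r e → G.Adj r e' → e = e'}
  have hβ : ∀ r, ∃ b, r ∈ A → r ≠ v → r ≠ w → r ∈ P → r ∈ Q → (b ∈ K ∧ ¬ G.Adj b r) ∧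
      ∀ e, e ∈ E ∨ e ∈ F → G.Adj r e → b ≠ α e := by
    intro r
    by_cases hr : r ∈ A ∧ r ≠ v ∧ r ≠ w ∧ r ∈ P ∧ r ∈ Q
    · obtain ⟨h1, h2, h3, h4, h5⟩ := hr
      have hE : ∃ a, ∀ e ∈ E, G.Adj r e → α e = a := by
        by_cases he : ∃ e ∈ E, G.Adj r e
        · obtain ⟨e, he, hre⟩ := he
          exact ⟨α e, fun e' he' hre' => by rw [h4 e' he' e he hre' hre]⟩
        · exact ⟨r, fun e he' hre => absurd ⟨e, he', hre⟩ he⟩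
      have hF : ∃ a, ∀ e ∈ F, G.Adj r e → α e = a := by
        by_cases he : ∃ e ∈ F, G.Adj r e
        · obtain ⟨e, he, hre⟩ := he
          exact ⟨α e, fun e' he' hre' => by rw [h5 e' he' e he hre' hre]⟩
        · exact ⟨r, fun e he' hre => absurd ⟨e, he', hre⟩ he⟩
      obtain ⟨a, ha⟩ := hE
      obtain ⟨a', ha'⟩ := hF
      obtain ⟨x, hx, hxr, hxa, hxa'⟩ := hR r h1 h2 h3 a a'
      refine ⟨x, fun _ _ _ _ _ => ⟨⟨hx, hxr⟩, ?_⟩⟩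
      rintro e (he | he) hre
      · rw [ha e he hre]; exact hxa
      · rw [ha' e he hre]; exact hxa'
    · exact ⟨r, fun h1 h2 h3 h4 h5 => absurd ⟨h1, h2, h3, h4, h5⟩ hr⟩
  choose β hβ using hβ
  -- A further vertex of `A` with two neighbours in `E` has no other neighbour in `B`, so it can
  -- take `false`; likewise for `F`, `C` and `true`. Any other has at most one neighbour in each of
  -- `E` and `F`, so `hR`, which excludes two colours, gives it a colour of `K`.
  set c : V → Bool ⊕ V := fun u =>
    if u ∈ A then
      if u = v then Sum.inl false else if u = w then Sum.inl true else
        if u ∉ P then Sum.inl false else if u ∉ Q then Sum.inl true else Sum.inr (β u)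
    else if u ∈ B then if u ∈ E then Sum.inr (α u) else Sum.inl false
    else if u ∈ F then Sum.inr (α u) else Sum.inl true with hc
  have hBA : ∀ u ∈ B, u ∉ A := fun u hu hu' => hAB u hu' hu
  have hCA : ∀ u ∈ C, u ∉ A := fun u hu hu' => hAC u hu' hu
  have hCB : ∀ u ∈ C, u ∉ B := fun u hu hu' => hBC u hu' hu
  have cE : ∀ u ∈ B, u ∈ E → c u = Sum.inr (α u) := fun u hu hE => by
    simp only [hc, hBA u hu, hu, hE, if_true, if_false]
  have cE' : ∀ u ∈ B, u ∉ E → c u = Sum.inl false := fun u hu hE => by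
    simp only [hc, hBA u hu, hu, hE, if_true, if_false]
  have cF : ∀ u ∈ C, u ∈ F → c u = Sum.inr (α u) := fun u hu hF => by
    simp only [hc, hCA u hu, hCB u hu, hF, if_true, if_false]
  have cF' : ∀ u ∈ C, u ∉ F → c u = Sum.inl true := fun u hu hF => by
    simp only [hc, hCA u hu, hCB u hu, hF, if_false]
  have cA : ∀ u ∈ A, (c u = Sum.inl false ∧ (u = v ∨ u ∉ P)) ∨
      (c u = Sum.inl true ∧ (u = w ∨ u ∉ Q)) ∨
      (c u = Sum.inr (β u) ∧ u ≠ v ∧ u ≠ w ∧ u ∈ P ∧ u ∈ Q) := by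
    intro u hu
    by_cases h1 : u = v
    · exact Or.inl ⟨by simp only [hc, h1, hv, if_true], Or.inl h1⟩
    by_cases h2 : u = w
    · exact Or.inr (Or.inl ⟨by simp only [hc, h2, hvw.symm, hw, if_true, if_false], Or.inl h2⟩)
    by_cases h3 : u ∈ P
    · by_cases h4 : u ∈ Q
      · exact Or.inr (Or.inr ⟨by
          simp only [hc, hu, h1, h2, h3, h4, not_true_eq_false, if_true, if_false], h1, h2, h3, h4⟩)
      · exact Or.inr (Or.inl ⟨by
          simp only [hc, hu, h1, h2, h3, h4, not_true_eq_false, not_false_eq_true, if_true, if_false],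
          Or.inr h4⟩)
    · exact Or.inl ⟨by
        simp only [hc, hu, h1, h2, h3, not_false_eq_true, if_true, if_false], Or.inr h3⟩
  have h := colOn_of_lists (G := G) (K := K) (S := A ∪ (B ∪ C)) (B := Finset.univ) c
    (fun v _ b _ => Finset.mem_univ b) ?_ ?_
  · simpa using h
  · rintro u (hu | hu | hu) x hux
    · rcases cA u hu with ⟨h1, _⟩ | ⟨h1, _⟩ | ⟨h1, h2, h3, h4, h5⟩
      · rw [h1] at hux; cases hux
      · rw [h1] at hux; cases hux
      · rw [h1, Sum.inr.injEq] at hux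
        exact hux ▸ (hβ u hu h2 h3 h4 h5).1
    · by_cases h1 : u ∈ E
      · rw [cE u hu h1, Sum.inr.injEq] at hux
        exact hux ▸ hα u (Or.inl h1)
      · rw [cE' u hu h1] at hux; cases hux
    · by_cases h1 : u ∈ F
      · rw [cF u hu h1, Sum.inr.injEq] at hux
        exact hux ▸ hα u (Or.inr h1)
      · rw [cF' u hu h1] at hux; cases hux
  · refine properOn_union (properOn_of_indep hA) (properOn_union (properOn_of_indep hB)
      (properOn_of_indep hC) ?_) ?_
    · intro a ha b hb hab
      by_cases h1 : a ∈ E <;> by_cases h2 : b ∈ F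
      · rw [cE a ha h1, cF b hb h2, ne_eq, Sum.inr.injEq]
        exact hα' a ha h1.2 b hb h2.2 hab
      · rw [cE a ha h1, cF' b hb h2]; simp
      · rw [cE' a ha h1, cF b hb h2]; simp
      · rw [cE' a ha h1, cF' b hb h2]; simp
    · rintro a ha b (hb | hb) hab
      · by_cases h1 : b ∈ E
        · rw [cE b hb h1]
          rcases cA a ha with ⟨h2, _⟩ | ⟨h2, _⟩ | ⟨h2, h3, h4, h5, h6⟩
          · rw [h2]; simp
          · rw [h2]; simp
          · rw [h2, ne_eq, Sum.inr.injEq]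
            exact (hβ a ha h3 h4 h5 h6).2 b (Or.inl h1) hab
        · rw [cE' b hb h1]
          rcases cA a ha with ⟨h2, h3⟩ | ⟨h2, _⟩ | ⟨h2, _⟩
          · exfalso
            rcases h3 with rfl | h3
            · exact h1 ⟨hb, hab⟩
            · simp only [P, Set.mem_ofPred_eq, not_forall] at h3
              obtain ⟨e, he, e', he', hae, hae', hee⟩ := h3
              exact hG.not_claw hab hae hae' (fun e => h1 (e ▸ he)) (fun e => h1 (e ▸ he')) hee
                (hB b hb e he.1) (hB b hb e' he'.1) (hB e he.1 e' he'.1)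
          · rw [h2]; simp
          · rw [h2]; simp
      · by_cases h1 : b ∈ F
        · rw [cF b hb h1]
          rcases cA a ha with ⟨h2, _⟩ | ⟨h2, _⟩ | ⟨h2, h3, h4, h5, h6⟩
          · rw [h2]; simp
          · rw [h2]; simp
          · rw [h2, ne_eq, Sum.inr.injEq]
            exact (hβ a ha h3 h4 h5 h6).2 b (Or.inr h1) hab
        · rw [cF' b hb h1]
          rcases cA a ha with ⟨h2, _⟩ | ⟨h2, h3⟩ | ⟨h2, _⟩
          · rw [h2]; simp
          · exfalso
            rcases h3 with rfl | h3
            · exact h1 ⟨hb, hab⟩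
            · simp only [Q, Set.mem_ofPred_eq, not_forall] at h3
              obtain ⟨e, he, e', he', hae, hae', hee⟩ := h3
              exact hG.not_claw hab hae hae' (fun e => h1 (e ▸ he)) (fun e => h1 (e ▸ he')) hee
                (hC b hb e he.1) (hC b hb e' he'.1) (hC e he.1 e' he'.1)
          · rw [h2]; simp

/-! ### Configurations excluded by a critical colouring -/

namespace CriticalColoring

variable {V : Type*} {G : SimpleGraph V} {K : Finset V} {n : ℕ} {f : V → ℕ}

/-- Two colour classes with unique common neighbours of `K` which are nonadjacent contain adjacent
vertices whose only nonneighbour in `K` is the same vertex. -/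
lemma exists_adj_near (h : CriticalColoring G K n f) (hK : 1 ≤ K.card) {y z : V} (hy : y ∉ K)
    (hz : z ∉ K) (hfyz : f y ≠ f z) (hyz : ¬ G.Adj y z)
    (hy' : ∀ u ∉ K, f u = f y → u ≠ y → ∃ w ∈ K, ¬ G.Adj w u)
    (hz' : ∀ u ∉ K, f u = f z → u ≠ z → ∃ w ∈ K, ¬ G.Adj w u) :
    ∃ e ∉ K, ∃ q ∉ K, f e = f y ∧ f q = f z ∧ G.Adj e q ∧ ∃ w ∈ K, ¬ G.Adj w e ∧ ¬ G.Adj w q ∧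
      ∀ x ∈ K, x ≠ w → G.Adj x e ∧ G.Adj x q := by
  classical
  by_contra hno
  have hlt : ∀ j ∈ ({f y, f z} : Finset ℕ), j < n := by
    intro j hj
    rw [Finset.mem_insert, Finset.mem_singleton] at hj
    rcases hj with rfl | rfl
    · exact h.lt _ hy
    · exact h.lt _ hz
  have h2 := h.claw.colOn_two_classes (K := K) (A := {u | u ∉ K ∧ f u = f y})
    (B := {u | u ∉ K ∧ f u = f z})
    (fun u hu v hv => h.not_adj hu.1 hv.1 (hu.2.trans hv.2.symm))
    (fun u hu v hv => h.not_adj hu.1 hv.1 (hu.2.trans hv.2.symm))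
    (fun u hu hu' => hfyz (hu.2.symm.trans hu'.2)) (y := y) (z := z) ⟨hy, rfl⟩ ⟨hz, rfl⟩ hyz
    (fun u hu hne => hy' u hu.1 hu.2 hne) (fun u hu hne => hz' u hu.1 hu.2 hne) ?_
  · refine h.not_colOn hK {f y, f z} hlt (by simp) (h2.mono ?_ ?_)
    · rintro u (hu | hu)
      · exact Or.inl hu
      · by_cases hu' : u ∈ K
        · exact Or.inl hu'
        · rw [Finset.mem_insert, Finset.mem_singleton] at hu
          exact Or.inr (hu.imp (fun e => ⟨hu', e⟩) (fun e => ⟨hu', e⟩))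
    · rw [Finset.card_pair hfyz]
      omega
  · intro e he q hq heq w hw hwe hwq
    by_contra hno'
    push Not at hno'
    exact hno ⟨e, he.1, q, hq.1, he.2, hq.2, heq, w, hw, hwe, hwq, hno'⟩

lemma false_of_three_classes (h : CriticalColoring G K n f) (hK : 1 ≤ K.card) {v w : V} {j k : ℕ}
    (hj : j < n) (hk : k < n) (hv : v ∉ K) (hw : w ∉ K) (hfv : f w = f v) (hvj : f v ≠ j)
    (hvk : f v ≠ k) (hjk : j ≠ k) (hvw : v ≠ w) (α : V → V)
    (hα : ∀ e ∉ K, f e = j ∧ G.Adj v e ∨ f e = k ∧ G.Adj w e → α e ∈ K ∧ ¬ G.Adj (α e) e)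
    (hα' : ∀ e ∉ K, f e = j → G.Adj v e → ∀ q ∉ K, f q = k → G.Adj w q → G.Adj e q → α e ≠ α q)
    (hR : ∀ r ∉ K, f r = f v → r ≠ v → r ≠ w → ∀ a b, ∃ x ∈ K, ¬ G.Adj x r ∧ x ≠ a ∧ x ≠ b) :
    False := by
  classical
  have hlt : ∀ i ∈ ({f v, j, k} : Finset ℕ), i < n := by
    intro i hi
    simp only [Finset.mem_insert, Finset.mem_singleton] at hi
    rcases hi with rfl | rfl | rfl
    · exact h.lt _ hv
    · exact hj
    · exact hk
  have hind : ∀ i, ∀ u ∈ {u | u ∉ K ∧ f u = i}, ∀ v ∈ {u | u ∉ K ∧ f u = i}, ¬ G.Adj u v :=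
    fun i u hu v hv => h.not_adj hu.1 hv.1 (hu.2.trans hv.2.symm)
  have h2 := h.claw.colOn_three_classes (K := K) (hind (f v)) (hind j) (hind k)
    (fun u hu hu' => hvj (hu.2.symm.trans hu'.2)) (fun u hu hu' => hvk (hu.2.symm.trans hu'.2))
    (fun u hu hu' => hjk (hu.2.symm.trans hu'.2)) ⟨hv, rfl⟩ ⟨hw, hfv⟩ hvw α
    (fun e he => he.elim (fun he => hα e he.1.1 (Or.inl ⟨he.1.2, he.2⟩))
      (fun he => hα e he.1.1 (Or.inr ⟨he.1.2, he.2⟩)))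
    (fun e he hve q hq hwq heq => hα' e he.1 he.2 hve q hq.1 hq.2 hwq heq)
    (fun r hr hrv hrw => hR r hr.1 hr.2 hrv hrw)
  have hc : ({f v, j, k} : Finset ℕ).card = 3 := Finset.card_eq_three.2 ⟨_, _, _, hvj, hvk, hjk, rfl⟩
  refine h.not_colOn hK {f v, j, k} hlt (by omega) (h2.mono ?_ (by omega))
  rintro u (hu | hu)
  · exact Or.inl hu
  · by_cases hu' : u ∈ K
    · exact Or.inl hu'
    · simp only [Finset.mem_insert, Finset.mem_singleton] at hu
      exact Or.inr (hu.imp (fun e => ⟨hu', e⟩) (Or.imp (fun e => ⟨hu', e⟩) (fun e => ⟨hu', e⟩)))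

end CriticalColoring

namespace CriticalColoring

variable {V : Type*} {G : SimpleGraph V} {K : Finset V} {n : ℕ} {f : V → ℕ}

/-- Two vertices of a colour class distinct from a common neighbour of `K` in the class have
nonneighbours covering `K`. -/
lemma not_adj_or_not_adj (h : CriticalColoring G K n f) {y a b x : V} (hy : y ∉ K)
    (hyK : ∀ x ∈ K, G.Adj x y) (ha : a ∉ K) (hb : b ∉ K) (hfa : f a = f y) (hfb : f b = f y)
    (hay : a ≠ y) (hby : b ≠ y) (hab : a ≠ b) (hx : x ∈ K) : ¬ G.Adj x a ∨ ¬ G.Adj x b := by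
  by_contra hno
  push Not at hno
  exact h.no_three hy ha hb (hyK x hx) hno.1 hno.2 hay.symm hby.symm hab hfa.symm hfb.symm

lemma card_nonNbrs_add [DecidableEq V] [DecidableRel G.Adj] (h : CriticalColoring G K n f)
    {y a b : V} (hy : y ∉ K)
    (hyK : ∀ x ∈ K, G.Adj x y) (ha : a ∉ K) (hb : b ∉ K) (hfa : f a = f y) (hfb : f b = f y)
    (hay : a ≠ y) (hby : b ≠ y) (hab : a ≠ b) :
    K.card ≤ (K.filter fun x => ¬ G.Adj x a).card + (K.filter fun x => ¬ G.Adj x b).card := by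
  refine (Finset.card_le_card ?_).trans (Finset.card_union_le _ _)
  intro x hx
  have := h.not_adj_or_not_adj hy hyK ha hb hfa hfb hay hby hab hx
  simp only [Finset.mem_union, Finset.mem_filter]
  exact this.imp (fun h' => ⟨hx, h'⟩) (fun h' => ⟨hx, h'⟩)

lemma card_nbrs_class_le [Fintype V] [DecidableEq V] [DecidableRel G.Adj]
    (h : CriticalColoring G K n f) (v : V) (j : ℕ) :
    (Finset.univ.filter fun e => e ∉ K ∧ f e = j ∧ G.Adj v e).card ≤ 2 := by
  by_contra hgt
  push Not at hgt
  obtain ⟨p, q, r, hp, hq, hr, hpq, hpr, hqr⟩ := Finset.two_lt_card_iff.1 hgt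
  simp only [Finset.mem_filter, Finset.mem_univ, true_and] at hp hq hr
  exact h.no_three hp.1 hq.1 hr.1 hp.2.2 hq.2.2 hr.2.2 hpq hpr hqr (hp.2.1.trans hq.2.1.symm)
    (hp.2.1.trans hr.2.1.symm)

/-- The neighbours of `v` in the class of `y` and of `w` in the class of `z` number at most two
each, and their lists are their nonneighbours in `K`. Two lists in one class cover `K`; with `|K| ≥
4`, a singleton forces the other to have three elements, as the list colouring lemma requires. -/
lemma false_of_near_or_common [Fintype V] (h : CriticalColoring G K n f) (hK : 4 ≤ K.card)
    {v w y z : V} (hv : v ∉ K) (hw : w ∉ K) (hy : y ∉ K) (hz : z ∉ K) (hfv : f w = f v)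
    (hvj : f v ≠ f y) (hvk : f v ≠ f z) (hjk : f y ≠ f z) (hvw : v ≠ w)
    (hvK : ∀ x ∈ K, G.Adj x v) (hwK : ∃ u, ∀ x ∈ K, x ≠ u → G.Adj x w)
    (hyK : ∀ x ∈ K, G.Adj x y) (hzK : ∀ x ∈ K, G.Adj x z)
    (hvy : ¬ G.Adj v y) (hwz : ¬ G.Adj w z)
    (hy' : ∀ u ∉ K, f u = f y → u ≠ y → ∃ x ∈ K, ¬ G.Adj x u)
    (hz' : ∀ u ∉ K, f u = f z → u ≠ z → ∃ x ∈ K, ¬ G.Adj x u)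
    (hne : ∀ e ∉ K, f e = f y → ∀ q ∉ K, f q = f z → G.Adj e q → ∀ u ∈ K,
      (∀ x ∈ K, x ≠ u → G.Adj x e ∧ G.Adj x q) → ¬ (¬ G.Adj u e ∧ ¬ G.Adj u q)) : False := by
  classical
  set E := Finset.univ.filter fun e => e ∉ K ∧ f e = f y ∧ G.Adj v e with hE
  set F := Finset.univ.filter fun e => e ∉ K ∧ f e = f z ∧ G.Adj w e with hF
  have mE : ∀ e, e ∈ E ↔ e ∉ K ∧ f e = f y ∧ G.Adj v e := by simp [hE]
  have mF : ∀ e, e ∈ F ↔ e ∉ K ∧ f e = f z ∧ G.Adj w e := by simp [hF]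
  have eE : ∀ e ∈ E, e ≠ y := by
    rintro e he rfl
    exact hvy ((mE _).1 he).2.2
  have eF : ∀ e ∈ F, e ≠ z := by
    rintro e he rfl
    exact hwz ((mF _).1 he).2.2
  obtain ⟨c, hc, hc'⟩ := exists_list_coloring_of_card_le_two (E := E) (F := F)
    (L := fun v => K.filter fun x => ¬ G.Adj x v) (r := G.Adj)
    (by
      rw [Finset.disjoint_left]
      intro e he he'
      exact hjk (((mE e).1 he).2.1.symm.trans ((mF e).1 he').2.1))
    (h.card_nbrs_class_le v _) (h.card_nbrs_class_le w _)
    (by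
      rintro e (he | he)
      · obtain ⟨x, hx, hxe⟩ := hy' e ((mE e).1 he).1 ((mE e).1 he).2.1 (eE e he)
        exact Finset.card_pos.2 ⟨x, Finset.mem_filter.2 ⟨hx, hxe⟩⟩
      · obtain ⟨x, hx, hxe⟩ := hz' e ((mF e).1 he).1 ((mF e).1 he).2.1 (eF e he)
        exact Finset.card_pos.2 ⟨x, Finset.mem_filter.2 ⟨hx, hxe⟩⟩)
    (by
      intro e he e' he' hee h1
      have := h.card_nonNbrs_add hy hyK ((mE e).1 he).1 ((mE e').1 he').1 ((mE e).1 he).2.1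
        ((mE e').1 he').2.1 (eE e he) (eE e' he') hee
      omega)
    (by
      intro e he e' he' hee h1
      have := h.card_nonNbrs_add hz hzK ((mF e).1 he).1 ((mF e').1 he').1 ((mF e).1 he).2.1
        ((mF e').1 he').2.1 (eF e he) (eF e' he') hee
      omega)
    (by
      intro e he q hq heq h1 h2 h3
      obtain ⟨u, hu, hue⟩ := hy' e ((mE e).1 he).1 ((mE e).1 he).2.1 (eE e he)
      have hue' : u ∈ K.filter fun x => ¬ G.Adj x e := Finset.mem_filter.2 ⟨hu, hue⟩
      have huq' : u ∈ K.filter fun x => ¬ G.Adj x q := by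
        exact h3 ▸ hue'
      refine hne e ((mE e).1 he).1 ((mE e).1 he).2.1 q ((mF q).1 hq).1 ((mF q).1 hq).2.1 heq u hu
        ?_ ⟨hue, (Finset.mem_filter.1 huq').2⟩
      intro x hx hxu
      constructor
      · by_contra hxe
        exact hxu (Finset.card_le_one.1 h1 x (Finset.mem_filter.2 ⟨hx, hxe⟩) u hue')
      · by_contra hxe
        exact hxu (Finset.card_le_one.1 h2 x (Finset.mem_filter.2 ⟨hx, hxe⟩) u huq'))
  refine h.false_of_three_classes (by omega) (h.lt y hy) (h.lt z hz) hv hw hfv hvj hvk hjk hvw c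
    ?_ ?_ ?_
  · rintro e he (he' | he')
    · exact Finset.mem_filter.1 (hc e (Or.inl ((mE e).2 ⟨he, he'⟩)))
    · exact Finset.mem_filter.1 (hc e (Or.inr ((mF e).2 ⟨he, he'⟩)))
  · intro e he hfe hve q hq hfq hwq
    exact hc' e ((mE e).2 ⟨he, hfe, hve⟩) q ((mF q).2 ⟨hq, hfq, hwq⟩)
  · intro r hr hfr hrv hrw a b
    obtain ⟨u, hu⟩ := hwK
    -- Every vertex of `K` except possibly `u` is adjacent to both `v` and `w`, so it cannot also be
    -- adjacent to `r`.
    have h3 : ({u, a, b} : Finset V).card < K.card := Finset.card_le_three.trans_lt (by omega)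
    obtain ⟨x, hx, hx'⟩ := Finset.exists_mem_notMem_of_card_lt_card h3
    simp only [Finset.mem_insert, Finset.mem_singleton, not_or] at hx'
    refine ⟨x, hx, fun hxr => ?_, hx'.2.1, hx'.2.2⟩
    exact h.no_three hv hw hr (hvK x hx) (hu x hx hx'.1) hxr hvw hrv.symm hrw.symm hfv.symm
      hfr.symm

set_option maxHeartbeats 800000 in
/-- Three colour classes whose vertices missing at most one vertex of `K` can be coloured, together
with `K`, with `|K| + 2` colours. -/
lemma false_of_coloring_near [Fintype V] (h : CriticalColoring G K n f) (hK : 4 ≤ K.card)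
    {J : Finset ℕ} (hJ : ∀ j ∈ J, j < n) (hJc : J.card = 3) (φ : V → ℕ)
    (hφ : ∀ v, v ∈ K ∨ f v ∈ J ∧ (∃ u, ∀ x ∈ K, x ≠ u → G.Adj x v) → φ v < K.card + 2)
    (hp : ProperOn G {v | v ∈ K ∨ f v ∈ J ∧ (∃ u, ∀ x ∈ K, x ≠ u → G.Adj x v)} φ) : False := by
  classical
  -- the vertices under consideration outside `K`
  set T : Set V := {v | v ∉ K ∧ f v ∈ J ∧ ∃ u, ∀ x ∈ K, x ≠ u → G.Adj x v} with hT
  have hTp : ∀ a ∈ T, ∀ b ∈ T, G.Adj a b → φ a ≠ φ b := fun a ha b hb =>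
    hp a (Or.inr ha.2) b (Or.inr hb.2)
  have hTK : ∀ a ∈ T, ∀ x ∈ K, G.Adj x a → φ x ≠ φ a := fun a ha x hx =>
    hp x (Or.inl hx) a (Or.inr ha.2)
  have hcomT : ∀ y, y ∉ K → f y ∈ J → (∀ x ∈ K, G.Adj x y) → y ∈ T :=
    fun y hy hf hyK => ⟨hy, hf, y, fun x hx _ => hyK x hx⟩
  -- Three vertices of `T` miss at most three vertices of `K`, so they have a common neighbour in
  -- `K`; if they shared a colour it would centre a claw.
  have hthree : ∀ a ∈ T, ∀ b ∈ T, ∀ c ∈ T, a ≠ b → a ≠ c → b ≠ c → φ a = φ b → φ a = φ c →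
      False := by
    intro a ha b hb c hc hab hac hbc h1 h2
    obtain ⟨u1, hu1⟩ := ha.2.2
    obtain ⟨u2, hu2⟩ := hb.2.2
    obtain ⟨u3, hu3⟩ := hc.2.2
    have h3 : ({u1, u2, u3} : Finset V).card < K.card := Finset.card_le_three.trans_lt (by omega)
    obtain ⟨x, hx, hx'⟩ := Finset.exists_mem_notMem_of_card_lt_card h3
    simp only [Finset.mem_insert, Finset.mem_singleton, not_or] at hx'
    exact h.claw.not_claw (hu1 x hx hx'.1) (hu2 x hx hx'.2.1) (hu3 x hx hx'.2.2) hab hac hbc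
      (fun e => hTp a ha b hb e h1) (fun e => hTp a ha c hc e h2)
      (fun e => hTp b hb c hc e (h1.symm.trans h2))
  have hφK : (K.image φ).card = K.card := by
    refine Finset.card_image_of_injOn fun a ha b hb hab => ?_
    by_contra hne
    exact hp a (Or.inl ha) b (Or.inl hb) (h.clique ha hb hne) hab
  -- the colours not used on `K`
  have hex : ((Finset.range (K.card + 2)) \ (K.image φ)).card = 2 := by
    rw [Finset.card_sdiff_of_subset, hφK, Finset.card_range]
    · omega
    · intro i hi
      obtain ⟨x, hx, rfl⟩ := Finset.mem_image.1 hi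
      exact Finset.mem_range.2 (hφ x (Or.inl hx))
  obtain ⟨p, q, hpq, hPQ⟩ := Finset.card_eq_two.1 hex
  have hcol : ∀ v ∈ T, (∃ x ∈ K, φ x = φ v) ∨ φ v = p ∨ φ v = q := by
    intro v hv
    by_cases hx : ∃ x ∈ K, φ x = φ v
    · exact Or.inl hx
    · right
      have : φ v ∈ (Finset.range (K.card + 2)) \ (K.image φ) := by
        rw [Finset.mem_sdiff, Finset.mem_range, Finset.mem_image]
        exact ⟨hφ v (Or.inr hv.2), hx⟩
      rw [hPQ] at this
      simpa using this
  have hcomcol : ∀ y ∈ T, (∀ x ∈ K, G.Adj x y) → φ y = p ∨ φ y = q := by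
    intro y hy hyK
    refine (hcol y hy).resolve_left ?_
    rintro ⟨x, hx, he⟩
    exact hTK y hy x hx (hyK x hx) he
  -- two adjacent vertices which get colours of `K` have different nonneighbours in `K`
  have hown : ∀ e ∈ T, ∀ r ∈ T, (∃ x ∈ K, φ x = φ e) → (∃ x ∈ K, φ x = φ r) → G.Adj e r →
      ∀ u ∈ K, (∀ x ∈ K, x ≠ u → G.Adj x e ∧ G.Adj x r) → False := by
    rintro e he r hr ⟨x, hx, hxe⟩ ⟨x', hx', hxr⟩ her u hu hadj
    have h1 : x = u := by
      by_contra hne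
      exact hTK e he x hx (hadj x hx hne).1 hxe
    have h2 : x' = u := by
      by_contra hne
      exact hTK r hr x' hx' (hadj x' hx' hne).2 hxr
    subst h1 h2
    exact hTp e he r hr her (hxe.symm.trans hxr)
  -- the main case: the third common neighbour shares its colour with a vertex of the first class
  have main : ∀ y1 ∈ T, ∀ y2 ∈ T, ∀ y3 ∈ T, ∀ v ∈ T, (∀ x ∈ K, G.Adj x y1) →
      (∀ x ∈ K, G.Adj x y2) → (∀ x ∈ K, G.Adj x y3) → f y1 ≠ f y2 → f y1 ≠ f y3 → f y2 ≠ f y3 →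
      φ y1 = φ y2 → φ y3 ≠ φ y1 → f v = f y1 → φ v = φ y3 → False := by
    intro y1 hy1 y2 hy2 y3 hy3 v hv k1 k2 k3 f12 f13 f23 c12 c31 hfv hcv
    have hvy : v ≠ y1 := fun e => c31 (by rw [← hcv, e])
    -- The two colours not on `K` are each used twice already, on `y1, y2` and on `y3, v`, so no
    -- third vertex of `T` receives them.
    have hexh : ∀ u ∈ T, f u = f y2 ∧ u ≠ y2 ∨ f u = f y3 ∧ u ≠ y3 → ∃ x ∈ K, φ x = φ u := by
      intro u hu huu
      refine (hcol u hu).resolve_right fun hpq' => ?_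
      have e1 := hcomcol y1 hy1 k1
      have e3 := hcomcol y3 hy3 k3
      have : φ u = φ y1 ∨ φ u = φ y3 := by omega
      have hu1 : u ≠ y1 := by
        rintro rfl
        rcases huu with h' | h'
        · exact f12 h'.1
        · exact f13 h'.1
      have hu2 : u ≠ y2 := by
        rintro rfl
        rcases huu with h' | h'
        · exact h'.2 rfl
        · exact f23 h'.1
      have hu3 : u ≠ y3 := by
        rintro rfl
        rcases huu with h' | h'
        · exact f23 h'.1.symm
        · exact h'.2 rfl
      have huv : u ≠ v := by
        rintro rfl
        rcases huu with h' | h'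
        · exact f12 (hfv.symm.trans h'.1)
        · exact f13 (hfv.symm.trans h'.1)
      rcases this with h1 | h1
      · exact hthree y1 hy1 y2 hy2 u hu (fun e => f12 (e ▸ rfl)) hu1.symm hu2.symm c12 h1.symm
      · exact hthree y3 hy3 v hv u hu (fun e => f13 (by rw [← hfv, e])) hu3.symm huv.symm
          hcv.symm h1.symm
    have huniq : ∀ u ∉ K, f u = f y2 ∧ u ≠ y2 ∨ f u = f y3 ∧ u ≠ y3 → ∃ x ∈ K, ¬ G.Adj x u := by
      intro u hu huu
      by_contra hno
      push Not at hno
      have huT : u ∈ T := hcomT u hu (by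
        rcases huu with h' | h'
        · rw [h'.1]; exact hy2.2.1
        · rw [h'.1]; exact hy3.2.1) hno
      obtain ⟨x, hx, hxu⟩ := hexh u huT huu
      exact hTK u huT x hx (hno x hx) hxu
    refine h.false_of_near_or_common hK hy1.1 hv.1 hy2.1 hy3.1 hfv f12 f13 f23 hvy.symm k1 hv.2.2 k2
      k3 (fun e => hTp y1 hy1 y2 hy2 e c12) (fun e => hTp v hv y3 hy3 e hcv)
      (fun u hu h1 h2 => huniq u hu (Or.inl ⟨h1, h2⟩))
      (fun u hu h1 h2 => huniq u hu (Or.inr ⟨h1, h2⟩)) ?_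
    rintro e he hfe r hr hfr her u hu hadj ⟨hue, hur⟩
    have heT : e ∈ T := ⟨he, by rw [hfe]; exact hy2.2.1, u, fun x hx hxu => (hadj x hx hxu).1⟩
    have hrT : r ∈ T := ⟨hr, by rw [hfr]; exact hy3.2.1, u, fun x hx hxu => (hadj x hx hxu).2⟩
    exact hown e heT r hrT
      (hexh e heT (Or.inl ⟨hfe, fun e' => hue (e' ▸ k2 u hu)⟩))
      (hexh r hrT (Or.inr ⟨hfr, fun e' => hur (e' ▸ k3 u hu)⟩)) her u hu hadj
  -- The three common neighbours share two colours, so two of them agree. If the colour of the third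
  -- does not recur in `T` outside its own class, the classes of the two that agree already
  -- contradict `exists_adj_near`.
  have step : ∀ y1 ∈ T, ∀ y2 ∈ T, ∀ y3 ∈ T, (∀ x ∈ K, G.Adj x y1) →
      (∀ x ∈ K, G.Adj x y2) → (∀ x ∈ K, G.Adj x y3) → f y1 ≠ f y2 → f y1 ≠ f y3 → f y2 ≠ f y3 →
      J = {f y1, f y2, f y3} → φ y1 = φ y2 → False := by
    intro y1 hy1 y2 hy2 y3 hy3 k1 k2 k3 f12 f13 f23 hJeq c12
    have c31 : φ y3 ≠ φ y1 := fun e => hthree y1 hy1 y2 hy2 y3 hy3 (fun e => f12 (e ▸ rfl))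
      (fun e => f13 (e ▸ rfl)) (fun e => f23 (e ▸ rfl)) c12 e.symm
    by_cases hv : ∃ v ∈ T, φ v = φ y3 ∧ f v ≠ f y3
    · obtain ⟨v, hv, hcv, hfv⟩ := hv
      have h1 := hv.2.1
      rw [hJeq] at h1
      simp only [Finset.mem_insert, Finset.mem_singleton, hfv, or_false] at h1
      rcases h1 with h1 | h1
      · exact main y1 hy1 y2 hy2 y3 hy3 v hv k1 k2 k3 f12 f13 f23 c12 c31 h1 hcv
      · exact main y2 hy2 y1 hy1 y3 hy3 v hv k2 k1 k3 f12.symm f23 f13 c12.symm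
          (fun e => c31 (e.trans c12.symm)) h1 hcv
    · push Not at hv
      have hexh : ∀ u ∈ T, f u ≠ f y3 → u ≠ y1 → u ≠ y2 → ∃ x ∈ K, φ x = φ u := by
        intro u hu hfu hu1 hu2
        refine (hcol u hu).resolve_right fun hpq' => ?_
        have e1 := hcomcol y1 hy1 k1
        have e3 := hcomcol y3 hy3 k3
        have : φ u = φ y1 ∨ φ u = φ y3 := by omega
        rcases this with h1 | h1
        · exact hthree y1 hy1 y2 hy2 u hu (fun e => f12 (e ▸ rfl)) hu1.symm hu2.symm c12 h1.symm
        · exact hfu (hv u hu h1)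
      have huniq : ∀ u ∉ K, f u ∈ J → f u ≠ f y3 → u ≠ y1 → u ≠ y2 → ∃ x ∈ K, ¬ G.Adj x u := by
        intro u hu hfJ hfu hu1 hu2
        by_contra hno
        push Not at hno
        have huT : u ∈ T := hcomT u hu hfJ hno
        obtain ⟨x, hx, hxu⟩ := hexh u huT hfu hu1 hu2
        exact hTK u huT x hx (hno x hx) hxu
      obtain ⟨e, he, r, hr, hfe, hfr, her, u, hu, hue, hur, hadj⟩ :=
        h.exists_adj_near (by omega) hy1.1 hy2.1 f12 (fun e => hTp y1 hy1 y2 hy2 e c12)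
          (fun u hu h1 h2 => huniq u hu (h1 ▸ hy1.2.1) (h1 ▸ f13) h2 (fun e => f12 (by rw [← h1, e])))
          (fun u hu h1 h2 => huniq u hu (h1 ▸ hy2.2.1) (h1 ▸ f23)
            (fun e => f12 (by rw [← h1, e])) h2)
      have heT : e ∈ T := ⟨he, by rw [hfe]; exact hy1.2.1, u, fun x hx hxu => (hadj x hx hxu).1⟩
      have hrT : r ∈ T := ⟨hr, by rw [hfr]; exact hy2.2.1, u, fun x hx hxu => (hadj x hx hxu).2⟩
      refine hown e heT r hrT (hexh e heT (hfe ▸ f13) ?_ ?_) (hexh r hrT (hfr ▸ f23) ?_ ?_) her u hu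
        hadj
      · rintro rfl; exact hue (k1 u hu)
      · rintro rfl; exact hue (k2 u hu)
      · rintro rfl; exact hur (k1 u hu)
      · rintro rfl; exact hur (k2 u hu)
  obtain ⟨j1, j2, j3, j12, j13, j23, rfl⟩ := Finset.card_eq_three.1 hJc
  obtain ⟨y1, hy1, rfl, k1⟩ := h.exists_common (hJ j1 (by simp))
  obtain ⟨y2, hy2, rfl, k2⟩ := h.exists_common (hJ j2 (by simp))
  obtain ⟨y3, hy3, rfl, k3⟩ := h.exists_common (hJ j3 (by simp))
  have t1 := hcomT y1 hy1 (by simp) k1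
  have t2 := hcomT y2 hy2 (by simp) k2
  have t3 := hcomT y3 hy3 (by simp) k3
  have e1 := hcomcol y1 t1 k1
  have e2 := hcomcol y2 t2 k2
  have e3 := hcomcol y3 t3 k3
  have : φ y1 = φ y2 ∨ φ y1 = φ y3 ∨ φ y2 = φ y3 := by omega
  rcases this with e | e | e
  · exact step y1 t1 y2 t2 y3 t3 k1 k2 k3 j12 j13 j23 rfl e
  · exact step y1 t1 y3 t3 y2 t2 k1 k3 k2 j13 j12 j23.symm (by
      ext i; simp only [Finset.mem_insert, Finset.mem_singleton]; tauto) e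
  · exact step y2 t2 y3 t3 y1 t1 k2 k3 k1 j23 j12.symm j13.symm (by
      ext i; simp only [Finset.mem_insert, Finset.mem_singleton]; tauto) e

end CriticalColoring

/-! ### Disjoint deficient label sets -/

/-- Vertices `U` with labels `lam` and colours `d` such that no colour is used more than twice. If
the vertices with labels in `I` use at least `e` colours fewer than there are labels, then there
are `e` disjoint sets `J` of labels such that the vertices with labels in `J` use one colour fewer
than there are labels in `J`, every colour being used by two labels. -/
lemma exists_disjoint_deficient {V ι γ : Type*} [DecidableEq V] [DecidableEq ι] [DecidableEq γ]
    (lam : V → ι) (d : V → γ) (U : Finset V)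
    (h3 : ∀ a ∈ U, ∀ b ∈ U, ∀ c ∈ U, a ≠ b → a ≠ c → b ≠ c → d a = d b → d a = d c → False)
    (e : ℕ) : ∀ I : Finset ι, (((U.filter fun v => lam v ∈ I).image d).card + e ≤ I.card) →
    ∃ 𝒥 : Finset (Finset ι), 𝒥.card = e ∧ (∀ J ∈ 𝒥, ∀ J' ∈ 𝒥, J ≠ J' → Disjoint J J') ∧
      ∀ J ∈ 𝒥, J ⊆ I ∧ J.Nonempty ∧ ((U.filter fun v => lam v ∈ J).image d).card + 1 = J.card ∧
        ∀ v ∈ U, lam v ∈ J → ∃ v' ∈ U, lam v' ∈ J ∧ v' ≠ v ∧ d v' = d v ∧ lam v' ≠ lam v := by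
  induction e with
  | zero => exact fun I _ => ⟨∅, by simp⟩
  | succ e ih =>
    intro I hI
    -- For a smallest set with fewer colours than labels the deficiency is exactly one, and removing
    -- a label loses no colour; so every colour occurs at two labels.
    obtain ⟨J, hJ, hmin⟩ := Finset.exists_min_image
      (I.powerset.filter fun J => ((U.filter fun v => lam v ∈ J).image d).card < J.card)
      Finset.card ⟨I, by simp; omega⟩
    simp only [Finset.mem_filter, Finset.mem_powerset] at hJ hmin
    have hne : J.Nonempty := Finset.card_pos.1 (by omega)
    have hsub : ∀ j, (U.filter fun v => lam v ∈ J.erase j).image d ⊆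
        (U.filter fun v => lam v ∈ J).image d := by
      intro j
      refine Finset.image_subset_image fun v hv => ?_
      rw [Finset.mem_filter] at hv ⊢
      exact ⟨hv.1, Finset.mem_of_mem_erase hv.2⟩
    have herase : ∀ j ∈ J, J.card ≤ ((U.filter fun v => lam v ∈ J.erase j).image d).card + 1 := by
      intro j hj
      by_contra hlt
      have h1 := Finset.card_erase_of_mem hj
      have h2 := Finset.card_pos.2 ⟨j, hj⟩
      have := hmin (J.erase j) ⟨(Finset.erase_subset j J).trans hJ.1, by omega⟩
      omega
    have hcard : ((U.filter fun v => lam v ∈ J).image d).card + 1 = J.card := by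
      obtain ⟨j, hj⟩ := hne
      have h1 := herase j hj
      have h2 := Finset.card_le_card (hsub j)
      omega
    have hpart : ∀ v ∈ U, lam v ∈ J →
        ∃ v' ∈ U, lam v' ∈ J ∧ v' ≠ v ∧ d v' = d v ∧ lam v' ≠ lam v := by
      intro v hv hvJ
      have h1 := Finset.eq_of_subset_of_card_le (hsub (lam v)) (by
        have := herase (lam v) hvJ
        omega)
      have h2 : d v ∈ (U.filter fun v => lam v ∈ J).image d :=
        Finset.mem_image_of_mem d (Finset.mem_filter.2 ⟨hv, hvJ⟩)
      rw [← h1, Finset.mem_image] at h2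
      obtain ⟨v', hv', hd⟩ := h2
      rw [Finset.mem_filter, Finset.mem_erase] at hv'
      exact ⟨v', hv'.1, hv'.2.2, fun e => hv'.2.1 (e ▸ rfl), hd, hv'.2.1⟩
    -- The colours at `J` have both their uses there, so none recurs at `I \ J`, which retains the
    -- rest of the deficiency.
    have hdisj : Disjoint ((U.filter fun v => lam v ∈ I \ J).image d)
        ((U.filter fun v => lam v ∈ J).image d) := by
      rw [Finset.disjoint_left]
      intro c hc hc'
      obtain ⟨w, hw, hwc⟩ := Finset.mem_image.1 hc
      obtain ⟨v, hv, hvc⟩ := Finset.mem_image.1 hc'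
      rw [Finset.mem_filter] at hw hv
      rw [Finset.mem_sdiff] at hw
      obtain ⟨v', hv', hv'J, hvv, hdv, _⟩ := hpart v hv.1 hv.2
      exact h3 w hw.1 v hv.1 v' hv' (fun e => hw.2.2 (e ▸ hv.2)) (fun e => hw.2.2 (e ▸ hv'J))
        hvv.symm (hwc.trans hvc.symm) (hwc.trans (hvc.symm.trans hdv.symm))
    have hle : ((U.filter fun v => lam v ∈ I \ J).image d).card +
        ((U.filter fun v => lam v ∈ J).image d).card ≤
        ((U.filter fun v => lam v ∈ I).image d).card := by
      rw [← Finset.card_union_of_disjoint hdisj]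
      refine Finset.card_le_card (Finset.union_subset ?_ ?_) <;>
      · refine Finset.image_subset_image fun v hv => ?_
        rw [Finset.mem_filter] at hv ⊢
        first
        | exact ⟨hv.1, (Finset.mem_sdiff.1 hv.2).1⟩
        | exact ⟨hv.1, hJ.1 hv.2⟩
    obtain ⟨𝒥, h𝒥c, h𝒥d, h𝒥⟩ := ih (I \ J) (by
      rw [Finset.card_sdiff_of_subset hJ.1]
      omega)
    have hd : ∀ J' ∈ 𝒥, Disjoint J J' := fun J' hJ' =>
      (Finset.disjoint_of_subset_left (h𝒥 J' hJ').1 Finset.sdiff_disjoint).symm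
    have hnot : J ∉ 𝒥 := by
      intro hJ'
      exact hne.ne_empty (disjoint_self.1 (hd J hJ'))
    refine ⟨insert J 𝒥, by rw [Finset.card_insert_of_notMem hnot, h𝒥c], ?_, ?_⟩
    · intro A hA B hB hAB
      rw [Finset.mem_insert] at hA hB
      rcases hA with rfl | hA <;> rcases hB with rfl | hB
      · exact absurd rfl hAB
      · exact hd B hB
      · exact (hd A hA).symm
      · exact h𝒥d A hA B hB hAB
    · intro A hA
      rw [Finset.mem_insert] at hA
      rcases hA with rfl | hA
      · exact ⟨hJ.1, hne, hcard, hpart⟩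
      · obtain ⟨h1, h2⟩ := h𝒥 A hA
        exact ⟨h1.trans Finset.sdiff_subset, h2⟩

/-! ### Counting near neighbours; the case s ≥ 4 -/

namespace CriticalColoring

variable {V : Type*} {G : SimpleGraph V} {K : Finset V} {n : ℕ} {f : V → ℕ}

/-- The class also contains a common neighbour of `K`; with `a ≠ b` it would form a claw centred at
a vertex of `K` other than `u`. -/
lemma injOn_nearNbrs [Fintype V] (h : CriticalColoring G K n f) (hK : 2 ≤ K.card) {u a b : V}
    (ha : a ∈ nearNbrs G K u) (hb : b ∈ nearNbrs G K u) (hu : u ∈ K) (hab : f a = f b) : a = b := by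
  classical
  have haK := notMem_of_mem_nearNbrs ha
  have hbK := notMem_of_mem_nearNbrs hb
  obtain ⟨y, hy, hfy, hyK⟩ := h.exists_common (h.lt a haK)
  obtain ⟨x, hx, hxu⟩ := Finset.exists_mem_ne hK u
  rw [mem_nearNbrs] at ha hb
  by_contra hne
  exact h.no_three hy haK hbK (hyK x hx) (ha.2.2 x hx hxu) (hb.2.2 x hx hxu)
    (fun e => ha.2.1 (e ▸ hyK u hu)) (fun e => hb.2.1 (e ▸ hyK u hu)) hne hfy (hfy.trans hab)

lemma eq_of_near_of_near [Fintype V] (h : CriticalColoring G K n f) (hK : 3 ≤ K.card)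
    {u w a b : V} (hu : u ∈ K) (hw : w ∈ K) (ha : a ∈ nearNbrs G K u) (hb : b ∈ nearNbrs G K w)
    (hab : f a = f b) : u = w := by
  classical
  by_contra huw
  have haK := notMem_of_mem_nearNbrs ha
  have hbK := notMem_of_mem_nearNbrs hb
  obtain ⟨y, hy, hfy, hyK⟩ := h.exists_common (h.lt a haK)
  obtain ⟨x, hx, hx'⟩ := Finset.exists_mem_notMem_of_card_lt_card
    (show ({u, w} : Finset V).card < K.card from Finset.card_le_two.trans_lt (by omega))
  simp only [Finset.mem_insert, Finset.mem_singleton, not_or] at hx'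
  rw [mem_nearNbrs] at ha hb
  exact h.no_three hy haK hbK (hyK x hx) (ha.2.2 x hx hx'.1) (hb.2.2 x hx hx'.2)
    (fun e => ha.2.1 (e ▸ hyK u hu)) (fun e => hb.2.1 (e ▸ hyK w hw))
    (fun e => hb.2.1 (e ▸ ha.2.2 w hw (Ne.symm huw))) hfy (hfy.trans hab)

/-- Each class of `f` contains at most one near neighbour, counted over all vertices of `K`. -/
lemma sum_card_nearNbrs_le [Fintype V] (h : CriticalColoring G K n f) (hK : 3 ≤ K.card) :
    ∑ u ∈ K, (nearNbrs G K u).card ≤ n := by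
  classical
  have h1 : ∀ u ∈ K, (nearNbrs G K u).card = ((nearNbrs G K u).image f).card := fun u hu =>
    (Finset.card_image_of_injOn fun a ha b hb hab =>
      h.injOn_nearNbrs (by omega) ha hb hu hab).symm
  rw [Finset.sum_congr rfl h1, ← Finset.card_biUnion]
  · refine (Finset.card_le_card (t := Finset.range n) ?_).trans (by simp)
    intro i hi
    obtain ⟨u, hu, hi⟩ := Finset.mem_biUnion.1 hi
    obtain ⟨a, ha, rfl⟩ := Finset.mem_image.1 hi
    exact Finset.mem_range.2 (h.lt a (notMem_of_mem_nearNbrs ha))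
  · intro u hu w hw huw
    rw [Function.onFun, Finset.disjoint_left]
    intro i hi hi'
    obtain ⟨a, ha, rfl⟩ := Finset.mem_image.1 hi
    obtain ⟨b, hb, hab⟩ := Finset.mem_image.1 hi'
    exact huw (h.eq_of_near_of_near hK hu hw ha hb hab.symm)

end CriticalColoring

lemma sum_card_le_of_disjoint {α β : Type*} [DecidableEq β] {𝒥 : Finset α} {g : α → Finset β}
    {B : Finset β} (hg : ∀ J ∈ 𝒥, g J ⊆ B) (hd : ∀ J ∈ 𝒥, ∀ J' ∈ 𝒥, J ≠ J' → Disjoint (g J) (g J')) :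
    ∑ J ∈ 𝒥, (g J).card ≤ B.card := by
  rw [← Finset.card_biUnion hd]
  exact Finset.card_le_card (Finset.biUnion_subset.2 hg)

namespace CriticalColoring

variable {V : Type*} {G : SimpleGraph V} {K : Finset V} {n : ℕ} {f : V → ℕ}

/-- A set `J` of vertices of `K` and of colours such that in some colouring `d` of the closed
neighbourhood of `x` the corresponding vertices missing at most one vertex of `K` use fewer than
`|J|` colours. -/
lemma four_le_or_two_le [Fintype V] [DecidableEq V] (h : CriticalColoring G K n f)
    (hK : 4 ≤ K.card) (hn : 3 ≤ n) {x : V} (hx : x ∈ K) {d : V → ℕ}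
    (hd : ProperOn G {v | v = x ∨ G.Adj x v} d) {U : Finset V}
    (hU : ∀ v, v ∈ U ↔ v ∈ K ∨ G.Adj x v ∧ ∃ u, ∀ w ∈ K, w ≠ u → G.Adj w v) {J : Finset (V ⊕ ℕ)}
    (hJ : J ⊆ K.disjSum (Finset.range n))
    (hJd : ((U.filter fun v => (if v ∈ K then Sum.inl v else Sum.inr (f v)) ∈ J).image d).card + 1 =
      J.card) :
    4 ≤ J.toRight.card ∨ 2 ≤ (J.toRight ∩ (nearNbrs G K x).image f).card := by
  classical
  by_contra hno
  push Not at hno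
  have hJr : J.toRight ⊆ Finset.range n := by
    intro i hi
    simpa using hJ (Finset.mem_toRight.1 hi)
  have hJl : J.toLeft ⊆ K := by
    intro i hi
    simpa using hJ (Finset.mem_toLeft.1 hi)
  -- If both alternatives fail, the classes in `J` are padded to exactly three, to contradict
  -- `false_of_coloring_near`.
  obtain ⟨C, hC, hCn, hCc⟩ := Finset.exists_subsuperset_card_eq hJr
    (show J.toRight.card ≤ 3 by omega) (by simpa using hn)
  set UJ := U.filter fun v => (if v ∈ K then Sum.inl v else Sum.inr (f v)) ∈ J with hUJ
  -- the colour of the vertex `x`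
  set cx : ℕ ⊕ (V ⊕ ℕ) := if Sum.inl x ∈ J then Sum.inl (d x) else Sum.inr (Sum.inl x) with hcx
  -- Labels in `J` are coloured by `d`, all others by themselves. Only near neighbours of `x` in
  -- classes of `J` escape `d`; they lie in a single class and can share the colour of `x`.
  set φ : V → ℕ ⊕ (V ⊕ ℕ) := fun v =>
    if v ∈ K then if Sum.inl v ∈ J then Sum.inl (d v) else Sum.inr (Sum.inl v)
    else if f v ∈ J.toRight then if G.Adj x v then Sum.inl (d v) else cx
    else Sum.inr (Sum.inr (f v)) with hφ
  set P : Set V := {v | v ∈ K ∨ f v ∈ C ∧ (∃ u, ∀ w ∈ K, w ≠ u → G.Adj w v)} with hP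
  have hUmem : ∀ v ∈ K, Sum.inl v ∈ J → v ∈ UJ := by
    intro v hv hvJ
    rw [hUJ, Finset.mem_filter, hU]
    exact ⟨Or.inl hv, by simpa [hv] using hvJ⟩
  have hUx : ∀ v ∈ U, v = x ∨ G.Adj x v := by
    intro v hv
    rcases (hU v).1 hv with hv | hv
    · by_cases e : v = x
      · exact Or.inl e
      · exact Or.inr (h.clique hx hv (Ne.symm e))
    · exact Or.inr hv.1
  -- the four kinds of vertices
  have hkind : ∀ v ∈ P, (v ∈ UJ ∧ φ v = Sum.inl (d v)) ∨ (v ∈ K ∧ Sum.inl v ∉ J ∧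
      φ v = Sum.inr (Sum.inl v)) ∨ (v ∉ K ∧ f v ∈ C \ J.toRight ∧ φ v = Sum.inr (Sum.inr (f v))) ∨
      (v ∉ K ∧ v ∈ nearNbrs G K x ∧ f v ∈ J.toRight ∧ φ v = cx) := by
    intro v hv
    by_cases hvK : v ∈ K
    · by_cases hvJ : Sum.inl v ∈ J
      · exact Or.inl ⟨hUmem v hvK hvJ, by simp only [hφ, hvK, hvJ, if_true]⟩
      · exact Or.inr (Or.inl ⟨hvK, hvJ, by simp only [hφ, hvK, hvJ, if_true, if_false]⟩)
    · obtain ⟨hvC, u, hu⟩ := hv.resolve_left hvK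
      by_cases hvJ : f v ∈ J.toRight
      · by_cases hxv : G.Adj x v
        · refine Or.inl ⟨?_, by simp only [hφ, hvK, hvJ, hxv, if_true, if_false]⟩
          rw [hUJ, Finset.mem_filter, hU]
          exact ⟨Or.inr ⟨hxv, u, hu⟩, by simpa [hvK] using hvJ⟩
        · refine Or.inr (Or.inr (Or.inr ⟨hvK, ?_, hvJ,
            by simp only [hφ, hvK, hvJ, hxv, if_true, if_false]⟩))
          rw [mem_nearNbrs]
          refine ⟨fun e => hvK (e ▸ hx), hxv, fun w hw hwx => hu w hw ?_⟩
          rintro rfl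
          exact hxv (hu x hx hwx.symm)
      · exact Or.inr (Or.inr (Or.inl ⟨hvK, Finset.mem_sdiff.2 ⟨hvC, hvJ⟩,
          by simp only [hφ, hvK, hvJ, if_false]⟩))
  have hcxk : (x ∈ UJ ∧ cx = Sum.inl (d x)) ∨ (Sum.inl x ∉ J ∧ cx = Sum.inr (Sum.inl x)) := by
    by_cases hxJ : Sum.inl x ∈ J
    · exact Or.inl ⟨hUmem x hx hxJ, by simp only [hcx, hxJ, if_true]⟩
    · exact Or.inr ⟨hxJ, by simp only [hcx, hxJ, if_false]⟩
  have hdUJ : ∀ a ∈ UJ, ∀ b ∈ UJ, G.Adj a b → d a ≠ d b := fun a ha b hb =>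
    hd a (hUx a (Finset.mem_filter.1 ha).1) b (hUx b (Finset.mem_filter.1 hb).1)
  have hspecial : ∀ a b, a ∈ nearNbrs G K x → a ∉ K → f a ∈ J.toRight → φ a = cx → b ∈ P →
      φ b = cx → ¬ G.Adj a b := by
    intro a b ha haK haJ hac hb hbc hab
    rcases hkind b hb with ⟨hb1, hb2⟩ | ⟨hb1, hb3, hb2⟩ | ⟨hb1, hb3, hb2⟩ | ⟨hb1, hb3, hb4, hb2⟩
    · rcases hcxk with ⟨hx1, hx2⟩ | ⟨hx1, hx2⟩
      · rw [hb2, hx2, Sum.inl.injEq] at hbc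
        rcases hUx b (Finset.mem_filter.1 hb1).1 with rfl | hxb
        · exact (mem_nearNbrs.1 ha).2.1 hab.symm
        · exact hdUJ x hx1 b hb1 hxb hbc.symm
      · rw [hb2, hx2] at hbc
        cases hbc
    · rcases hcxk with ⟨hx1, hx2⟩ | ⟨hx1, hx2⟩
      · rw [hb2, hx2] at hbc
        cases hbc
      · rw [hb2, hx2, Sum.inr.injEq, Sum.inl.injEq] at hbc
        subst hbc
        exact (mem_nearNbrs.1 ha).2.1 hab.symm
    · rcases hcxk with ⟨hx1, hx2⟩ | ⟨hx1, hx2⟩ <;> · rw [hb2, hx2] at hbc; simp at hbc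
    · have h1 : f a = f b := by
        refine Finset.card_le_one.1 (show (J.toRight ∩ (nearNbrs G K x).image f).card ≤ 1 by omega)
          _ ?_ _ ?_
        · exact Finset.mem_inter.2 ⟨haJ, Finset.mem_image_of_mem f ha⟩
        · exact Finset.mem_inter.2 ⟨hb4, Finset.mem_image_of_mem f hb3⟩
      exact h.not_adj haK hb1 h1 hab
  have hcol : ColOn G P (K.card + 2) := by
    refine ColOn.of_image φ
      ((UJ.image d).disjSum ((K \ J.toLeft).disjSum (C \ J.toRight))) ?_ ?_ ?_
    · have hcxm : cx ∈ (UJ.image d).disjSum ((K \ J.toLeft).disjSum (C \ J.toRight)) := by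
        rcases hcxk with ⟨hx1, hx2⟩ | ⟨hx1, hx2⟩
        · rw [hx2, Finset.inl_mem_disjSum]
          exact Finset.mem_image_of_mem d hx1
        · rw [hx2, Finset.inr_mem_disjSum, Finset.inl_mem_disjSum, Finset.mem_sdiff,
            Finset.mem_toLeft]
          exact ⟨hx, hx1⟩
      intro v hv
      rcases hkind v hv with ⟨hb1, hb2⟩ | ⟨hb1, hb3, hb2⟩ | ⟨hb1, hb3, hb2⟩ | ⟨hb1, hb3, hb4, hb2⟩
      · rw [hb2, Finset.inl_mem_disjSum]
        exact Finset.mem_image_of_mem d hb1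
      · rw [hb2, Finset.inr_mem_disjSum, Finset.inl_mem_disjSum, Finset.mem_sdiff,
            Finset.mem_toLeft]
        exact ⟨hb1, hb3⟩
      · rw [hb2, Finset.inr_mem_disjSum, Finset.inr_mem_disjSum]
        exact hb3
      · rw [hb2]
        exact hcxm
    · intro a ha b hb hab he
      rcases hkind a ha with ⟨ha1, ha2⟩ | ⟨ha1, ha3, ha2⟩ | ⟨ha1, ha3, ha2⟩ | ⟨ha1, ha3, ha4, ha2⟩
      · rcases hkind b hb with ⟨hb1, hb2⟩ | ⟨hb1, hb3, hb2⟩ | ⟨hb1, hb3, hb2⟩ | ⟨hb1, hb3, hb4, hb2⟩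
        · rw [ha2, hb2, Sum.inl.injEq] at he
          exact hdUJ a ha1 b hb1 hab he
        · rw [ha2, hb2] at he; cases he
        · rw [ha2, hb2] at he; cases he
        · exact hspecial b a hb3 hb1 hb4 hb2 ha (he.trans hb2) hab.symm
      · rcases hkind b hb with ⟨hb1, hb2⟩ | ⟨hb1, hb3, hb2⟩ | ⟨hb1, hb3, hb2⟩ | ⟨hb1, hb3, hb4, hb2⟩
        · rw [ha2, hb2] at he; cases he
        · rw [ha2, hb2, Sum.inr.injEq, Sum.inl.injEq] at he
          exact hab.ne he
        · rw [ha2, hb2] at he; simp at he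
        · exact hspecial b a hb3 hb1 hb4 hb2 ha (he.trans hb2) hab.symm
      · rcases hkind b hb with ⟨hb1, hb2⟩ | ⟨hb1, hb3, hb2⟩ | ⟨hb1, hb3, hb2⟩ | ⟨hb1, hb3, hb4, hb2⟩
        · rw [ha2, hb2] at he; cases he
        · rw [ha2, hb2] at he; simp at he
        · rw [ha2, hb2, Sum.inr.injEq, Sum.inr.injEq] at he
          exact h.not_adj ha1 hb1 he hab
        · exact hspecial b a hb3 hb1 hb4 hb2 ha (he.trans hb2) hab.symm
      · exact hspecial a b ha3 ha1 ha4 ha2 hb (he.symm.trans ha2) hab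
    · rw [Finset.card_disjSum, Finset.card_disjSum, Finset.card_sdiff_of_subset hJl,
        Finset.card_sdiff_of_subset hC]
      have h1 : J.toLeft.card + J.toRight.card = J.card := Finset.card_toLeft_add_card_toRight
      have h2 := Finset.card_le_card hJl
      omega
  obtain ⟨ψ, hψ, hψp⟩ := hcol
  exact h.false_of_coloring_near hK (fun j hj => Finset.mem_range.1 (hCn hj)) hCc ψ hψ hψp

end CriticalColoring

/-- There are `s` disjoint deficient sets. Each has at least four classes, or at least two
containing near neighbours of `x`, so its classes count at least 4 when those of the latter kind are
counted twice. If `x` has at most three near neighbours, this gives `4 * s ≤ n + 3`. -/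
lemma not_unsplit_of_clawFree_of_four_le {V : Type*} [Finite V] {G : SimpleGraph V}
    (hG : ClawFree G) {s n : ℕ} (hs : 4 ≤ s) (hn : 3 ≤ n) (hns : n ≤ 4 * s - 4) {K : Finset V}
    (hK : G.IsClique (K : Set V)) (hKc : K.card = s) : ¬ Unsplit G s n := by
  classical
  have := Fintype.ofFinite V
  intro h
  obtain ⟨L, hL, hLc, hLa⟩ := h.exists_avoidable_clique (by omega) hK hKc
  clear hK hKc K
  obtain ⟨f, hf⟩ := h.exists_criticalColoring hG (by omega) hL hLc
  -- Four near neighbours at every vertex of `L` would add up to `4 * s > n`.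
  obtain ⟨x, hx, hx3⟩ : ∃ x ∈ L, (nearNbrs G L x).card ≤ 3 := by
    by_contra hno
    push Not at hno
    have h1 := hf.sum_card_nearNbrs_le (by omega)
    have h2 := Finset.card_nsmul_le_sum L (fun u => (nearNbrs G L u).card) 4 fun u hu => hno u hu
    rw [smul_eq_mul] at h2
    omega
  obtain ⟨d, hd, hdp⟩ := h.exists_coloring_of_avoidable (by omega) (hLa x hx)
  set U : Finset V := Finset.univ.filter fun v =>
    v ∈ L ∨ G.Adj x v ∧ ∃ u, ∀ w ∈ L, w ≠ u → G.Adj w v with hU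
  have hUx : ∀ v ∈ U, v = x ∨ G.Adj x v := by
    intro v hv
    rcases (Finset.mem_filter.1 hv).2 with hv | hv
    · by_cases e : v = x
      · exact Or.inl e
      · exact Or.inr (hL hx hv (Ne.symm e))
    · exact Or.inr hv.1
  have hdU : ∀ a ∈ U, ∀ b ∈ U, d a = d b → ¬ G.Adj a b := fun a ha b hb hab hadj =>
    hdp a (hUx a ha) b (hUx b hb) hadj hab
  obtain ⟨𝒥, h𝒥c, h𝒥d, h𝒥⟩ := exists_disjoint_deficient
    (fun v => if v ∈ L then (Sum.inl v : V ⊕ ℕ) else Sum.inr (f v)) d U (by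
      intro a ha b hb c hc hab hac hbc h1 h2
      rcases hUx a ha with rfl | hxa
      · exact hdU a ha b hb h1 ((hUx b hb).resolve_left hab.symm)
      rcases hUx b hb with rfl | hxb
      · exact hdU a ha b hb h1 hxa.symm
      rcases hUx c hc with rfl | hxc
      · exact hdU a ha c hc h2 hxa.symm
      exact hG.not_claw hxa hxb hxc hab hac hbc (hdU a ha b hb h1) (hdU a ha c hc h2)
        (hdU b hb c hc (h1.symm.trans h2))) s (L.disjSum (Finset.range n)) (by
      rw [Finset.card_disjSum, hLc, Finset.card_range, add_comm s n]
      refine Nat.add_le_add_right ((Finset.card_le_card (t := Finset.range n) ?_).trans (by simp)) s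
      intro i hi
      obtain ⟨v, hv, rfl⟩ := Finset.mem_image.1 hi
      exact Finset.mem_range.2 (hd v (hUx v (Finset.mem_filter.1 hv).1)))
  have hdisj : ∀ J ∈ 𝒥, ∀ J' ∈ 𝒥, J ≠ J' → Disjoint J.toRight J'.toRight := by
    intro J hJ J' hJ' hne
    rw [Finset.disjoint_left]
    intro i hi hi'
    exact Finset.disjoint_left.1 (h𝒥d J hJ J' hJ' hne) (Finset.mem_toRight.1 hi)
      (Finset.mem_toRight.1 hi')
  have h1 : ∑ J ∈ 𝒥, J.toRight.card ≤ (Finset.range n).card := by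
    refine sum_card_le_of_disjoint (fun J hJ i hi => ?_) hdisj
    simpa using (h𝒥 J hJ).1 (Finset.mem_toRight.1 hi)
  have h2 : ∑ J ∈ 𝒥, (J.toRight ∩ (nearNbrs G L x).image f).card ≤
      ((nearNbrs G L x).image f).card := by
    refine sum_card_le_of_disjoint (fun J hJ => Finset.inter_subset_right) ?_
    intro J hJ J' hJ' hne
    exact Finset.disjoint_of_subset_left Finset.inter_subset_left
      (Finset.disjoint_of_subset_right Finset.inter_subset_left (hdisj J hJ J' hJ' hne))
  have h3 : 𝒥.card • 4 ≤ ∑ J ∈ 𝒥, (J.toRight.card + (J.toRight ∩ (nearNbrs G L x).image f).card) := by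
    refine Finset.card_nsmul_le_sum _ _ _ fun J hJ => ?_
    have h4 := hf.four_le_or_two_le (by omega) hn hx hdp (U := U) (by simp [hU]) (h𝒥 J hJ).1
      (h𝒥 J hJ).2.2.1
    have h5 := Finset.card_le_card
      (Finset.inter_subset_left (s₁ := J.toRight) (s₂ := (nearNbrs G L x).image f))
    omega
  rw [Finset.sum_add_distrib, smul_eq_mul, h𝒥c] at h3
  rw [Finset.card_range] at h1
  have h6 : ((nearNbrs G L x).image f).card ≤ (nearNbrs G L x).card := Finset.card_image_le
  omega

/-! ### The case s = 2 -/

/-- The bounds are tight: `L` has exactly four common neighbours, one per class, and `d` gives them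
at most two colours. Two that agree are nonadjacent and force two near neighbours at one vertex `w`,
although `hnear` leaves room for one. -/
lemma not_unsplit_of_clawFree_two {V : Type*} [Finite V] {G : SimpleGraph V} (hG : ClawFree G)
    {K : Finset V} (hK : G.IsClique (K : Set V)) (hKc : K.card = 2) : ¬ Unsplit G 2 4 := by
  classical
  have := Fintype.ofFinite V
  intro h
  obtain ⟨L, hL, hLc, hLa⟩ := h.exists_avoidable_clique (by omega) hK hKc
  clear hK hKc K
  obtain ⟨f, hf⟩ := h.exists_criticalColoring hG (by omega) hL hLc
  have hnear : ∀ u ∈ L, (commonNbrs G L).card + (nearNbrs G L u).card ≤ 5 := by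
    intro u hu
    obtain ⟨x, hx, hxu⟩ := Finset.exists_mem_ne (show 1 < L.card by omega) u
    have h1 := h.card_commonNbrs_le hG (by omega) (Q := L.erase u) (hL.subset (by simp))
      (Finset.mem_erase.2 ⟨hxu, hx⟩) (hLa x hx)
    rw [card_commonNbrs_erase hL hu, Finset.card_erase_of_mem hu] at h1
    omega
  have himg : Finset.range 4 ⊆ (commonNbrs G L).image f := by
    intro i hi
    obtain ⟨y, hy, hfy, hyL⟩ := hf.exists_common (Finset.mem_range.1 hi)
    exact Finset.mem_image.2 ⟨y, mem_commonNbrs.2 hyL, hfy⟩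
  have h4 := Finset.card_le_card himg
  rw [Finset.card_range] at h4
  have h4' : ((commonNbrs G L).image f).card ≤ (commonNbrs G L).card := Finset.card_image_le
  obtain ⟨x, hx⟩ := Finset.card_pos.1 (show 0 < L.card by omega)
  have hle := h.card_commonNbrs_le hG (by omega) hL hx (hLa x hx)
  have hinj : Set.InjOn f (commonNbrs G L) := Finset.card_image_iff.1 (by omega)
  obtain ⟨d, hd, hdp⟩ := h.exists_coloring_of_avoidable (by omega) (hLa x hx)
  have h2 := card_image_add_card_le hd hdp hL hx (N := commonNbrs G L)
    fun v hv => mem_commonNbrs.1 hv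
  obtain ⟨y, hy, z, hz, hyz, hdyz⟩ := Finset.exists_ne_map_eq_of_card_lt_of_maps_to
    (s := commonNbrs G L) (t := (commonNbrs G L).image d) (by omega)
    (fun a ha => Finset.mem_image_of_mem d ha)
  have huniq : ∀ y ∈ commonNbrs G L, ∀ u ∉ L, f u = f y → u ≠ y → ∃ w ∈ L, ¬ G.Adj w u := by
    intro y hy u _ hfu huy
    by_contra hno
    push Not at hno
    exact huy (hinj (mem_commonNbrs.2 hno) hy hfu)
  obtain ⟨e, he, q, hq, _, _, heq, w, hw, hwe, hwq, hadj⟩ := hf.exists_adj_near (by omega)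
    (notMem_of_mem_commonNbrs hy) (notMem_of_mem_commonNbrs hz) (fun e => hyz (hinj hy hz e))
    (fun hadj => hdp y (Or.inr (mem_commonNbrs.1 hy x hx)) z (Or.inr (mem_commonNbrs.1 hz x hx))
      hadj hdyz) (huniq y hy) (huniq z hz)
  have hew : e ∈ nearNbrs G L w :=
    mem_nearNbrs.2 ⟨fun h' => he (h' ▸ hw), hwe, fun x hx hxw => (hadj x hx hxw).1⟩
  have hqw : q ∈ nearNbrs G L w :=
    mem_nearNbrs.2 ⟨fun h' => hq (h' ▸ hw), hwq, fun x hx hxw => (hadj x hx hxw).2⟩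
  have := Finset.one_lt_card.2 ⟨e, hew, q, hqw, heq.ne⟩
  have := hnear w hw
  omega

/-! ### The case s = 3 -/

namespace CriticalColoring

variable {V : Type*} {G : SimpleGraph V} {K : Finset V} {n : ℕ} {f : V → ℕ}

/-- If the class of `y` has no near neighbour, its vertices adjacent to `v` have lists with at least
two of the three vertices of `K`. This replaces the assumption `|K| ≥ 4` in the list colouring
behind `false_of_three_classes`. -/
lemma exists_near_of_pair [Fintype V] (h : CriticalColoring G K n f) (hK : K.card = 3)
    {v w y z : V} (hv : v ∈ commonNbrs G K) (hw : w ∈ commonNbrs G K) (hy : y ∈ commonNbrs G K)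
    (hz : z ∈ commonNbrs G K) (hfv : f w = f v) (hvw : v ≠ w) (hvy : f v ≠ f y) (hvz : f v ≠ f z)
    (hyz : f y ≠ f z) (hy' : ∀ u ∈ commonNbrs G K, f u = f y → u = y)
    (hz' : ∀ u ∈ commonNbrs G K, f u = f z → u = z) (nvy : ¬ G.Adj v y) (nwz : ¬ G.Adj w z) :
    ∃ u ∈ K, ∃ a ∈ nearNbrs G K u, f a = f y := by
  classical
  by_contra hno
  push Not at hno
  have kv := notMem_of_mem_commonNbrs hv
  have kw := notMem_of_mem_commonNbrs hw
  have ky := notMem_of_mem_commonNbrs hy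
  have kz := notMem_of_mem_commonNbrs hz
  rw [mem_commonNbrs] at hv hw hy hz
  set E := Finset.univ.filter fun e => e ∉ K ∧ f e = f y ∧ G.Adj v e with hE
  set F := Finset.univ.filter fun e => e ∉ K ∧ f e = f z ∧ G.Adj w e with hF
  set L : V → Finset V := fun v => K.filter fun x => ¬ G.Adj x v with hL
  have mE : ∀ e, e ∈ E ↔ e ∉ K ∧ f e = f y ∧ G.Adj v e := by simp [hE]
  have mF : ∀ e, e ∈ F ↔ e ∉ K ∧ f e = f z ∧ G.Adj w e := by simp [hF]
  have eE : ∀ e ∈ E, e ≠ y := by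
    rintro e he rfl
    exact nvy ((mE _).1 he).2.2
  have eF : ∀ e ∈ F, e ≠ z := by
    rintro e he rfl
    exact nwz ((mF _).1 he).2.2
  have hLE : ∀ e ∈ E, 2 ≤ (L e).card := by
    intro e he
    obtain ⟨heK, hfe, _⟩ := (mE e).1 he
    obtain ⟨u, hu, hue⟩ : ∃ u ∈ K, ¬ G.Adj u e := by
      by_contra hall
      push Not at hall
      exact eE e he (hy' e (mem_commonNbrs.2 hall) hfe)
    by_contra hlt
    refine hno u hu e (mem_nearNbrs.2 ⟨fun h' => heK (h' ▸ hu), hue, fun x hx hxu => ?_⟩) hfe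
    by_contra hxe
    exact hxu (Finset.card_le_one.1 (show (L e).card ≤ 1 by omega) x
      (Finset.mem_filter.2 ⟨hx, hxe⟩) u (Finset.mem_filter.2 ⟨hu, hue⟩))
  have hLF : ∀ e ∈ F, 1 ≤ (L e).card := by
    intro e he
    obtain ⟨heK, hfe, _⟩ := (mF e).1 he
    obtain ⟨u, hu, hue⟩ : ∃ u ∈ K, ¬ G.Adj u e := by
      by_contra hall
      push Not at hall
      exact eF e he (hz' e (mem_commonNbrs.2 hall) hfe)
    exact Finset.card_pos.2 ⟨u, Finset.mem_filter.2 ⟨hu, hue⟩⟩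
  have hE1 : ∀ e ∈ E, ∀ e' ∈ E, e = e' := by
    intro e he e' he'
    by_contra hne
    -- A common nonneighbour of `e` and `e'` in `K` would form a claw with them at `v`; but two
    -- disjoint lists of size two do not fit into `K`.
    have hdisj : Disjoint (L e) (L e') := by
      rw [Finset.disjoint_left]
      intro x hx hx'
      rw [Finset.mem_filter] at hx hx'
      have h1 := (mE e).1 he
      have h2 := (mE e').1 he'
      exact h.claw.not_claw (hv x hx.1).symm h1.2.2 h2.2.2 (fun e => h1.1 (e ▸ hx.1))
        (fun e => h2.1 (e ▸ hx.1)) hne hx.2 hx'.2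
        (h.not_adj h1.1 h2.1 (h1.2.1.trans h2.2.1.symm))
    have h1 : (L e ∪ L e').card ≤ K.card := Finset.card_le_card
      (Finset.union_subset (Finset.filter_subset _ _) (Finset.filter_subset _ _))
    rw [Finset.card_union_of_disjoint hdisj] at h1
    have := hLE e he
    have := hLE e' he'
    omega
  have hF1 : ∀ e ∈ F, ∀ e' ∈ F, e ≠ e' → 3 ≤ (L e).card + (L e').card := by
    intro e he e' he' hne
    rw [← hK]
    exact h.card_nonNbrs_add kz hz ((mF e).1 he).1 ((mF e').1 he').1 ((mF e).1 he).2.1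
      ((mF e').1 he').2.1 (eF e he) (eF e' he') hne
  have hα : ∃ a, ∀ e ∈ E, a ∈ L e ∧ ∀ q ∈ F, ∃ b ∈ L q, b ≠ a := by
    by_cases hEne : ∃ e, e ∈ E
    · obtain ⟨e, he⟩ := hEne
      suffices H : ∃ a ∈ L e, ∀ q ∈ F, ∃ b ∈ L q, b ≠ a by
        obtain ⟨a, ha, ha'⟩ := H
        exact ⟨a, fun e' he' => ⟨hE1 e he e' he' ▸ ha, ha'⟩⟩
      by_cases hq : ∃ q ∈ F, (L q).card ≤ 1
      · obtain ⟨q, hq, hq1⟩ := hq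
        obtain ⟨c, hc⟩ := Finset.card_eq_one.1 (le_antisymm hq1 (hLF q hq))
        obtain ⟨a, ha, hac⟩ := Finset.exists_mem_ne (hLE e he) c
        refine ⟨a, ha, fun r hr => ?_⟩
        by_cases hrq : r = q
        · subst hrq
          exact ⟨c, by simp [hc], hac.symm⟩
        · exact Finset.exists_mem_ne (by have := hF1 q hq r hr (Ne.symm hrq); omega) a
      · push Not at hq
        obtain ⟨a, ha⟩ := Finset.card_pos.1 (show 0 < (L e).card by have := hLE e he; omega)
        exact ⟨a, ha, fun r hr => Finset.exists_mem_ne (hq r hr) a⟩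
    · exact ⟨v, fun e he => absurd ⟨e, he⟩ hEne⟩
  obtain ⟨a, ha⟩ := hα
  obtain ⟨c, hc, hc'⟩ := exists_list_coloring (E := E) (F := F) (L := L) (r := G.Adj) (fun _ => a)
    (fun e he => (ha e he).1) (fun q hq => by
      by_cases hEne : ∃ e, e ∈ E
      · obtain ⟨e, he⟩ := hEne
        obtain ⟨b, hb, hba⟩ := (ha e he).2 q hq
        exact ⟨b, hb, fun _ _ _ => hba⟩
      · obtain ⟨b, hb⟩ := Finset.card_pos.1 (hLF q hq)
        exact ⟨b, hb, fun e he => absurd ⟨e, he⟩ hEne⟩)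
    (by
      rw [Finset.disjoint_left]
      intro e he he'
      exact hyz (((mE e).1 he).2.1.symm.trans ((mF e).1 he').2.1))
  refine h.false_of_three_classes (by omega) (h.lt y ky) (h.lt z kz) kv kw hfv hvy hvz hyz hvw c
    ?_ ?_ ?_
  · rintro e he (he' | he')
    · exact Finset.mem_filter.1 (hc e (Or.inl ((mE e).2 ⟨he, he'⟩)))
    · exact Finset.mem_filter.1 (hc e (Or.inr ((mF e).2 ⟨he, he'⟩)))
  · intro e he hfe hve q hq hfq hwq
    exact hc' e ((mE e).2 ⟨he, hfe, hve⟩) q ((mF q).2 ⟨hq, hfq, hwq⟩)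
  · intro r hr hfr hrv hrw a b
    obtain ⟨x, hx, hx'⟩ := Finset.exists_mem_notMem_of_card_lt_card
      (show ({a, b} : Finset V).card < K.card from Finset.card_le_two.trans_lt (by omega))
    simp only [Finset.mem_insert, Finset.mem_singleton, not_or] at hx'
    refine ⟨x, hx, fun hxr => ?_, hx'⟩
    exact h.no_three kv kw hr (hv x hx) (hw x hx) hxr hvw hrv.symm hrw.symm hfv.symm hfr.symm

end CriticalColoring

namespace CriticalColoring

variable {V : Type*} {G : SimpleGraph V} {K : Finset V} {n : ℕ} {f : V → ℕ}

lemma one_le_card_commonNbrs_color [Fintype V] (h : CriticalColoring G K n f) {i : ℕ}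
    (hi : i < n) : 1 ≤ ((commonNbrs G K).filter fun v => f v = i).card := by
  obtain ⟨y, _, hfy, hyK⟩ := h.exists_common hi
  exact Finset.card_pos.2 ⟨y, Finset.mem_filter.2 ⟨mem_commonNbrs.2 hyK, hfy⟩⟩

/-- Two colours with unique common neighbours of `K`, which are nonadjacent, are colours of
vertices whose only nonneighbour in `K` is the same vertex. -/
lemma exists_near_colors [Fintype V] (h : CriticalColoring G K n f) (hK : 1 ≤ K.card)
    {y z : V} (hy : y ∈ commonNbrs G K) (hz : z ∈ commonNbrs G K) (hyz : f y ≠ f z)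
    (nyz : ¬ G.Adj y z) (hy' : ∀ u ∈ commonNbrs G K, f u = f y → u = y)
    (hz' : ∀ u ∈ commonNbrs G K, f u = f z → u = z) :
    ∃ u ∈ K, (∃ a ∈ nearNbrs G K u, f a = f y) ∧ ∃ a ∈ nearNbrs G K u, f a = f z := by
  have huniq : ∀ y, (∀ u ∈ commonNbrs G K, f u = f y → u = y) →
      ∀ u ∉ K, f u = f y → u ≠ y → ∃ w ∈ K, ¬ G.Adj w u := by
    intro y hy u _ hfu huy
    by_contra hno
    push Not at hno
    exact huy (hy u (mem_commonNbrs.2 hno) hfu)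
  obtain ⟨e, he, q, hq, hfe, hfq, heq, w, hw, hwe, hwq, hadj⟩ := h.exists_adj_near hK
    (notMem_of_mem_commonNbrs hy) (notMem_of_mem_commonNbrs hz) hyz nyz (huniq y hy') (huniq z hz')
  exact ⟨w, hw, ⟨e, mem_nearNbrs.2 ⟨fun h' => he (h' ▸ hw), hwe, fun x hx hxw => (hadj x hx hxw).1⟩,
    hfe⟩, q, mem_nearNbrs.2 ⟨fun h' => hq (h' ▸ hw), hwq, fun x hx hxw => (hadj x hx hxw).2⟩, hfq⟩

set_option maxHeartbeats 1600000 in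
-- The three deficient sets are sorted by size: `f₀` with two classes, `f₁` with three, `f₂` with
-- more. A pair consists of classes with one common neighbour each and puts near neighbours of one
-- vertex `u` in both. A triple has two common neighbours in one class and near neighbours in the
-- other two. A larger set has at least two common neighbours beyond one per class.
lemma exists_counts [Fintype V] [DecidableEq V] (h : CriticalColoring G K n f) (hK : K.card = 3)
    {d : V → ℕ} (hd : ∀ a ∈ commonNbrs G K, ∀ b ∈ commonNbrs G K, d a = d b → ¬ G.Adj a b)
    {I : Finset ℕ} (hI : I ⊆ Finset.range n)
    (hdI : (((commonNbrs G K).filter fun v => f v ∈ I).image d).card + 3 ≤ I.card) :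
    ∃ f₀ f₁ f₂ : ℕ, f₀ + f₁ + f₂ = 3 ∧ n + (f₁ + 2 * f₂) ≤ (commonNbrs G K).card ∧
      2 * (f₀ + f₁) ≤ ∑ u ∈ K, (((nearNbrs G K u).image f) ∩ I).card ∧
      f₀ ≤ ∑ u ∈ K, (((nearNbrs G K u).image f) ∩ I).card / 2 := by
  classical
  set N := commonNbrs G K with hN
  set c : ℕ → ℕ := fun i => (N.filter fun v => f v = i).card with hc
  set Dc : V → Finset ℕ := fun u => (nearNbrs G K u).image f with hDc
  obtain ⟨x, hx⟩ := Finset.card_pos.1 (show 0 < K.card by omega)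
  have h3 : ∀ a ∈ N, ∀ b ∈ N, ∀ c ∈ N, a ≠ b → a ≠ c → b ≠ c → d a = d b → d a = d c → False := by
    intro a ha b hb c hc hab hac hbc h1 h2
    exact h.claw.not_claw (mem_commonNbrs.1 ha x hx) (mem_commonNbrs.1 hb x hx)
      (mem_commonNbrs.1 hc x hx) hab hac hbc (hd a ha b hb h1) (hd a ha c hc h2)
      (hd b hb c hc (h1.symm.trans h2))
  obtain ⟨𝒥, h𝒥c, h𝒥d, h𝒥⟩ := exists_disjoint_deficient f d N h3 3 I hdI
  have hc1 : ∀ i ∈ I, 1 ≤ c i := fun i hi =>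
    h.one_le_card_commonNbrs_color (Finset.mem_range.1 (hI hi))
  have huniq : ∀ i, c i = 1 → ∀ y ∈ N, f y = i → ∀ u ∈ N, f u = f y → u = y := by
    intro i hi y hy hfy u hu hfu
    exact Finset.card_le_one.1 hi.le u (Finset.mem_filter.2 ⟨hu, hfu.trans hfy⟩) y
      (Finset.mem_filter.2 ⟨hy, hfy⟩)
  -- Each of the `|J| - 1` colours on `J` is used exactly twice.
  have hsum : ∀ J ∈ 𝒥, ∑ i ∈ J, c i + 2 = 2 * J.card := by
    intro J hJ
    obtain ⟨_, _, hJd, hJp⟩ := h𝒥 J hJ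
    have h1 : (N.filter fun v => f v ∈ J).card = ∑ i ∈ J, c i := by
      have e := Finset.card_eq_sum_card_fiberwise (f := f) (s := N.filter fun v => f v ∈ J) (t := J)
        (fun v hv => (Finset.mem_filter.1 hv).2)
      rw [e]
      refine Finset.sum_congr rfl fun i hi => ?_
      rw [hc, Finset.filter_filter]
      congr 1
      refine Finset.filter_congr fun v _ => ?_
      constructor
      · exact fun h' => h'.2
      · exact fun h' => ⟨h' ▸ hi, h'⟩
    have h2 : (N.filter fun v => f v ∈ J).card ≤ 2 * ((N.filter fun v => f v ∈ J).image d).card :=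
      h.claw.card_le_two_mul_card_image (x := x)
        (fun v hv => mem_commonNbrs.1 (Finset.mem_filter.1 hv).1 x hx)
        (fun a ha b hb hab he =>
          hd a (Finset.mem_filter.1 ha).1 b (Finset.mem_filter.1 hb).1 he hab)
    have h4 : 2 * ((N.filter fun v => f v ∈ J).image d).card ≤ (N.filter fun v => f v ∈ J).card := by
      refine Finset.mul_card_image_le_card _ 2 fun a ha => ?_
      obtain ⟨v, hv, rfl⟩ := Finset.mem_image.1 ha
      rw [Finset.mem_filter] at hv
      obtain ⟨v', hv', hfv', hne, hdv, _⟩ := hJp v hv.1 hv.2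
      exact Finset.one_lt_card.2 ⟨v, by simp [hv.1, hv.2], v', by simp [hv', hfv', hdv], hne.symm⟩
    omega
  have hJ2 : ∀ J ∈ 𝒥, 2 ≤ J.card := by
    intro J hJ
    have h1 := Finset.card_nsmul_le_sum J c 1 fun i hi => hc1 i ((h𝒥 J hJ).1 hi)
    have h2 : J.sum c + 2 = 2 * J.card := hsum J hJ
    rw [smul_eq_mul] at h1
    omega
  have hexc : ∀ i ∈ I, ∃ y ∈ N, f y = i := by
    intro i hi
    obtain ⟨y, hy⟩ := Finset.card_pos.1 (hc1 i hi)
    exact ⟨y, (Finset.mem_filter.1 hy).1, (Finset.mem_filter.1 hy).2⟩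
  have hcase2 : ∀ J ∈ 𝒥, J.card = 2 → ∃ u ∈ K, J ⊆ Dc u := by
    intro J hJ hJc
    obtain ⟨i, j, hij, rfl⟩ := Finset.card_eq_two.1 hJc
    obtain ⟨hJI, -, -, hJp⟩ := h𝒥 _ hJ
    have h1 := hsum _ hJ
    rw [Finset.sum_pair hij, hJc] at h1
    have hi := hc1 i (hJI (by simp))
    have hj := hc1 j (hJI (by simp))
    obtain ⟨y, hy, hfy⟩ := hexc i (hJI (by simp))
    obtain ⟨z, hz, hfz, _, hdz, hne⟩ := hJp y hy (by simp [hfy])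
    have hfz' : f z = j := by
      rw [Finset.mem_insert, Finset.mem_singleton] at hfz
      exact hfz.resolve_left (fun e => hne (e.trans hfy.symm))
    obtain ⟨u, hu, ⟨a, ha, hfa⟩, b, hb, hfb⟩ := h.exists_near_colors (by omega) hy hz hne.symm
      (hd y hy z hz hdz.symm) (huniq i (by omega) y hy hfy) (huniq j (by omega) z hz hfz')
    refine ⟨u, hu, fun k hk => ?_⟩
    rw [Finset.mem_insert, Finset.mem_singleton] at hk
    rcases hk with rfl | rfl
    · exact Finset.mem_image.2 ⟨a, ha, hfa.trans hfy⟩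
    · exact Finset.mem_image.2 ⟨b, hb, hfb.trans hfz'⟩
  have hcase3 : ∀ J ∈ 𝒥, J.card = 3 → 2 ≤ (J ∩ K.biUnion Dc).card := by
    intro J hJ hJc
    obtain ⟨hJI, -, -, hJp⟩ := h𝒥 _ hJ
    have key : ∀ i j k, i ≠ j → i ≠ k → j ≠ k → J = {i, j, k} → c i = 2 → c j = 1 → c k = 1 →
        2 ≤ (J ∩ K.biUnion Dc).card := by
      intro i j k hij hik hjk hJeq hci hcj hck
      obtain ⟨v, w, hvw, hvweq⟩ := Finset.card_eq_two.1 hci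
      have hv : v ∈ N.filter fun v => f v = i := by rw [hvweq]; simp
      have hw : w ∈ N.filter fun v => f v = i := by rw [hvweq]; simp
      rw [Finset.mem_filter] at hv hw
      have hcol : ∀ m, m = j ∨ m = k → c m = 1 := by rintro m (rfl | rfl) <;> assumption
      obtain ⟨y, hy, hfy, hyv, hdy, hny⟩ := hJp v hv.1 (by simp [hJeq, hv.2])
      obtain ⟨z, hz, hfz, hzw, hdz, hnz⟩ := hJp w hw.1 (by simp [hJeq, hw.2])
      have hfy' : f y = j ∨ f y = k := by
        rw [hJeq, Finset.mem_insert, Finset.mem_insert, Finset.mem_singleton] at hfy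
        exact hfy.resolve_left fun e => hny (e.trans hv.2.symm)
      have hfz' : f z = j ∨ f z = k := by
        rw [hJeq, Finset.mem_insert, Finset.mem_insert, Finset.mem_singleton] at hfz
        exact hfz.resolve_left fun e => hnz (e.trans hw.2.symm)
      have uy := huniq _ (hcol _ hfy') y hy rfl
      have uz := huniq _ (hcol _ hfz') z hz rfl
      have hfyz : f y ≠ f z := by
        intro e
        have := uz y hy e
        subst this
        exact h3 v hv.1 w hw.1 y hy hvw hyv.symm hzw.symm (hdy.symm.trans hdz) hdy.symm
      have hiy : f v ≠ f y := hny.symm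
      have hiz : f v ≠ f z := fun e => hnz (e.symm.trans (hv.2.trans hw.2.symm))
      have hwv : f w = f v := hw.2.trans hv.2.symm
      obtain ⟨u1, hu1, a1, ha1, e1⟩ := h.exists_near_of_pair hK hv.1 hw.1 hy hz hwv hvw hiy hiz hfyz
        uy uz (hd v hv.1 y hy hdy.symm) (hd w hw.1 z hz hdz.symm)
      obtain ⟨u2, hu2, a2, ha2, e2⟩ := h.exists_near_of_pair hK hw.1 hv.1 hz hy hwv.symm hvw.symm
        (hwv ▸ hiz) (hwv ▸ hiy) hfyz.symm uz uy (hd w hw.1 z hz hdz.symm) (hd v hv.1 y hy hdy.symm)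
      refine Finset.one_lt_card.2 ⟨f y, ?_, f z, ?_, hfyz⟩
      · exact Finset.mem_inter.2 ⟨hfy, Finset.mem_biUnion.2 ⟨u1, hu1, Finset.mem_image.2 ⟨a1, ha1, e1⟩⟩⟩
      · exact Finset.mem_inter.2 ⟨hfz, Finset.mem_biUnion.2 ⟨u2, hu2, Finset.mem_image.2 ⟨a2, ha2, e2⟩⟩⟩
    obtain ⟨i, j, k, hij, hik, hjk, hJeq⟩ := Finset.card_eq_three.1 hJc
    have h1 := hsum _ hJ
    rw [hJc, hJeq, Finset.sum_insert (by simp [hij, hik]), Finset.sum_pair hjk] at h1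
    have hi := hc1 i (hJI (by simp [hJeq]))
    have hj := hc1 j (hJI (by simp [hJeq]))
    have hk := hc1 k (hJI (by simp [hJeq]))
    have : c i = 2 ∧ c j = 1 ∧ c k = 1 ∨ c j = 2 ∧ c i = 1 ∧ c k = 1 ∨
      c k = 2 ∧ c i = 1 ∧ c j = 1 := by omega
    rcases this with ⟨k1, k2, k3⟩ | ⟨k1, k2, k3⟩ | ⟨k1, k2, k3⟩
    · exact key i j k hij hik hjk hJeq k1 k2 k3
    · exact key j i k hij.symm hjk hik (by rw [hJeq, Finset.insert_comm]) k1 k2 k3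
    · exact key k i j hik.symm hjk.symm hij (by
        rw [hJeq]
        ext m
        simp only [Finset.mem_insert, Finset.mem_singleton]
        tauto) k1 k2 k3
  refine ⟨∑ J ∈ 𝒥, if J.card = 2 then 1 else 0, ∑ J ∈ 𝒥, if J.card = 3 then 1 else 0,
    ∑ J ∈ 𝒥, if 4 ≤ J.card then 1 else 0, ?_, ?_, ?_, ?_⟩
  · rw [← Finset.sum_add_distrib, ← Finset.sum_add_distrib]
    refine (Finset.sum_congr rfl fun J hJ => ?_).trans (Finset.card_eq_sum_ones 𝒥 ▸ h𝒥c)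
    have := hJ2 J hJ
    split_ifs <;> omega
  · have h1 : (∑ J ∈ 𝒥, if J.card = 3 then 1 else 0) + 2 * (∑ J ∈ 𝒥, if 4 ≤ J.card then 1 else 0) ≤
        ∑ J ∈ 𝒥, ∑ i ∈ J, (c i - 1) := by
      rw [Finset.mul_sum, ← Finset.sum_add_distrib]
      refine Finset.sum_le_sum fun J hJ => ?_
      have h2 : ∑ i ∈ J, (c i - 1) + J.card = ∑ i ∈ J, c i := by
        rw [Finset.card_eq_sum_ones, ← Finset.sum_add_distrib]
        refine Finset.sum_congr rfl fun i hi => ?_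
        have := hc1 i ((h𝒥 J hJ).1 hi)
        omega
      have h4 := hsum J hJ
      split_ifs <;> omega
    have h2 : ∑ J ∈ 𝒥, ∑ i ∈ J, (c i - 1) ≤ ∑ i ∈ Finset.range n, (c i - 1) := by
      have h4 := Finset.sum_biUnion (s := 𝒥) (t := id) (f := fun i => c i - 1)
        (fun J hJ J' hJ' hne => h𝒥d J hJ J' hJ' hne)
      simp only [id] at h4
      rw [← h4]
      refine Finset.sum_le_sum_of_subset (Finset.biUnion_subset.2 fun J hJ => ?_)
      exact (h𝒥 J hJ).1.trans hI
    have h4 : ∑ i ∈ Finset.range n, (c i - 1) + n = N.card := by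
      rw [Finset.card_eq_sum_card_fiberwise (f := f) (t := Finset.range n) (fun v hv => by
        simpa using h.lt v (notMem_of_mem_commonNbrs hv))]
      nth_rewrite 2 [← Finset.card_range n]
      rw [Finset.card_eq_sum_ones, ← Finset.sum_add_distrib]
      refine Finset.sum_congr rfl fun i hi => ?_
      have : 1 ≤ c i := h.one_le_card_commonNbrs_color (Finset.mem_range.1 hi)
      simp only [hc] at this ⊢
      omega
    omega
  · have h1 : 2 * ((∑ J ∈ 𝒥, if J.card = 2 then 1 else 0) + ∑ J ∈ 𝒥, if J.card = 3 then 1 else 0) ≤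
        ∑ J ∈ 𝒥, (J ∩ K.biUnion Dc).card := by
      rw [← Finset.sum_add_distrib, Finset.mul_sum]
      refine Finset.sum_le_sum fun J hJ => ?_
      by_cases e2 : J.card = 2
      · obtain ⟨u, hu, hJu⟩ := hcase2 J hJ e2
        have : J ∩ K.biUnion Dc = J :=
          Finset.inter_eq_left.2 (hJu.trans (Finset.subset_biUnion_of_mem Dc hu))
        rw [this]
        simp [e2]
      · by_cases e3 : J.card = 3
        · have := hcase3 J hJ e3
          simp [e3, this]
        · simp [e2, e3]
    have h2 : ∑ J ∈ 𝒥, (J ∩ K.biUnion Dc).card ≤ (K.biUnion fun u => Dc u ∩ I).card := by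
      refine sum_card_le_of_disjoint (fun J hJ i hi => ?_) ?_
      · obtain ⟨hi1, hi2⟩ := Finset.mem_inter.1 hi
        obtain ⟨u, hu, hiu⟩ := Finset.mem_biUnion.1 hi2
        exact Finset.mem_biUnion.2 ⟨u, hu, Finset.mem_inter.2 ⟨hiu, (h𝒥 J hJ).1 hi1⟩⟩
      · intro J hJ J' hJ' hne
        exact Finset.disjoint_of_subset_left Finset.inter_subset_left
          (Finset.disjoint_of_subset_right Finset.inter_subset_left (h𝒥d J hJ J' hJ' hne))
    exact h1.trans (h2.trans Finset.card_biUnion_le)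
  · have h1 : (∑ J ∈ 𝒥, if J.card = 2 then 1 else 0) ≤
        ∑ u ∈ K, (𝒥.filter fun J => J.card = 2 ∧ J ⊆ Dc u).card := by
      rw [← Finset.card_filter]
      refine (Finset.card_le_card (t := K.biUnion fun u => 𝒥.filter fun J => J.card = 2 ∧ J ⊆ Dc u)
        fun J hJ => ?_).trans Finset.card_biUnion_le
      rw [Finset.mem_filter] at hJ
      obtain ⟨u, hu, hJu⟩ := hcase2 J hJ.1 hJ.2
      exact Finset.mem_biUnion.2 ⟨u, hu, Finset.mem_filter.2 ⟨hJ.1, hJ.2, hJu⟩⟩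
    refine h1.trans (Finset.sum_le_sum fun u _ => ?_)
    rw [Nat.le_div_iff_mul_le (by norm_num)]
    have h2 := Finset.card_nsmul_le_sum (𝒥.filter fun J => J.card = 2 ∧ J ⊆ Dc u)
      (fun J => J.card) 2 fun J hJ => (Finset.mem_filter.1 hJ).2.1.ge
    rw [smul_eq_mul] at h2
    refine h2.trans (sum_card_le_of_disjoint (g := fun J => J) (fun J hJ => ?_) ?_)
    · rw [Finset.mem_filter] at hJ
      exact Finset.subset_inter hJ.2.2 (h𝒥 J hJ.1).1
    · intro J hJ J' hJ' hne
      exact h𝒥d J (Finset.mem_filter.1 hJ).1 J' (Finset.mem_filter.1 hJ').1 hne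

end CriticalColoring

/-- These are the bounds of `Unsplit.card_commonNbrs_le` for `L` without `u`, and without `u` and
`v`; deleting a vertex turns it and its near neighbours into common neighbours. -/
lemma Unsplit.card_add_card_nearNbrs_le {V : Type*} [Fintype V] {G : SimpleGraph V} {n : ℕ}
    (h : Unsplit G 3 n) (hG : ClawFree G) {L : Finset V} (hL : G.IsClique (L : Set V))
    (hLc : L.card = 3) (hLa : ∀ x ∈ L, Avoidable G 3 x) {u v : V} (hu : u ∈ L) (hv : v ∈ L)
    (huv : u ≠ v) : (commonNbrs G L).card + (nearNbrs G L u).card + 5 ≤ 2 * n ∧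
      (commonNbrs G L).card + (nearNbrs G L u).card + (nearNbrs G L v).card + 4 ≤ 2 * n := by
  classical
  have hvu : v ∈ L.erase u := Finset.mem_erase.2 ⟨huv.symm, hv⟩
  have hcl : G.IsClique ((L.erase u : Finset V) : Set V) := hL.subset (by simp)
  have c1 := Finset.card_erase_of_mem hu
  have c2 := Finset.card_erase_of_mem hvu
  obtain ⟨x, hx⟩ := Finset.card_pos.1 (show 0 < ((L.erase u).erase v).card by omega)
  have hxL : x ∈ L := Finset.mem_of_mem_erase (Finset.mem_of_mem_erase hx)
  have h1 := h.card_commonNbrs_le hG (by omega) hcl hvu (hLa v hv)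
  have h2 := h.card_commonNbrs_le hG (by omega) (Q := (L.erase u).erase v) (hcl.subset (by simp)) hx
    (hLa x hxL)
  have e2 := card_commonNbrs_erase hcl hvu
  have e1 := card_commonNbrs_erase hL hu
  have h3 : (nearNbrs G L v).card ≤ (nearNbrs G (L.erase u) v).card := by
    refine Finset.card_le_card fun a ha => ?_
    rw [mem_nearNbrs] at ha ⊢
    exact ⟨ha.1, ha.2.1, fun x hx hxv => ha.2.2 x (Finset.mem_of_mem_erase hx) hxv⟩
  omega

/-- If the clique `L` minimizes the number of common neighbours, a vertex `p` whose only
nonneighbour in `L` is `w` is adjacent to almost all common neighbours of `L \ {w}`. -/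
lemma Unsplit.adj_of_mem_nearNbrs {V : Type*} [Fintype V] [DecidableEq V] {G : SimpleGraph V}
    {n : ℕ} (h : Unsplit G 3 n) {L : Finset V} (hL : G.IsClique (L : Set V))
    (hLc : L.card = 3) (hLa : ∀ x ∈ L, Avoidable G 3 x)
    (hmin : ∀ M : Finset V, G.IsClique (M : Set V) → M.card = 3 → (∀ x ∈ M, Avoidable G 3 x) →
      (commonNbrs G L).card ≤ (commonNbrs G M).card) {w p y v : V} (hw : w ∈ L)
    (hp : p ∈ nearNbrs G L w) (hw2 : (nearNbrs G L w).card = 2) (hy : y ∈ commonNbrs G L)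
    (hpy : ¬ G.Adj p y) (hv : v ∈ commonNbrs G (L.erase w)) (hvp : v ≠ p) (hvw : v ≠ w)
    (hvy : v ≠ y) : G.Adj p v := by
  by_contra hpv
  have hpL := notMem_of_mem_nearNbrs hp
  have hyL := notMem_of_mem_commonNbrs hy
  rw [mem_nearNbrs] at hp
  have h1 := hmin (insert p (L.erase w)) (isClique_exchange hL hp.2.2)
    ((card_exchange hw hpL).trans hLc) (by
      intro x hx
      rcases Finset.mem_insert.1 hx with rfl | hx
      · exact h.avoidable (by omega) x L hL hLc hpL ⟨w, hw, fun e => hp.2.1 e.symm⟩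
      · exact hLa x (Finset.mem_of_mem_erase hx))
  have hyp : y ≠ p := by
    rintro rfl
    exact hp.2.1 (mem_commonNbrs.1 hy w hw)
  have hyw : y ≠ w := fun e => hyL (e ▸ hw)
  -- `L` without `w` has three more common neighbours than `L`. With `p` put in place of `w`, these
  -- four would be lost, contradicting the minimality of `L`.
  have hX : ({v, y, w, p} : Finset V) ⊆ commonNbrs G (L.erase w) := by
    intro a ha
    simp only [Finset.mem_insert, Finset.mem_singleton] at ha
    rcases ha with rfl | rfl | rfl | rfl
    · exact hv
    · exact mem_commonNbrs.2 fun x hx => mem_commonNbrs.1 hy x (Finset.mem_of_mem_erase hx)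
    · exact mem_commonNbrs.2 fun x hx =>
        hL (Finset.mem_of_mem_erase hx) hw (Finset.ne_of_mem_erase hx)
    · exact mem_commonNbrs.2 fun x hx =>
        hp.2.2 x (Finset.mem_of_mem_erase hx) (Finset.ne_of_mem_erase hx)
  have hXc : ({v, y, w, p} : Finset V).card = 4 := by
    rw [Finset.card_insert_of_notMem (by simp [hvy, hvw, hvp]), Finset.card_insert_of_notMem
      (by simp [hyw, hyp]), Finset.card_pair hp.1.symm]
  have hsub : commonNbrs G (insert p (L.erase w)) ⊆
      commonNbrs G (L.erase w) \ ({v, y, w, p} : Finset V) := by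
    intro a ha
    rw [mem_commonNbrs] at ha
    have hpa := ha p (Finset.mem_insert_self _ _)
    rw [Finset.mem_sdiff, mem_commonNbrs]
    refine ⟨fun x hx => ha x (Finset.mem_insert_of_mem hx), fun hmem => ?_⟩
    simp only [Finset.mem_insert, Finset.mem_singleton] at hmem
    rcases hmem with rfl | rfl | rfl | rfl
    · exact hpv hpa
    · exact hpy hpa
    · exact hp.2.1 hpa.symm
    · exact hpa.ne rfl
  have h2 := Finset.card_le_card hsub
  rw [Finset.card_sdiff_of_subset hX, hXc, card_commonNbrs_erase hL hw] at h2
  have h3 := Finset.card_pos.2 ⟨y, hy⟩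
  omega

/-- A first count yields a vertex `w` of `L` with exactly two near neighbours `p` and `q`. A second
count leaves out the class of one of them, and uses a colouring around another vertex `u` together
with the minimality of `L`, which makes `p` and `q` adjacent to nearly all common neighbours. -/
lemma not_unsplit_of_clawFree_three {V : Type*} [Finite V] {G : SimpleGraph V} (hG : ClawFree G)
    {n : ℕ} (hn : n ≤ 9) {K : Finset V} (hK : G.IsClique (K : Set V))
    (hKc : K.card = 3) : ¬ Unsplit G 3 n := by
  classical
  have := Fintype.ofFinite V
  intro h
  obtain ⟨W, hW, hWc, hWa⟩ := h.exists_avoidable_clique (by omega) hK hKc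
  clear hK hKc K
  obtain ⟨L, hL', hmin'⟩ := Finset.exists_min_image
    (Finset.univ.filter fun L : Finset V =>
      G.IsClique (L : Set V) ∧ L.card = 3 ∧ ∀ x ∈ L, Avoidable G 3 x)
    (fun L => (commonNbrs G L).card) ⟨W, by simpa using ⟨hW, hWc, hWa⟩⟩
  clear hWa hWc hW W
  simp only [Finset.mem_filter, Finset.mem_univ, true_and] at hL' hmin'
  obtain ⟨hL, hLc, hLa⟩ := hL'
  have hmin : ∀ M : Finset V, G.IsClique (M : Set V) → M.card = 3 → (∀ x ∈ M, Avoidable G 3 x) →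
      (commonNbrs G L).card ≤ (commonNbrs G M).card := fun M h1 h2 h3 => hmin' M ⟨h1, h2, h3⟩
  clear hmin'
  obtain ⟨f, hf⟩ := h.exists_criticalColoring hG (by omega) hL hLc
  have hnear : ∀ u I, ((nearNbrs G L u).image f ∩ I).card ≤ (nearNbrs G L u).card := fun u I =>
    (Finset.card_le_card Finset.inter_subset_left).trans Finset.card_image_le
  -- a vertex of `L` which is the only nonneighbour of exactly two vertices
  obtain ⟨w, u, v, hwu, hwv, huv, hLeq, hw2, hbw, hbu, hbv, hbuv⟩ : ∃ w u v, w ≠ u ∧ w ≠ v ∧ u ≠ v ∧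
      L = {w, u, v} ∧ (nearNbrs G L w).card = 2 ∧ (commonNbrs G L).card ≤ n + 1 ∧
      (commonNbrs G L).card + (nearNbrs G L w).card + (nearNbrs G L u).card + 4 ≤ 2 * n ∧
      (commonNbrs G L).card + (nearNbrs G L w).card + (nearNbrs G L v).card + 4 ≤ 2 * n ∧
      (commonNbrs G L).card + (nearNbrs G L u).card + (nearNbrs G L v).card + 4 ≤ 2 * n := by
    obtain ⟨a, b, c, hab, hac, hbc, hLeq⟩ := Finset.card_eq_three.1 hLc
    have ha : a ∈ L := by simp [hLeq]
    have hb : b ∈ L := by simp [hLeq]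
    have hc : c ∈ L := by simp [hLeq]
    have hsum : ∀ g : V → ℕ, ∑ x ∈ L, g x = g a + g b + g c := by
      intro g
      rw [hLeq, Finset.sum_insert (by simp [hab, hac]), Finset.sum_pair hbc]
      omega
    obtain ⟨d, hd, hdp⟩ := h.exists_coloring_of_avoidable (by omega) (hLa a ha)
    have h1 := card_image_add_card_le hd hdp hL ha (N := commonNbrs G L)
      fun v hv => mem_commonNbrs.1 hv
    have h2 : (((commonNbrs G L).filter fun v => f v ∈ Finset.range n).image d).card ≤
        ((commonNbrs G L).image d).card :=
      Finset.card_le_card (Finset.image_subset_image (Finset.filter_subset _ _))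
    obtain ⟨f₀, f₁, f₂, e1, e2, e3, e4⟩ := hf.exists_counts hLc (d := d)
      (fun p hp q hq hpq hadj => hdp p (Or.inr (mem_commonNbrs.1 hp a ha)) q
        (Or.inr (mem_commonNbrs.1 hq a ha)) hadj hpq) (I := Finset.range n) subset_rfl
      (by rw [Finset.card_range]; omega)
    rw [hsum] at e3 e4
    have na := hnear a (Finset.range n)
    have nb := hnear b (Finset.range n)
    have nc := hnear c (Finset.range n)
    have bab := h.card_add_card_nearNbrs_le hG hL hLc hLa ha hb hab
    have bbc := h.card_add_card_nearNbrs_le hG hL hLc hLa hb hc hbc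
    have bca := h.card_add_card_nearNbrs_le hG hL hLc hLa hc ha hac.symm
    -- For `n ≤ 9` two vertices of `L` have together at most 5 near neighbours, and one fewer for
    -- each common neighbour beyond `n`. Two or more such common neighbours are then impossible, and
    -- each surviving distribution has a vertex with exactly two near neighbours.
    have : (commonNbrs G L).card ≤ n + 1 ∧ ((nearNbrs G L a).card = 2 ∨ (nearNbrs G L b).card = 2 ∨
        (nearNbrs G L c).card = 2) := by omega
    obtain ⟨hp, h2 | h2 | h2⟩ := this
    · exact ⟨a, b, c, hab, hac, hbc, hLeq, h2, hp, by omega, by omega, by omega⟩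
    · exact ⟨b, a, c, hab.symm, hbc, hac, by rw [hLeq, Finset.insert_comm], h2, hp, by omega,
        by omega, by omega⟩
    · exact ⟨c, a, b, hac.symm, hbc.symm, hab, by
        rw [hLeq]
        ext m
        simp only [Finset.mem_insert, Finset.mem_singleton]
        tauto, h2, hp, by omega, by omega, by omega⟩
  have hw : w ∈ L := by simp [hLeq]
  have hu : u ∈ L := by simp [hLeq]
  have hsum : ∀ g : V → ℕ, ∑ x ∈ L, g x = g w + g u + g v := by
    intro g
    rw [hLeq, Finset.sum_insert (by simp [hwu, hwv]), Finset.sum_pair huv]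
    omega
  have huw : u ∈ L.erase w := Finset.mem_erase.2 ⟨hwu.symm, hu⟩
  obtain ⟨d, hd, hdp⟩ := h.exists_coloring_of_avoidable (by omega) (hLa u hu)
  have hd1 := card_image_add_card_le hd hdp (Q := L.erase w) (hL.subset (by simp)) huw
    (N := commonNbrs G (L.erase w)) fun v hv => mem_commonNbrs.1 hv
  rw [Finset.card_erase_of_mem hw, hLc] at hd1
  have hdne : ∀ a ∈ commonNbrs G (L.erase w), ∀ b ∈ commonNbrs G (L.erase w), G.Adj a b → d a ≠ d b :=
    fun a ha b hb => hdp a (Or.inr (mem_commonNbrs.1 ha u huw)) b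
      (Or.inr (mem_commonNbrs.1 hb u huw))
  have hsub : ∀ a ∈ commonNbrs G L, a ∈ commonNbrs G (L.erase w) := fun a ha =>
    mem_commonNbrs.2 fun x hx => mem_commonNbrs.1 ha x (Finset.mem_of_mem_erase hx)
  have hwm : w ∈ commonNbrs G (L.erase w) := mem_commonNbrs.2 fun x hx =>
    hL (Finset.mem_of_mem_erase hx) hw (Finset.ne_of_mem_erase hx)
  have hnm : ∀ p ∈ nearNbrs G L w, p ∈ commonNbrs G (L.erase w) := fun p hp =>
    mem_commonNbrs.2 fun x hx => (mem_nearNbrs.1 hp).2.2 x (Finset.mem_of_mem_erase hx)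
      (Finset.ne_of_mem_erase hx)
  have hadj : ∀ p ∈ nearNbrs G L w, ∀ a ∈ commonNbrs G (L.erase w), a ≠ p → a ≠ w →
      (a ∈ commonNbrs G L → f a ≠ f p) → G.Adj p a := by
    intro p hp a ha hap haw hfa
    have hpL := notMem_of_mem_nearNbrs hp
    obtain ⟨y, hy, hfy, hyL⟩ := hf.exists_common (hf.lt p hpL)
    exact h.adj_of_mem_nearNbrs hL hLc hLa hmin hw hp hw2 (mem_commonNbrs.2 hyL)
      (hf.not_adj hpL hy hfy.symm) ha hap haw (fun e => hfa (mem_commonNbrs.2 (e ▸ hyL)) (e ▸ hfy))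
  -- it is enough to find two colours of `d` not used on the common neighbours outside a class
  have hfin : ∀ e ∈ nearNbrs G L w, ∀ a ∈ commonNbrs G (L.erase w),
      ∀ b ∈ commonNbrs G (L.erase w), d a ≠ d b →
      (∀ z ∈ commonNbrs G L, f z ≠ f e → d z ≠ d a ∧ d z ≠ d b) → False := by
    intro e he a ha b hb hab hz
    set M := (commonNbrs G L).filter fun z => f z ∈ (Finset.range n).erase (f e) with hM
    have hen : f e < n := hf.lt e (notMem_of_mem_nearNbrs he)
    have h1 : (M.image d).card + 2 ≤ ((commonNbrs G (L.erase w)).image d).card := by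
      have hMz : ∀ z ∈ M, z ∈ commonNbrs G L ∧ f z ≠ f e := fun z hz =>
        ⟨(Finset.mem_filter.1 hz).1, Finset.ne_of_mem_erase (Finset.mem_filter.1 hz).2⟩
      have hb' : d b ∉ M.image d := by
        intro hmem
        obtain ⟨z, hzM, hdz⟩ := Finset.mem_image.1 hmem
        exact (hz z (hMz z hzM).1 (hMz z hzM).2).2 hdz
      have ha' : d a ∉ insert (d b) (M.image d) := by
        rw [Finset.mem_insert, not_or]
        refine ⟨hab, fun hmem => ?_⟩
        obtain ⟨z, hzM, hdz⟩ := Finset.mem_image.1 hmem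
        exact (hz z (hMz z hzM).1 (hMz z hzM).2).1 hdz
      rw [show (M.image d).card + 2 = (insert (d a) (insert (d b) (M.image d))).card by
        rw [Finset.card_insert_of_notMem ha', Finset.card_insert_of_notMem hb']]
      refine Finset.card_le_card fun i hi => ?_
      rw [Finset.mem_insert, Finset.mem_insert] at hi
      rcases hi with rfl | rfl | hi
      · exact Finset.mem_image_of_mem d ha
      · exact Finset.mem_image_of_mem d hb
      · obtain ⟨z, hzM, rfl⟩ := Finset.mem_image.1 hi
        exact Finset.mem_image_of_mem d (hsub z (hMz z hzM).1)
    -- Here `d` uses at most `n - 2` colours on the common neighbours of `L` without `w`, hence at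
    -- most `n - 4` on `M`, against `n - 1` classes. With one near class left at `w`, the counts
    -- need three pairs from `u` and `v`, or five near neighbours there plus an extra common
    -- neighbour; the bounds permit neither.
    obtain ⟨f₀, f₁, f₂, e1, e2, e3, e4⟩ := hf.exists_counts hLc (d := d)
      (fun p hp q hq hpq hadj => hdne p (hsub p hp) q (hsub q hq) hadj hpq)
      (I := (Finset.range n).erase (f e)) (Finset.erase_subset _ _) (by
        rw [Finset.card_erase_of_mem (Finset.mem_range.2 hen), Finset.card_range]
        have h2 : (M.image d).card + 3 ≤ n - 1 := by omega
        convert h2)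
    rw [hsum] at e3 e4
    have nu := hnear u ((Finset.range n).erase (f e))
    have nv := hnear v ((Finset.range n).erase (f e))
    have nw : ((nearNbrs G L w).image f ∩ (Finset.range n).erase (f e)).card ≤ 1 := by
      have h2 : (nearNbrs G L w).image f ∩ (Finset.range n).erase (f e) ⊆
          ((nearNbrs G L w).image f).erase (f e) := by
        intro i hi
        obtain ⟨hi1, hi2⟩ := Finset.mem_inter.1 hi
        exact Finset.mem_erase.2 ⟨Finset.ne_of_mem_erase hi2, hi1⟩
      have h3 := Finset.card_le_card h2
      rw [Finset.card_erase_of_mem (Finset.mem_image_of_mem f he)] at h3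
      have h4 : ((nearNbrs G L w).image f).card ≤ (nearNbrs G L w).card := Finset.card_image_le
      omega
    omega
  obtain ⟨p, q, hpq, hpqeq⟩ := Finset.card_eq_two.1 hw2
  have hp : p ∈ nearNbrs G L w := by rw [hpqeq]; simp
  have hq : q ∈ nearNbrs G L w := by rw [hpqeq]; simp
  have hnotcom : ∀ r ∈ nearNbrs G L w, r ∉ commonNbrs G L := fun r hr hr' =>
    (mem_nearNbrs.1 hr).2.1 (mem_commonNbrs.1 hr' w hw)
  have hpqadj : G.Adj p q := hadj p hp q (hnm q hq) hpq.symm (mem_nearNbrs.1 hq).1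
    fun h' => absurd h' (hnotcom q hq)
  have hdw : ∀ z ∈ commonNbrs G L, d z ≠ d w := fun z hz =>
    (hdne w hwm z (hsub z hz) (mem_commonNbrs.1 hz w hw)).symm
  have hdnear : ∀ r ∈ nearNbrs G L w, ∀ z ∈ commonNbrs G L, f z ≠ f r → d z ≠ d r := by
    intro r hr z hz hfz
    exact (hdne r (hnm r hr) z (hsub z hz) (hadj r hr z (hsub z hz)
      (fun e => hnotcom r hr (e ▸ hz)) (fun e => notMem_of_mem_commonNbrs hz (e ▸ hw))
      fun _ => hfz)).symm
  -- The two spare colours are that of `w` and that of `p` or `q`; as `p` and `q` are adjacent, at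
  -- most one of them shares the colour of `w`.
  by_cases hwq : d w = d q
  · exact hfin p hp w hwm p (hnm p hp) (by
      rw [hwq]
      exact (hdne p (hnm p hp) q (hnm q hq) hpqadj).symm)
      fun z hz hfz => ⟨hdw z hz, hdnear p hp z hz hfz⟩
  · exact hfin q hq w hwm q (hnm q hq) hwq fun z hz hfz => ⟨hdw z hz, hdnear q hq z hz hfz⟩

/-! ### Assembling the cases -/

theorem not_unsplit_of_clawFree {V : Type*} [Finite V] {G : SimpleGraph V} (hG : ClawFree G)
    {s n : ℕ} (hs : 2 ≤ s) (hn : 1 ≤ n) (hns : n + 1 ≤ 4 * s - 3 ∨ s = 3 ∧ n ≤ 9) {K : Finset V}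
    (hK : G.IsClique (K : Set V)) (hKc : K.card = s) : ¬ Unsplit G s n := by
  by_cases h1 : n ≤ s + 1
  · exact not_unsplit_of_le hs hn h1 hK hKc
  · obtain rfl | rfl | h4 : s = 2 ∨ s = 3 ∨ 4 ≤ s := by omega
    · obtain rfl : n = 4 := by omega
      exact not_unsplit_of_clawFree_two hG hK hKc
    · exact not_unsplit_of_clawFree_three hG (by omega) hK hKc
    · exact not_unsplit_of_clawFree_of_four_le hG h4 (by omega) (by omega) hK hKc

theorem mainTheorem4 {V : Type*} [Finite V] (G : SimpleGraph V) :
    (∀ s t : ℕ, 2 ≤ s → 2 ≤ t → t ≤ s + 2 → ContainsComplete G s → ErdosLovaszTihany s t G) ∧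
    (∀ s t : ℕ, 2 ≤ s → 2 ≤ t → t ≤ 4 * s - 3 → ClawFree G → ContainsComplete G s →
      ErdosLovaszTihany s t G) ∧
    (∀ t : ℕ, 2 ≤ t → t ≤ 10 → ClawFree G → ErdosLovaszTihany 3 t G) ∧
    (∀ t : ℕ, 2 ≤ t → t ≤ 5 → ErdosLovaszTihany 3 t G) := by
  refine ⟨?_, ?_, ?_, ?_⟩
  · intro s t hs ht hst hK
    obtain ⟨K, hK, hKc⟩ := exists_clique_of_containsComplete hK
    exact erdosLovaszTihany_of_not_unsplit hs ht
      (not_unsplit_of_le hs (by omega) (by omega) hK hKc)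
  · intro s t hs ht hst hG hK
    obtain ⟨K, hK, hKc⟩ := exists_clique_of_containsComplete hK
    exact erdosLovaszTihany_of_not_unsplit hs ht
      (not_unsplit_of_clawFree hG hs (by omega) (Or.inl (by omega)) hK hKc)
  · intro t ht ht' hG
    refine erdosLovaszTihany_of_not_unsplit (by omega) ht ?_
    by_cases h3 : ∃ K : Finset V, G.IsClique (K : Set V) ∧ K.card = 3
    · obtain ⟨K, hK, hKc⟩ := h3
      exact not_unsplit_of_clawFree hG (by omega) (by omega) (Or.inr ⟨rfl, by omega⟩) hK hKc
    · push Not at h3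
      -- A triangle-free claw-free graph needs at most three colours, and here `3 + (t - 1) - 1 ≥
      -- 3`.
      exact fun h => h.notCol ((hG.colOn_three h3).mono subset_rfl (by omega))
  · intro t ht ht'
    refine erdosLovaszTihany_of_not_unsplit (by omega) ht ?_
    by_cases h3 : ∃ K : Finset V, G.IsClique (K : Set V) ∧ K.card = 3
    · obtain ⟨K, hK, hKc⟩ := h3
      exact not_unsplit_of_le (by omega) (by omega) (by omega) hK hKc
    · push Not at h3
      exact not_unsplit_three_of_triangleFree (by omega) h3
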